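/- Let $\Bbbk$ be an algebraically closed field of characteristic $0$, $G$ a finite abelian group, $\Gamma=\mathrm{Hom}(G,\Bbbk^\times)$, and let $\mathcal D=(G,\chi,a,\alpha)$ be a group datum: $\chi\in\Gamma$, $a\in G$, $\alpha\in\Bbbk$, and $\chi^n=1$ or $\alpha(a^n-1)=0$ in $\Bbbk G$, where $n$ is the order of $\rho:=\chi(a)$. The datum is of nilpotent type if $\alpha(a^n-1)=0$ and of non-nilpotent type otherwise; in the latter case we assume, as usual, $\alpha=1$. For $q\in\Bbbk$ put $(i)_q=1+q+\dots+q^{i-1}$ and $(i)!_q=(1)_q\cdots(i)_q$. Let $D(H_{\mathcal D})$ be the Drinfeld double of the rank one pointed Hopf algebra $H_{\mathcal D}$, that is, the $\Bbbk$-algebra generated by the groups $G$, $\Gamma$ and elements $x,\xi$ with the relations $$x^n=\alpha(a^n-1),\quad xg=\chi(g)gx,\quad \xi^n=0,\quad \xi\gamma=\gamma(a)\gamma\xi,\quad g\gamma=\gamma g,\quad \xi g=\chi^{-1}(g)g\xi,\quad x\xi-\xi x=a-\chi$$ for $g\in G$, $\gamma\in\Gamma$, together with $\gamma(a)x\gamma=\gamma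 x$ in the nilpotent case and $\gamma(a)x\gamma=\gamma x+\frac{\gamma(a)^n-1}{(n-1)!_\rho}\gamma(\rho a-\chi)\xi^{n-1}$ in the non-nilpotent case. Let $m=\frac1n\mathrm{ord}(a)$ in the non-nilpotent case and $m=\frac1n\mathrm{lcm}(\mathrm{ord}(a),\mathrm{ord}(\chi))$ in the nilpotent case, and assume $m>1$. Let $\Lambda$ be the group of characters of $G\times\Gamma$ (write $g\gamma$ for $(g,\gamma)$) and let $\phi\in\Lambda$, $\phi(g\gamma)=\chi(g)^{-1}\gamma(a)$. For $\lambda\in\Lambda$ let $d(\lambda)=s$ if $\lambda(a\chi^{-1})=\rho^s$ with $0\le s\le n-2$, and $d(\lambda)=-1$ if there is no such $s$. Put $\sigma(\lambda)=\lambda\phi^{d(\lambda)+1}$ and $\tau=\sigma^2$ (a permutation of $\Lambda$), and for $1\le l\le n-1$ let $I_l=\{\lambda\in\Lambda:\lambda(a\chi^{-1})=\rho^{l-1}\}$. For $\lambda\in\Lambda$ put $\alpha_i(\lambda)=(i)_\rho(\lambda(\chi)-\lambda(a)\rho^{1-i})$ and $z_\lambda=\frac{\rho\lambda(a)-\lambda(\chi)}{(n-1)!_\rho}$.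 For $1\le l\le n-1$, $\lambda\in I_l$ and $\eta\in\Bbbk^\times$ let $M_1(l,\lambda,\eta)$ be the $D(H_{\mathcal D})$-module with $\Bbbk$-basis $x_j^k$ ($0\le j\le n-1$, $0\le k\le m-1$) and the following action, where $x_j^m$ means $\eta x_j^0$. * Nilpotent type: $x_j^k$ has weight $\phi^{j+l}\tau^k(\lambda)$ for $j\le n-l-1$ and $\phi^{j-n+l}\tau^k(\lambda)$ for $j\ge n-l$; $x\cdot x_j^k=x_{j+1}^k$ for $j\ne n-l-1,n-1$, $x\cdot x_{n-l-1}^k=x_{n-l}^{k+1}$, $x\cdot x_{n-1}^k=0$; $\xi\cdot x_0^k=x_{n-1}^k$, $\xi\cdot x_j^k=\alpha_j(\sigma(\lambda))x_{j-1}^k$ for $1\le j\le n-l-1$, $\xi\cdot x_{n-l}^k=0$, $\xi\cdot x_j^k=\alpha_{j-n+l}(\lambda)x_{j-1}^k$ for $n-l+1\le j\le n-1$. * Non-nilpotent type: $x_j^k$ has weight $\phi^j\tau^k(\lambda)$; $x\cdot x_j^k=\alpha_{j+1}(\lambda)x_{j+1}^k$ for $j\le l-2$, $x\cdot x_{l-1}^k=0$,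 $x\cdot x_j^k=\alpha_{j+1-l}(\sigma(\lambda))x_{j+1}^k$ for $l\le j\le n-2$, $x\cdot x_{n-1}^k=z_\lambda x_0^k+x_0^{k+1}$; $\xi\cdot x_0^k=0$, $\xi\cdot x_j^k=x_{j-1}^k$ for $j\ge1$. Here "$v$ has weight $\mu$" means $(g\gamma)v=\mu(g\gamma)v$ for all $g\in G$, $\gamma\in\Gamma$. A module is of $(s,t)$-type if it is indecomposable of radical (Loewy) length $2$, its head has length $s$ and its socle has length $t$. For $t\ge2$, $M_t(l,\lambda,\eta)$ denotes an indecomposable $D(H_{\mathcal D})$-module of $(tm,tm)$-type that has a submodule isomorphic to $M_{t-1}(l,\lambda,\eta)$ with quotient isomorphic to $M_1(l,\lambda,\eta)$. Then such modules $M_t(l,\lambda,\eta)$ exist for all integers $t\ge1$, $1\le l\le n-1$, all $\lambda\in I_l$ and all $\eta\in\Bbbk^\times$. Moreover, for all $\eta,\eta'\in\Bbbk^\times$, all integers $l,l',t,t'$ with $1\le l,l'\le n-1$ and $t,t'\ge1$, and all $\lambda\in I_l$, $\lambda'\in I_{l'}$ (and for every choice of the modules $M_t(l,\lambda,\eta)$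 and $M_{t'}(l',\lambda',\eta')$), $$M_t(l,\lambda,\eta)\cong M_{t'}(l',\lambda',\eta')\iff t=t',\ l=l',\ \eta=\eta'\ \text{ and }\ \lambda'=\tau^k(\lambda)\text{ for some integer }k.$$ In particular $M_t(l,\lambda,\eta)$ is determined up to isomorphism by $(t,l,\lambda,\eta)$. -/

import Mathlib

universe u v w

/-- The `q`-number `(j)_q = 1 + q + ⋯ + q^(j-1)`. -/
def qNumber {k : Type u} [Field k] (q : k) (j : ℕ) : k := ∑ i ∈ Finset.range j, q ^ i

/-- The `q`-factorial `(j)!_q = (j)_q (j-1)_q ⋯ (1)_q`, with `(0)!_q = 1`. -/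
def qFactorial {k : Type u} [Field k] (q : k) (j : ℕ) : k :=
  ∏ i ∈ Finset.range j, qNumber q (i + 1)

/-- The group `Hom(G, kˣ)` of `k`-valued characters of `G`. -/
def Chr (k : Type u) [Field k] (G : Type v) [CommGroup G] : Type (max u v) := G →* kˣ

namespace Chr

variable {k : Type u} [Field k] {G : Type v} [CommGroup G]

instance : CommGroup (Chr k G) := inferInstanceAs (CommGroup (G →* kˣ))

instance : FunLike (Chr k G) G kˣ := inferInstanceAs (FunLike (G →* kˣ) G kˣ)

instance : MonoidHomClass (Chr k G) G kˣ := inferInstanceAs (MonoidHomClass (G →* kˣ) G kˣ)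

theorem mul_apply (γ γ' : Chr k G) (h : G) : (γ * γ') h = γ h * γ' h := rfl

theorem one_apply (h : G) : (1 : Chr k G) h = 1 := rfl

theorem inv_apply (γ : Chr k G) (h : G) : (γ⁻¹) h = (γ h)⁻¹ := rfl

/-- Evaluation at `h` as a homomorphism. -/
def ev (h : G) : Chr k G →* kˣ where
  toFun γ := γ h
  map_one' := rfl
  map_mul' _ _ := rfl

theorem pow_apply (γ : Chr k G) (j : ℕ) (h : G) : (γ ^ j) h = γ h ^ j := map_pow (ev h) γ j

theorem zpow_apply (γ : Chr k G) (j : ℤ) (h : G) : (γ ^ j) h = γ h ^ j := map_zpow (ev h) γ j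

end Chr

/-- A group datum `(G, χ, a, α)` with `G` a finite abelian group. In the group algebra,
`α (a^n - 1) = 0` means `α = 0` or `a^n = 1`, where `n` is the order of `χ(a)`.
As usual, `α = 1` is assumed when the datum is of non-nilpotent type. -/
structure GroupDatum (k : Type u) [Field k] (G : Type v) [CommGroup G] where
  chi : Chr k G
  a : G
  alpha : k
  cond : chi ^ orderOf (chi a) = 1 ∨ alpha = 0 ∨ a ^ orderOf (chi a) = 1
  normalized : ¬ (alpha = 0 ∨ a ^ orderOf (chi a) = 1) → alpha = 1

namespace GroupDatum

section Basic

variable {k : Type u} [Field k] {G : Type v} [CommGroup G] (D : GroupDatum k G)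

/-- `ρ = χ(a)`. -/
def rho : kˣ := D.chi D.a

/-- `n`, the order of `ρ`. -/
noncomputable def n : ℕ := orderOf D.rho

/-- The datum is of nilpotent type: `α (a^n - 1) = 0`. -/
def Nilpotent : Prop := D.alpha = 0 ∨ D.a ^ D.n = 1

open Classical in
/-- `m = ord(a)/n` in the non-nilpotent case and `m = lcm(ord(a), ord(χ))/n` otherwise. -/
noncomputable def m : ℕ :=
  if D.Nilpotent then Nat.lcm (orderOf D.a) (orderOf D.chi) / D.n else orderOf D.a / D.n

/-- The generators of the Drinfeld double: the elements `g` of `G`, the characters `γ` in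
`Γ = Hom(G, kˣ)`, and `x`, `ξ`. -/
inductive Gen (k : Type u) [Field k] (G : Type v) [CommGroup G] : Type (max u v)
  | g (g : G) : Gen k G
  | c (γ : Chr k G) : Gen k G
  | x : Gen k G
  | xi : Gen k G

/-- Abbreviation for a generator in the free algebra. -/
def gen (y : Gen k G) : FreeAlgebra k (Gen k G) := FreeAlgebra.ι k y

open Gen in
/-- The defining relations of the Drinfeld double: those of `H_D` (generated by `G` and `x`),
those of its dual with opposite comultiplication (generated by `Γ` and `ξ`), and the cross
relations. -/
inductive Rel : FreeAlgebra k (Gen k G) → FreeAlgebra k (Gen k G) → Prop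
  | g_one : Rel (gen (g 1)) 1
  | g_mul (h h' : G) : Rel (gen (g (h * h'))) (gen (g h) * gen (g h'))
  | c_one : Rel (gen (c 1)) 1
  | c_mul (γ γ' : Chr k G) : Rel (gen (c (γ * γ'))) (gen (c γ) * gen (c γ'))
  | x_pow : Rel (gen x ^ D.n) (D.alpha • (gen (g D.a) ^ D.n - 1))
  | x_g (h : G) : Rel (gen x * gen (g h)) ((D.chi h : k) • (gen (g h) * gen x))
  | xi_pow : Rel (gen xi ^ D.n) 0
  | xi_c (γ : Chr k G) : Rel (gen xi * gen (c γ)) ((γ D.a : k) • (gen (c γ) * gen xi))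
  | g_c (h : G) (γ : Chr k G) : Rel (gen (g h) * gen (c γ)) (gen (c γ) * gen (g h))
  | xi_g (h : G) : Rel (gen xi * gen (g h)) ((((D.chi h)⁻¹ : kˣ) : k) • (gen (g h) * gen xi))
  | x_xi : Rel (gen x * gen xi - gen xi * gen x) (gen (g D.a) - gen (c D.chi))
  | x_c_nil (hD : D.Nilpotent) (γ : Chr k G) :
      Rel ((γ D.a : k) • (gen x * gen (c γ))) (gen (c γ) * gen x)
  | x_c_non (hD : ¬ D.Nilpotent) (γ : Chr k G) :
      Rel ((γ D.a : k) • (gen x * gen (c γ)))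
        (gen (c γ) * gen x
          + (((γ D.a : k) ^ D.n - 1) / qFactorial (D.rho : k) (D.n - 1)) •
            (gen (c γ) * ((D.rho : k) • gen (g D.a) - gen (c D.chi)) * gen xi ^ (D.n - 1)))

/-- The Drinfeld double `D(H_D)`, by generators and relations. -/
abbrev Double : Type (max u v) := RingQuot D.Rel

/-- The group `Λ` of characters of `G × Γ`. -/
abbrev Weight (k : Type u) [Field k] (G : Type v) [CommGroup G] : Type (max u v) :=
  Chr k (G × Chr k G)

/-- The character `φ = χ⁻¹ â` of `G × Γ`, where `â(γ) = γ(a)`. -/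
def phi : Weight k G := show (G × Chr k G) →* kˣ from
  { toFun := fun p => (D.chi p.1)⁻¹ * p.2 D.a
    map_one' := by simp [Chr.one_apply]
    map_mul' := fun p q => by
      simp only [Prod.fst_mul, Prod.snd_mul, map_mul, mul_inv, Chr.mul_apply]
      exact mul_mul_mul_comm _ _ _ _ }

theorem phi_apply (h : G) (γ : Chr k G) : D.phi (h, γ) = (D.chi h)⁻¹ * γ D.a := rfl

/-- `λ(a χ⁻¹)`. -/
def evA (lam : Weight k G) : kˣ := lam (D.a, D.chi⁻¹)

/-- The weights that map `a χ⁻¹` to `ρ^s` for some `0 ≤ s ≤ n - 2`. -/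
def LambdaTilde : Set (Weight k G) := {lam | ∃ s : ℕ, s + 2 ≤ D.n ∧ D.evA lam = D.rho ^ s}

open Classical in
/-- `d(λ)`: the exponent `s` with `λ(a χ⁻¹) = ρ^s`, `0 ≤ s ≤ n - 2`, if there is one, else `-1`. -/
noncomputable def d (lam : Weight k G) : ℤ :=
  if h : ∃ s : ℕ, s + 2 ≤ D.n ∧ D.evA lam = D.rho ^ s then (Nat.find h : ℤ) else -1

/-- `σ(λ) = λ φ^(d(λ)+1)`. -/
noncomputable def sigma (lam : Weight k G) : Weight k G := lam * D.phi ^ (D.d lam + 1)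

/-- `I_l`, used for `1 ≤ l ≤ n - 1`. -/
def I (l : ℕ) : Set (Weight k G) := {lam ∈ D.LambdaTilde | D.evA lam = D.rho ^ (l - 1)}

variable {D}

theorem evA_mul (lam mu : Weight k G) : D.evA (lam * mu) = D.evA lam * D.evA mu := rfl

theorem evA_phi_zpow (z : ℤ) : D.evA (D.phi ^ z) = D.rho ^ (-2 * z) := by
  have h1 : D.evA D.phi = D.rho ^ (-2 : ℤ) := by
    simp [evA, phi_apply, rho, Chr.inv_apply, zpow_neg, zpow_ofNat, pow_two]
  rw [zpow_mul, ← h1]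
  exact Chr.zpow_apply _ _ _

theorem d_eq {lam : Weight k G} {s : ℕ} (hs : s + 2 ≤ D.n) (h : D.evA lam = D.rho ^ s) :
    D.d lam = s := by
  classical
  have hex : ∃ s : ℕ, s + 2 ≤ D.n ∧ D.evA lam = D.rho ^ s := ⟨s, hs, h⟩
  unfold d
  rw [dif_pos hex]
  obtain ⟨h1, h2⟩ := Nat.find_spec hex
  have := pow_injOn_Iio_orderOf (x := D.rho)
    (show Nat.find hex < D.n by omega) (show s < D.n by omega) (h2.symm.trans h)
  exact_mod_cast this

theorem sigma_of_notMem {lam : Weight k G} (h : lam ∉ D.LambdaTilde) : D.sigma lam = lam := by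
  classical
  have : D.d lam = -1 := dif_neg h
  simp [sigma, this]

theorem rho_zpow_n : D.rho ^ (D.n : ℤ) = 1 := by
  rw [zpow_natCast]; exact pow_orderOf_eq_one _

theorem evA_mul_phi {lam : Weight k G} {s : ℕ} (hs : s + 2 ≤ D.n) (h : D.evA lam = D.rho ^ s)
    (z j : ℤ) (hz : z = s + 1 + j * D.n) :
    D.evA (lam * D.phi ^ z) = D.rho ^ (D.n - 2 - s) := by
  have e : ((D.n - 2 - s : ℕ) : ℤ) = D.n - 2 - s := by omega
  rw [evA_mul, evA_phi_zpow, h, ← zpow_natCast, ← zpow_natCast, ← zpow_add, e,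
    show (s : ℤ) + -2 * z = ((D.n : ℤ) - 2 - s) + (D.n : ℤ) * (-1 - 2 * j) by rw [hz]; ring,
    zpow_add, zpow_mul, rho_zpow_n, one_zpow, mul_one]

theorem evA_sigma {lam : Weight k G} {s : ℕ} (hs : s + 2 ≤ D.n) (h : D.evA lam = D.rho ^ s) :
    D.evA (D.sigma lam) = D.rho ^ (D.n - 2 - s) := by
  unfold sigma
  exact evA_mul_phi hs h _ 0 (by rw [d_eq hs h]; ring)

theorem sigma_bijective : Function.Bijective D.sigma := by
  constructor
  · intro lam mu hlm
    by_cases h1 : lam ∈ D.LambdaTilde <;> by_cases h2 : mu ∈ D.LambdaTilde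
    · obtain ⟨s, hs, h⟩ := h1
      obtain ⟨t, ht, h'⟩ := h2
      have e1 := evA_sigma hs h
      have e2 := evA_sigma ht h'
      have e3 := d_eq (by omega) e1
      rw [hlm, d_eq (by omega) e2] at e3
      have : s = t := by omega
      subst this
      unfold sigma at hlm
      rw [d_eq hs h, d_eq ht h'] at hlm
      exact mul_right_cancel hlm
    · obtain ⟨s, hs, h⟩ := h1
      rw [sigma_of_notMem h2] at hlm
      exact absurd ⟨_, by omega, hlm ▸ evA_sigma hs h⟩ h2
    · obtain ⟨s, hs, h⟩ := h2
      rw [sigma_of_notMem h1] at hlm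
      exact absurd ⟨_, by omega, hlm ▸ evA_sigma hs h⟩ h1
    · rwa [sigma_of_notMem h1, sigma_of_notMem h2] at hlm
  · intro mu
    by_cases h2 : mu ∈ D.LambdaTilde
    · obtain ⟨s, hs, h⟩ := h2
      refine ⟨mu * D.phi ^ ((s : ℤ) + 1 - D.n), ?_⟩
      have e := evA_mul_phi hs h ((s : ℤ) + 1 - D.n) (-1) (by ring)
      unfold sigma
      rw [d_eq (by omega) e, mul_assoc, ← zpow_add]
      rw [show ((s : ℤ) + 1 - D.n + (((D.n - 2 - s : ℕ) : ℤ) + 1)) = 0 by omega]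
      simp
    · exact ⟨mu, sigma_of_notMem h2⟩

variable (D)

/-- `τ = σ²`, as a permutation of `Λ`. -/
noncomputable def tau : Equiv.Perm (Weight k G) := (Equiv.ofBijective D.sigma sigma_bijective) ^ 2

/-- The scalars `α_i(l, λ) = (i)_ρ (λ(χ) - λ(a) ρ^(1-i))` (they do not depend on `l`). -/
def alphaCoeff (i : ℕ) (lam : Weight k G) : k :=
  qNumber (D.rho : k) i *
    ((lam (1, D.chi) : k) - (lam (D.a, 1) : k) * ((D.rho ^ (1 - (i : ℤ)) : kˣ) : k))

/-- The scalar `z_{l,λ} = (ρ λ(a) - λ(χ)) / (n-1)!_ρ`. -/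
noncomputable def zCoeff (lam : Weight k G) : k :=
  ((D.rho : k) * (lam (D.a, 1) : k) - (lam (1, D.chi) : k)) / qFactorial (D.rho : k) (D.n - 1)

/-- The underlying vector space of `M₁(l, λ, η)`, with basis indexed by `0 ≤ k < m`, `0 ≤ j < n`. -/
abbrev Space : Type u := (Fin D.m × Fin D.n) →₀ k

/-- The basis vector `x_j^i` (upper index `i < m`, lower index `j < n`; zero out of range). -/
noncomputable def e (i j : ℕ) : D.Space :=
  if h : i < D.m ∧ j < D.n then Finsupp.single (⟨i, h.1⟩, ⟨j, h.2⟩) 1 else 0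

/-- `x_j^(i+1)` if `i < m - 1`, and `η x_j^0` if `i = m - 1`. -/
noncomputable def next (η : kˣ) (i j : ℕ) : D.Space :=
  if i + 1 < D.m then D.e (i + 1) j else (η : k) • D.e 0 j

open Classical in
/-- The weight of the basis vector `x_j^i` of `M₁(l, λ, η)`. -/
noncomputable def wt (l : ℕ) (lam : Weight k G) (i j : ℕ) : Weight k G :=
  if D.Nilpotent then
    if j < D.n - l then D.phi ^ (j + l) * (D.tau ^ i) lam
    else D.phi ^ (j - (D.n - l)) * (D.tau ^ i) lam
  else D.phi ^ j * (D.tau ^ i) lam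

open Classical in
/-- The vector `x · x_j^i` in `M₁(l, λ, η)`. -/
noncomputable def xImage (l : ℕ) (lam : Weight k G) (η : kˣ) (i j : ℕ) : D.Space :=
  if D.Nilpotent then
    if j + 1 < D.n - l then D.e i (j + 1)
    else if j + 1 = D.n - l then D.next η i (D.n - l)
    else if j + 1 < D.n then D.e i (j + 1)
    else 0
  else
    if j + 1 < l then D.alphaCoeff (j + 1) lam • D.e i (j + 1)
    else if j + 1 = l then 0
    else if j + 1 < D.n then D.alphaCoeff (j + 1 - l) (D.sigma lam) • D.e i (j + 1)
    else D.zCoeff lam • D.e i 0 + D.next η i 0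

open Classical in
/-- The vector `ξ · x_j^i` in `M₁(l, λ, η)`. -/
noncomputable def xiImage (l : ℕ) (lam : Weight k G) (i j : ℕ) : D.Space :=
  if D.Nilpotent then
    if j = 0 then D.e i (D.n - 1)
    else if j < D.n - l then D.alphaCoeff j (D.sigma lam) • D.e i (j - 1)
    else if j = D.n - l then 0
    else D.alphaCoeff (j - (D.n - l)) lam • D.e i (j - 1)
  else
    if j = 0 then 0 else D.e i (j - 1)

/-- The linear endomorphism with prescribed values on the basis vectors `x_j^i`. -/
noncomputable def ofImages (f : ℕ → ℕ → D.Space) : Module.End k D.Space :=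
  Finsupp.linearCombination k (fun p : Fin D.m × Fin D.n => f p.1 p.2)

/-- The operator on `M₁(l, λ, η)` by which a generator acts. -/
noncomputable def genAction (l : ℕ) (lam : Weight k G) (η : kˣ) : Gen k G → Module.End k D.Space
  | Gen.g h => D.ofImages fun i j => (D.wt l lam i j (h, 1) : k) • D.e i j
  | Gen.c γ => D.ofImages fun i j => (D.wt l lam i j (1, γ) : k) • D.e i j
  | Gen.x => D.ofImages (D.xImage l lam η)
  | Gen.xi => D.ofImages (D.xiImage l lam)

variable {D}

theorem e_of_not {i j : ℕ} (h : ¬ (i < D.m ∧ j < D.n)) : D.e i j = 0 := dif_neg h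

theorem ofImages_e (f : ℕ → ℕ → D.Space) {i j : ℕ} (hi : i < D.m) (hj : j < D.n) :
    D.ofImages f (D.e i j) = f i j := by
  simp [ofImages, e, hi, hj]

theorem end_ext {S T : Module.End k D.Space}
    (h : ∀ i j, i < D.m → j < D.n → S (D.e i j) = T (D.e i j)) : S = T := by
  refine Finsupp.lhom_ext' fun p => LinearMap.ext_ring ?_
  have := h p.1 p.2 p.1.2 p.2.2
  simpa [e] using this

/-- A strictly triangular operator is nilpotent. -/
theorem pow_eq_zero_of_height {T : Module.End k D.Space} (f : ℕ → ℕ)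
    (hf : ∀ j, j < D.n → f j < D.n)
    (hT : ∀ i j, i < D.m → j < D.n →
      T (D.e i j) ∈ Submodule.span k {v | ∃ i' j', v = D.e i' j' ∧ f j < f j'}) :
    T ^ D.n = 0 := by
  have key : ∀ r i j, (T ^ r) (D.e i j) ∈
      Submodule.span k {v | ∃ i' j', v = D.e i' j' ∧ f j + r ≤ f j'} := by
    intro r
    induction r with
    | zero => intro i j; exact Submodule.subset_span ⟨i, j, rfl, by omega⟩
    | succ r ih =>
      intro i j
      by_cases hij : i < D.m ∧ j < D.n
      · rw [pow_succ, Module.End.mul_apply]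
        have h1 := hT i j hij.1 hij.2
        have h2 : Submodule.span k {v | ∃ i' j', v = D.e i' j' ∧ f j < f j'} ≤
            (Submodule.span k {v | ∃ i' j', v = D.e i' j' ∧ f j + (r + 1) ≤ f j'}).comap
              (T ^ r) := by
          rw [Submodule.span_le]
          rintro _ ⟨i', j', rfl, hlt⟩
          refine Submodule.span_mono ?_ (ih i' j')
          rintro _ ⟨i2, j2, rfl, h⟩
          exact ⟨i2, j2, rfl, by omega⟩
        exact h2 h1
      · rw [e_of_not hij, map_zero]; exact Submodule.zero_mem _
  refine end_ext fun i j hi hj => ?_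
  have h1 := key D.n i j
  have h2 : Submodule.span k {v | ∃ i' j', v = D.e i' j' ∧ f j + D.n ≤ f j'} ≤ ⊥ := by
    rw [Submodule.span_le]
    rintro _ ⟨i', j', rfl, hlt⟩
    by_cases hij : i' < D.m ∧ j' < D.n
    · have := hf j' hij.2; omega
    · rw [e_of_not hij]; exact Submodule.zero_mem _
  simpa using h2 h1

theorem e_mem (i j r : ℕ) (f : ℕ → ℕ) (h : r < f j) :
    D.e i j ∈ Submodule.span k {v | ∃ i' j', v = D.e i' j' ∧ r < f j'} :=
  Submodule.subset_span ⟨_, _, rfl, h⟩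

theorem next_mem (η : kˣ) (i j r : ℕ) (f : ℕ → ℕ) (h : r < f j) :
    D.next η i j ∈ Submodule.span k {v | ∃ i' j', v = D.e i' j' ∧ r < f j'} := by
  unfold next
  split_ifs
  · exact Submodule.subset_span ⟨_, _, rfl, h⟩
  · exact Submodule.smul_mem _ _ (Submodule.subset_span ⟨_, _, rfl, h⟩)

section Rel

variable {l : ℕ} {lam : Weight k G} (η : kˣ)

theorem n_pos [Finite G] : 0 < D.n := by
  have h : IsOfFinOrder D.a := isOfFinOrder_of_finite _
  exact ((D.chi : G →* kˣ).isOfFinOrder h).orderOf_pos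

theorem n_dvd : D.n ∣ orderOf D.a := orderOf_map_dvd (D.chi : G →* kˣ) D.a

theorem lam_chi (hl : 1 ≤ l) (hlam : lam ∈ D.I l) :
    lam (1, D.chi) = lam (D.a, 1) * D.rho ^ (1 - (l : ℤ)) := by
  have h := hlam.2
  have h1 : D.evA lam = lam (D.a, 1) * (lam (1, D.chi))⁻¹ := by
    unfold evA
    rw [← map_inv, ← map_mul]
    simp
  rw [h1, ← zpow_natCast, Nat.cast_sub hl] at h
  rw [mul_inv_eq_iff_eq_mul] at h
  rw [h, mul_right_comm, ← zpow_add]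
  simp

theorem chi_pow (hD : ¬ D.Nilpotent) : D.chi ^ D.n = 1 := by
  rcases D.cond with h | h
  · exact h
  · exact absurd h hD

theorem phi_pow_eq_one : D.phi ^ (D.n * D.m) = 1 := by
  have key : ∀ N, orderOf D.a ∣ N → orderOf D.chi ∣ N → D.phi ^ N = 1 := by
    intro N h1 h2
    refine DFunLike.ext _ _ fun p => ?_
    obtain ⟨h, γ⟩ := p
    rw [Chr.pow_apply, phi_apply, mul_pow, inv_pow, ← Chr.pow_apply,
      orderOf_dvd_iff_pow_eq_one.mp h2, ← map_pow, orderOf_dvd_iff_pow_eq_one.mp h1]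
    simp [Chr.one_apply]
  apply key
  · unfold m
    split_ifs with hD
    · rw [Nat.mul_div_cancel' (n_dvd.trans (Nat.dvd_lcm_left _ _))]
      exact Nat.dvd_lcm_left _ _
    · rw [Nat.mul_div_cancel' n_dvd]
  · unfold m
    split_ifs with hD
    · rw [Nat.mul_div_cancel' (n_dvd.trans (Nat.dvd_lcm_left _ _))]
      exact Nat.dvd_lcm_right _ _
    · rw [Nat.mul_div_cancel' n_dvd]
      exact (orderOf_dvd_of_pow_eq_one (chi_pow hD)).trans n_dvd

theorem sigma_eq (hl : 1 ≤ l) (hl' : l < D.n) (hlam : lam ∈ D.I l) :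
    D.sigma lam = D.phi ^ l * lam := by
  unfold sigma
  rw [d_eq (s := l - 1) (by omega) hlam.2, mul_comm,
    show ((l - 1 : ℕ) : ℤ) + 1 = (l : ℤ) by omega, zpow_natCast]

theorem sigma_mem (hl : 1 ≤ l) (hl' : l < D.n) (hlam : lam ∈ D.I l) :
    D.sigma lam ∈ D.I (D.n - l) := by
  have h := evA_sigma (s := l - 1) (by omega) hlam.2
  rw [show D.n - 2 - (l - 1) = D.n - l - 1 by omega] at h
  exact ⟨⟨_, by omega, h⟩, h⟩

theorem tau_eq (hl : 1 ≤ l) (hl' : l < D.n) (hlam : lam ∈ D.I l) :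
    D.tau lam = D.phi ^ D.n * lam ∧ D.tau lam ∈ D.I l := by
  have h1 := sigma_mem hl hl' hlam
  have h2 := sigma_mem (l := D.n - l) (by omega) (by omega) h1
  have h3 : D.tau lam = D.sigma (D.sigma lam) := by simp [tau, pow_two]
  rw [show D.n - (D.n - l) = l by omega, ← h3] at h2
  refine ⟨?_, h2⟩
  rw [h3, sigma_eq (l := D.n - l) (by omega) (by omega) h1, sigma_eq hl hl' hlam,
    ← mul_assoc, ← pow_add, show D.n - l + l = D.n by omega]

theorem tau_pow_eq (hl : 1 ≤ l) (hl' : l < D.n) (hlam : lam ∈ D.I l) (i : ℕ) :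
    (D.tau ^ i) lam = D.phi ^ (D.n * i) * lam ∧ (D.tau ^ i) lam ∈ D.I l := by
  induction i with
  | zero => exact ⟨by simp, by simpa using hlam⟩
  | succ i ih =>
    have h := tau_eq hl hl' ih.2
    rw [pow_succ', Equiv.Perm.mul_apply]
    refine ⟨?_, h.2⟩
    rw [h.1, ih.1, ← mul_assoc, ← pow_add]
    congr 2
    ring

theorem wt_succ (hl : 1 ≤ l) (hl' : l < D.n) (hlam : lam ∈ D.I l) (i j : ℕ) :
    D.wt l lam (i + 1) j = D.phi ^ D.n * D.wt l lam i j := by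
  have h : (D.tau ^ (i + 1)) lam = D.phi ^ D.n * (D.tau ^ i) lam := by
    rw [(tau_pow_eq hl hl' hlam _).1, (tau_pow_eq hl hl' hlam _).1, ← mul_assoc, ← pow_add]
    congr 2
    ring
  unfold wt
  rw [h]
  split_ifs <;> exact mul_left_comm _ _ _

theorem wt_m (hl : 1 ≤ l) (hl' : l < D.n) (hlam : lam ∈ D.I l) (j : ℕ) :
    D.wt l lam D.m j = D.wt l lam 0 j := by
  have h : (D.tau ^ D.m) lam = (D.tau ^ 0) lam := by
    rw [(tau_pow_eq hl hl' hlam _).1, phi_pow_eq_one]; simp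
  unfold wt
  rw [h]

/-- The diagonal operator given by the action of `p` in `G × Γ`. -/
noncomputable def diagAction (D : GroupDatum k G) (l : ℕ) (lam : Weight k G) (p : G × Chr k G) :
    Module.End k D.Space :=
  D.ofImages fun i j => (D.wt l lam i j p : k) • D.e i j

theorem diag_e (p : G × Chr k G) (i j : ℕ) :
    D.diagAction l lam p (D.e i j) = (D.wt l lam i j p : k) • D.e i j := by
  by_cases h : i < D.m ∧ j < D.n
  · exact ofImages_e _ h.1 h.2
  · rw [e_of_not h]; simp

theorem diag_next (hl : 1 ≤ l) (hl' : l < D.n) (hlam : lam ∈ D.I l) (p : G × Chr k G) {i : ℕ}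
    (hi : i < D.m) (j : ℕ) :
    D.diagAction l lam p (D.next η i j) = (D.wt l lam (i + 1) j p : k) • D.next η i j := by
  unfold next
  split_ifs with h
  · exact diag_e _ _ _
  · rw [map_smul, diag_e, show i + 1 = D.m by omega, wt_m hl hl' hlam, smul_comm]

theorem wt_x_nil (hD : D.Nilpotent) {i j : ℕ} (h : j + 1 ≠ D.n - l) :
    D.wt l lam i (j + 1) = D.phi * D.wt l lam i j := by
  unfold wt
  rw [if_pos hD, if_pos hD]
  by_cases h1 : j + 1 < D.n - l
  · rw [if_pos h1, if_pos (by omega), ← mul_assoc, ← pow_succ', show j + 1 + l = j + l + 1 by omega]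
  · rw [if_neg h1, if_neg (by omega), ← mul_assoc, ← pow_succ',
      show j + 1 - (D.n - l) = j - (D.n - l) + 1 by omega]

theorem wt_x_nil' (hD : D.Nilpotent) (hl : 1 ≤ l) (hl' : l < D.n) (hlam : lam ∈ D.I l)
    {i j : ℕ} (h : j + 1 = D.n - l) :
    D.wt l lam (i + 1) (D.n - l) = D.phi * D.wt l lam i j := by
  rw [wt_succ hl hl' hlam]
  unfold wt
  rw [if_pos hD, if_pos hD, if_neg (by omega), if_pos (by omega), ← mul_assoc, ← mul_assoc,
    ← pow_succ', Nat.sub_self, pow_zero, mul_one, show j + l + 1 = D.n by omega]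

theorem wt_xi_nil (hD : D.Nilpotent) (hl : 1 ≤ l) (hl' : l < D.n) {i : ℕ} :
    D.wt l lam i 0 = D.phi * D.wt l lam i (D.n - 1) := by
  unfold wt
  rw [if_pos hD, if_pos hD, if_pos (by omega), if_neg (by omega), ← mul_assoc, ← pow_succ',
    show D.n - 1 - (D.n - l) + 1 = 0 + l by omega]

theorem wt_non (hD : ¬ D.Nilpotent) {i j : ℕ} : D.wt l lam i j = D.phi ^ j * (D.tau ^ i) lam := by
  unfold wt
  rw [if_neg hD]

theorem diag_x_nil (hD : D.Nilpotent) (hl : 1 ≤ l) (hl' : l < D.n) (hlam : lam ∈ D.I l)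
    (p : G × Chr k G) {i j : ℕ} (hi : i < D.m) :
    D.diagAction l lam p (D.xImage l lam η i j) =
      (D.phi p * D.wt l lam i j p : k) • D.xImage l lam η i j := by
  unfold xImage
  rw [if_pos hD]
  split_ifs with h1 h2 h3
  · rw [diag_e, wt_x_nil hD (by omega)]; simp [Chr.mul_apply]
  · rw [diag_next η hl hl' hlam p hi, wt_x_nil' hD hl hl' hlam h2]; simp [Chr.mul_apply]
  · rw [diag_e, wt_x_nil hD (by omega)]; simp [Chr.mul_apply]
  · simp

theorem diag_xi (hl : 1 ≤ l) (hl' : l < D.n) (p : G × Chr k G) {i j : ℕ} :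
    (D.phi p : k) • D.diagAction l lam p (D.xiImage l lam i j) =
      (D.wt l lam i j p : k) • D.xiImage l lam i j := by
  unfold xiImage
  by_cases hD : D.Nilpotent
  · rw [if_pos hD]
    split_ifs with h1 h2 h3
    · subst h1
      rw [diag_e, wt_xi_nil hD hl hl', smul_smul]; simp [Chr.mul_apply]
    · obtain ⟨j, rfl⟩ := Nat.exists_eq_succ_of_ne_zero h1
      rw [map_smul, Nat.succ_sub_one, diag_e, wt_x_nil hD (by omega), smul_smul, smul_smul,
        smul_smul]
      simp only [Chr.mul_apply, Units.val_mul]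
      congr 1; ring
    · simp
    · obtain ⟨j, rfl⟩ := Nat.exists_eq_succ_of_ne_zero h1
      rw [map_smul, Nat.succ_sub_one, diag_e, wt_x_nil hD (by omega), smul_smul, smul_smul,
        smul_smul]
      simp only [Chr.mul_apply, Units.val_mul]
      congr 1; ring
  · rw [if_neg hD]
    split_ifs with h1
    · simp
    · obtain ⟨j, rfl⟩ := Nat.exists_eq_succ_of_ne_zero h1
      rw [Nat.succ_sub_one, diag_e, wt_non hD, wt_non hD, smul_smul]
      simp [Chr.mul_apply, pow_succ', mul_assoc]

theorem genAction_x_e {i j : ℕ} (hi : i < D.m) (hj : j < D.n) :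
    D.genAction l lam η Gen.x (D.e i j) = D.xImage l lam η i j := ofImages_e _ hi hj

theorem genAction_xi_e {i j : ℕ} (hi : i < D.m) (hj : j < D.n) :
    D.genAction l lam η Gen.xi (D.e i j) = D.xiImage l lam i j := ofImages_e _ hi hj

theorem genAction_g (h : G) : D.genAction l lam η (Gen.g h) = D.diagAction l lam (h, 1) := rfl

theorem genAction_c (γ : Chr k G) : D.genAction l lam η (Gen.c γ) = D.diagAction l lam (1, γ) := rfl

theorem diag_mul (p q : G × Chr k G) :
    D.diagAction l lam (p * q) = D.diagAction l lam p * D.diagAction l lam q := by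
  refine end_ext fun i j _ _ => ?_
  rw [Module.End.mul_apply, diag_e, diag_e, map_smul, diag_e, map_mul, smul_smul]
  simp [mul_comm]

theorem pair_pow (h : G) (r : ℕ) : ((h, 1) : G × Chr k G) ^ r = (h ^ r, 1) := by
  rw [Prod.pow_mk, one_pow]

theorem diag_one : D.diagAction l lam 1 = 1 := by
  refine end_ext fun i j _ _ => ?_
  rw [diag_e, map_one]; simp

theorem xi_pow_eq_zero (hl : 1 ≤ l) (hl' : l < D.n) :
    D.genAction l lam η Gen.xi ^ D.n = 0 := by
  by_cases hD : D.Nilpotent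
  · obtain ⟨f, hf⟩ : ∃ f : ℕ → ℕ, ∀ j,
        (j < D.n - l → f j = D.n - l - 1 - j) ∧ (¬ j < D.n - l → f j = 2 * D.n - l - 1 - j) :=
      ⟨fun j => if j < D.n - l then D.n - l - 1 - j else 2 * D.n - l - 1 - j,
        fun j => ⟨fun h => if_pos h, fun h => if_neg h⟩⟩
    apply pow_eq_zero_of_height f
    · intro j hj
      have := hf j
      omega
    · intro i j hi hj
      have h1 := hf j
      have h2 := hf (j - 1)
      have h3 := hf (D.n - 1)
      rw [genAction_xi_e η hi hj]
      unfold xiImage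
      rw [if_pos hD]
      split_ifs
      · exact e_mem _ _ _ _ (by omega)
      · exact Submodule.smul_mem _ _ (e_mem _ _ _ _ (by omega))
      · exact Submodule.zero_mem _
      · exact Submodule.smul_mem _ _ (e_mem _ _ _ _ (by omega))
  · apply pow_eq_zero_of_height (fun j => D.n - 1 - j)
    · intro j hj; omega
    · intro i j hi hj
      rw [genAction_xi_e η hi hj]
      unfold xiImage
      rw [if_neg hD]
      split_ifs with h1
      · exact Submodule.zero_mem _
      · exact Submodule.subset_span ⟨_, _, rfl, by omega⟩

theorem x_pow_eq_zero (hl : 1 ≤ l) (hl' : l < D.n) :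
    D.genAction l lam η Gen.x ^ D.n = 0 := by
  by_cases hD : D.Nilpotent
  · apply pow_eq_zero_of_height (fun j => j)
    · intro j hj; omega
    · intro i j hi hj
      rw [genAction_x_e η hi hj]
      unfold xImage
      rw [if_pos hD]
      split_ifs with h1 h2 h3
      · exact Submodule.subset_span ⟨_, _, rfl, by omega⟩
      · exact next_mem _ _ _ _ _ (by omega)
      · exact Submodule.subset_span ⟨_, _, rfl, by omega⟩
      · exact Submodule.zero_mem _
  · obtain ⟨f, hf⟩ : ∃ f : ℕ → ℕ, ∀ j,
        (j < l → f j = D.n - l + j) ∧ (¬ j < l → f j = j - l) :=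
      ⟨fun j => if j < l then D.n - l + j else j - l,
        fun j => ⟨fun h => if_pos h, fun h => if_neg h⟩⟩
    apply pow_eq_zero_of_height f
    · intro j hj
      have := hf j
      omega
    · intro i j hi hj
      have h1 := hf j
      have h2 := hf (j + 1)
      have h3 := hf 0
      rw [genAction_x_e η hi hj]
      unfold xImage
      rw [if_neg hD]
      split_ifs
      · exact Submodule.smul_mem _ _ (e_mem _ _ _ _ (by omega))
      · exact Submodule.zero_mem _
      · exact Submodule.smul_mem _ _ (e_mem _ _ _ _ (by omega))
      · exact Submodule.add_mem _ (Submodule.smul_mem _ _ (e_mem _ _ _ _ (by omega)))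
          (next_mem _ _ _ _ _ (by omega))

theorem alpha_zero (mu : Weight k G) : D.alphaCoeff 0 mu = 0 := by
  simp [alphaCoeff, qNumber]

theorem alpha_l (hl : 1 ≤ l) (hlam : lam ∈ D.I l) : D.alphaCoeff l lam = 0 := by
  unfold alphaCoeff
  rw [lam_chi hl hlam]
  simp

theorem alpha_sub (mu : Weight k G) (i : ℕ) :
    D.alphaCoeff i mu - D.alphaCoeff (i + 1) mu =
      (((D.phi ^ i * mu) (D.a, 1) : kˣ) : k) - (((D.phi ^ i * mu) (1, D.chi) : kˣ) : k) := by
  have hq : ∀ j, qNumber (D.rho : k) (j + 1) = qNumber (D.rho : k) j + (D.rho : k) ^ j := by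
    intro j; unfold qNumber; rw [Finset.sum_range_succ]
  have hq' : ∀ j, qNumber (D.rho : k) (j + 1) = 1 + (D.rho : k) * qNumber (D.rho : k) j := by
    intro j; unfold qNumber; rw [Finset.sum_range_succ', Finset.mul_sum, add_comm]
    simp [pow_succ']
  have e1 : (D.phi ^ i * mu) (D.a, 1) = (D.rho⁻¹) ^ i * mu (D.a, 1) := by
    rw [Chr.mul_apply, Chr.pow_apply, phi_apply]; simp [rho, Chr.one_apply]
  have e2 : (D.phi ^ i * mu) (1, D.chi) = D.rho ^ i * mu (1, D.chi) := by
    rw [Chr.mul_apply, Chr.pow_apply, phi_apply]; simp [rho]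
  have e3 : D.rho ^ (1 - (i : ℤ)) = D.rho * (D.rho⁻¹) ^ i := by
    rw [zpow_sub]; simp
  have e4 : D.rho ^ (1 - ((i + 1 : ℕ) : ℤ)) = (D.rho⁻¹) ^ i := by
    rw [show 1 - ((i + 1 : ℕ) : ℤ) = -(i : ℤ) by push_cast; ring]; simp
  rw [e1, e2]
  unfold alphaCoeff
  rw [e3, e4]
  push_cast
  have h1 := hq i
  have h2 := hq' i
  linear_combination (-(mu (1, D.chi) : k)) * h1 +
    ((mu (D.a, 1) : k) * ((D.rho : k)⁻¹) ^ i) * h2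

theorem phi_n_a : (D.phi ^ D.n) (D.a, 1) = 1 := by
  rw [Chr.pow_apply, phi_apply, Chr.one_apply, mul_one, inv_pow]
  exact inv_eq_one.mpr (pow_orderOf_eq_one D.rho)

theorem phi_n_chi : (D.phi ^ D.n) (1, D.chi) = 1 := by
  rw [Chr.pow_apply, phi_apply, map_one, inv_one, one_mul]
  exact pow_orderOf_eq_one D.rho

theorem diag_comm (p : G × Chr k G) (hp : (D.phi ^ D.n) p = 1) (hl : 1 ≤ l) (hl' : l < D.n)
    (hlam : lam ∈ D.I l) (s i : ℕ) :
    (D.phi ^ s * (D.tau ^ i) lam) p = (D.phi ^ s * lam) p := by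
  have h : ((D.phi ^ D.n) ^ i) p = 1 := by rw [Chr.pow_apply, hp, one_pow]
  rw [(tau_pow_eq hl hl' hlam i).1, Chr.mul_apply, Chr.mul_apply, Chr.mul_apply, pow_mul,
    h, one_mul]

theorem wt_sub (hl : 1 ≤ l) (hl' : l < D.n) (hlam : lam ∈ D.I l) (s i : ℕ) :
    (((D.phi ^ s * (D.tau ^ i) lam) (D.a, 1) : kˣ) : k) -
      (((D.phi ^ s * (D.tau ^ i) lam) (1, D.chi) : kˣ) : k) =
      D.alphaCoeff s lam - D.alphaCoeff (s + 1) lam := by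
  rw [diag_comm _ phi_n_a hl hl' hlam, diag_comm _ phi_n_chi hl hl' hlam, alpha_sub]

theorem wt_sub' (hl : 1 ≤ l) (hl' : l < D.n) (hlam : lam ∈ D.I l) (s i : ℕ) :
    (((D.phi ^ (s + l) * (D.tau ^ i) lam) (D.a, 1) : kˣ) : k) -
      (((D.phi ^ (s + l) * (D.tau ^ i) lam) (1, D.chi) : kˣ) : k) =
      D.alphaCoeff s (D.sigma lam) - D.alphaCoeff (s + 1) (D.sigma lam) := by
  rw [diag_comm _ phi_n_a hl hl' hlam, diag_comm _ phi_n_chi hl hl' hlam, alpha_sub,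
    sigma_eq hl hl' hlam, ← mul_assoc, ← pow_add]

theorem diag_apply_sub (i j : ℕ) :
    (D.diagAction l lam (D.a, 1) - D.diagAction l lam (1, D.chi)) (D.e i j) =
      (((D.wt l lam i j (D.a, 1) : kˣ) : k) - ((D.wt l lam i j (1, D.chi) : kˣ) : k)) • D.e i j := by
  rw [LinearMap.sub_apply, diag_e, diag_e, sub_smul]

theorem xi_next_nil (hD : D.Nilpotent) {i : ℕ} (hm : 0 < D.m) (hl : 1 ≤ l) (hl' : l < D.n) :
    D.genAction l lam η Gen.xi (D.next η i (D.n - l)) = 0 := by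
  unfold next
  have key : ∀ i, i < D.m → D.genAction l lam η Gen.xi (D.e i (D.n - l)) = 0 := by
    intro i hi
    rw [genAction_xi_e η hi (by omega)]
    unfold xiImage
    rw [if_pos hD, if_neg (by omega), if_neg (by omega), if_pos rfl]
  split_ifs with h
  · exact key _ h
  · rw [map_smul, key _ hm, smul_zero]

theorem xi_next_non (hD : ¬ D.Nilpotent) {i : ℕ} (hm : 0 < D.m) (hn : 0 < D.n) :
    D.genAction l lam η Gen.xi (D.next η i 0) = 0 := by
  unfold next
  have key : ∀ i, i < D.m → D.genAction l lam η Gen.xi (D.e i 0) = 0 := by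
    intro i hi
    rw [genAction_xi_e η hi hn]
    unfold xiImage
    rw [if_neg hD, if_pos rfl]
  split_ifs with h
  · exact key _ h
  · rw [map_smul, key _ hm, smul_zero]

theorem x_xi_comm (hl : 1 ≤ l) (hl' : l < D.n) (hlam : lam ∈ D.I l) :
    D.genAction l lam η Gen.x * D.genAction l lam η Gen.xi -
      D.genAction l lam η Gen.xi * D.genAction l lam η Gen.x =
    D.diagAction l lam (D.a, 1) - D.diagAction l lam (1, D.chi) := by
  have hα := alpha_l hl hlam
  have hα' := alpha_l (l := D.n - l) (by omega) (sigma_mem hl hl' hlam)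
  refine end_ext fun i j hi hj => ?_
  rw [diag_apply_sub, LinearMap.sub_apply, Module.End.mul_apply, Module.End.mul_apply,
    genAction_x_e η hi hj, genAction_xi_e η hi hj]
  by_cases hD : D.Nilpotent
  · have hX : ∀ j', j' < D.n → D.genAction l lam η Gen.x (D.e i j') = D.xImage l lam η i j' :=
      fun j' hj' => genAction_x_e η hi hj'
    have hXi : ∀ j', j' < D.n → D.genAction l lam η Gen.xi (D.e i j') = D.xiImage l lam i j' :=
      fun j' hj' => genAction_xi_e η hi hj'
    have hm : 0 < D.m := by omega
    by_cases h1 : j < D.n - l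
    · have hw : D.wt l lam i j = D.phi ^ (j + l) * (D.tau ^ i) lam := by
        unfold wt; rw [if_pos hD, if_pos h1]
      rw [hw, wt_sub' hl hl' hlam, sub_smul]
      congr 1
      · by_cases h0 : j = 0
        · subst h0
          unfold xiImage
          rw [if_pos hD, if_pos rfl, hX _ (by omega), alpha_zero, zero_smul]
          unfold xImage
          rw [if_pos hD, if_neg (by omega), if_neg (by omega), if_neg (by omega)]
        · unfold xiImage
          rw [if_pos hD, if_neg h0, if_pos h1, map_smul, hX _ (by omega)]
          unfold xImage
          rw [if_pos hD, if_pos (by omega), Nat.sub_add_cancel (by omega)]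
      · by_cases h2 : j + 1 = D.n - l
        · unfold xImage
          rw [if_pos hD, if_neg (by omega), if_pos h2, xi_next_nil η hD hm hl hl', h2, hα',
            zero_smul]
        · unfold xImage
          rw [if_pos hD, if_pos (by omega), hXi _ (by omega)]
          unfold xiImage
          rw [if_pos hD, if_neg (by omega), if_pos (by omega), Nat.add_sub_cancel]
    · have hw : D.wt l lam i j = D.phi ^ (j - (D.n - l)) * (D.tau ^ i) lam := by
        unfold wt; rw [if_pos hD, if_neg h1]
      rw [hw, wt_sub hl hl' hlam, sub_smul]
      congr 1
      · by_cases h0 : j = D.n - l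
        · unfold xiImage
          rw [if_pos hD, if_neg (by omega), if_neg h1, if_pos h0, map_zero, h0, Nat.sub_self,
            alpha_zero, zero_smul]
        · unfold xiImage
          rw [if_pos hD, if_neg (by omega), if_neg h1, if_neg h0, map_smul, hX _ (by omega)]
          unfold xImage
          rw [if_pos hD, if_neg (by omega), if_neg (by omega), if_pos (by omega),
            Nat.sub_add_cancel (by omega)]
      · by_cases h2 : j + 1 < D.n
        · unfold xImage
          rw [if_pos hD, if_neg (by omega), if_neg (by omega), if_pos h2, hXi _ h2]
          unfold xiImage
          rw [if_pos hD, if_neg (by omega), if_neg (by omega), if_neg (by omega),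
            Nat.add_sub_cancel, show j + 1 - (D.n - l) = j - (D.n - l) + 1 by omega]
        · unfold xImage
          rw [if_pos hD, if_neg (by omega), if_neg (by omega), if_neg h2, map_zero,
            show j - (D.n - l) + 1 = l by omega, hα, zero_smul]
  · have hX : ∀ j', j' < D.n → D.genAction l lam η Gen.x (D.e i j') = D.xImage l lam η i j' :=
      fun j' hj' => genAction_x_e η hi hj'
    have hXi : ∀ j', j' < D.n → D.genAction l lam η Gen.xi (D.e i j') = D.xiImage l lam i j' :=
      fun j' hj' => genAction_xi_e η hi hj'
    have hm : 0 < D.m := by omega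
    rw [wt_non hD]
    by_cases h1 : j < l
    · rw [wt_sub hl hl' hlam, sub_smul]
      congr 1
      · by_cases h0 : j = 0
        · subst h0
          unfold xiImage
          rw [if_neg hD, if_pos rfl, map_zero, alpha_zero, zero_smul]
        · unfold xiImage
          rw [if_neg hD, if_neg h0, hX _ (by omega)]
          unfold xImage
          rw [if_neg hD, if_pos (by omega), Nat.sub_add_cancel (by omega)]
      · by_cases h2 : j + 1 = l
        · unfold xImage
          rw [if_neg hD, if_neg (by omega), if_pos h2, map_zero, h2, hα, zero_smul]
        · unfold xImage
          rw [if_neg hD, if_pos (by omega), map_smul, hXi _ (by omega)]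
          unfold xiImage
          rw [if_neg hD, if_neg (by omega), Nat.add_sub_cancel]
    · obtain ⟨s, rfl⟩ : ∃ s, j = s + l := ⟨j - l, by omega⟩
      rw [wt_sub' hl hl' hlam, sub_smul]
      congr 1
      · by_cases h0 : s = 0
        · subst h0
          unfold xiImage
          rw [if_neg hD, if_neg (by omega), hX _ (by omega)]
          unfold xImage
          rw [if_neg hD, if_neg (by omega), if_pos (by omega), alpha_zero, zero_smul]
        · unfold xiImage
          rw [if_neg hD, if_neg (by omega), hX _ (by omega)]
          unfold xImage
          rw [if_neg hD, if_neg (by omega), if_neg (by omega), if_pos (by omega),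
            Nat.sub_add_cancel (by omega), Nat.add_sub_cancel]
      · by_cases h2 : s + l + 1 < D.n
        · unfold xImage
          rw [if_neg hD, if_neg (by omega), if_neg (by omega), if_pos h2, map_smul, hXi _ h2]
          unfold xiImage
          rw [if_neg hD, if_neg (by omega), Nat.add_sub_cancel,
            show s + l + 1 - l = s + 1 by omega]
        · unfold xImage
          have h3 : D.genAction l lam η Gen.xi (D.e i 0) = 0 := by
            rw [hXi _ (by omega)]; unfold xiImage; rw [if_neg hD, if_pos rfl]
          rw [if_neg hD, if_neg (by omega), if_neg (by omega), if_neg h2, map_add, map_smul, h3,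
            xi_next_non η hD hm (by omega), smul_zero, add_zero,
            show s + 1 = D.n - l by omega, hα', zero_smul]

theorem xi_pow_e (hD : ¬ D.Nilpotent) (r : ℕ) {i j : ℕ} (hi : i < D.m) (hj : j < D.n) :
    (D.genAction l lam η Gen.xi ^ r) (D.e i j) = if r ≤ j then D.e i (j - r) else 0 := by
  induction r with
  | zero => simp
  | succ r ih =>
    rw [pow_succ', Module.End.mul_apply, ih]
    by_cases h : r ≤ j
    · rw [if_pos h, genAction_xi_e η hi (by omega)]
      unfold xiImage
      rw [if_neg hD]
      by_cases h2 : r + 1 ≤ j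
      · rw [if_neg (by omega), if_pos h2, Nat.sub_sub]
      · rw [if_pos (by omega), if_neg h2]
    · rw [if_neg h, if_neg (by omega), map_zero]

/-- The `φ`-homogeneous part of the action of `x` in the non-nilpotent case. -/
theorem diag_x_non (hD : ¬ D.Nilpotent) (hl : 1 ≤ l) (hl' : l < D.n) (hlam : lam ∈ D.I l)
    (p : G × Chr k G) {i j : ℕ} (hi : i < D.m) (hj : j < D.n) :
    D.diagAction l lam p (D.xImage l lam η i j) +
      (((D.phi p : k) ^ D.n - 1) * D.zCoeff lam * ((D.tau ^ i) lam p : k)) •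
        (if D.n - 1 ≤ j then D.e i 0 else 0) =
      (D.phi p * D.wt l lam i j p : k) • D.xImage l lam η i j := by
  have hs : ∀ i j, D.wt l lam i (j + 1) = D.phi * D.wt l lam i j := by
    intro i j
    rw [wt_non hD, wt_non hD, pow_succ', mul_assoc]
  unfold xImage
  rw [if_neg hD]
  split_ifs with h1 h2 h3 h4 h5 h6
  · omega
  · rw [map_smul, diag_e, hs, smul_comm]; simp [Chr.mul_apply]
  · omega
  · simp
  · omega
  · rw [map_smul, diag_e, hs, smul_comm]; simp [Chr.mul_apply]
  · have hj' : j + 1 = D.n := by omega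
    have hw0 : D.wt l lam i 0 = (D.tau ^ i) lam := by rw [wt_non hD]; simp
    have hw1 : D.phi * D.wt l lam i j = D.phi ^ D.n * (D.tau ^ i) lam := by
      rw [← hs, hj', wt_non hD]
    have hw2 : D.wt l lam (i + 1) 0 = D.phi ^ D.n * (D.tau ^ i) lam := by
      rw [wt_succ hl hl' hlam, hw0]
    have hw3 : (D.phi p * D.wt l lam i j p : k) = (D.phi p : k) ^ D.n * ((D.tau ^ i) lam p : k) := by
      have := congrArg (fun q : Weight k G => ((q p : kˣ) : k)) hw1
      simpa [Chr.mul_apply, Chr.pow_apply] using this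
    have hw4 : (D.wt l lam (i + 1) 0 p : k) = (D.phi p : k) ^ D.n * ((D.tau ^ i) lam p : k) := by
      rw [hw2]; simp [Chr.mul_apply, Chr.pow_apply]
    rw [map_add, map_smul, diag_e, diag_next η hl hl' hlam p hi, hw0, hw3, hw4]
    module
  · omega

/-- The operators defining `M₁(l, λ, η)` satisfy the relations of the Drinfeld double. -/
theorem lift_rel (hl : 1 ≤ l) (hl' : l < D.n) (hlam : lam ∈ D.I l)
    ⦃y z : FreeAlgebra k (Gen k G)⦄ (h : D.Rel y z) :
    FreeAlgebra.lift k (D.genAction l lam η) y = FreeAlgebra.lift k (D.genAction l lam η) z := by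
  have hphi : ∀ h : G, D.phi (h, 1) = (D.chi h)⁻¹ := by
    intro h; rw [phi_apply, Chr.one_apply, mul_one]
  have hphi' : ∀ γ : Chr k G, D.phi (1, γ) = γ D.a := by
    intro γ; rw [phi_apply, map_one, inv_one, one_mul]
  cases h with
  | g_one =>
    simp only [gen, map_one, FreeAlgebra.lift_ι_apply, genAction_g]
    exact diag_one
  | g_mul h h' =>
    simp only [gen, map_mul, FreeAlgebra.lift_ι_apply, genAction_g]
    rw [← diag_mul]; simp
  | c_one =>
    simp only [gen, map_one, FreeAlgebra.lift_ι_apply, genAction_c]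
    exact diag_one
  | c_mul γ γ' =>
    simp only [gen, map_mul, FreeAlgebra.lift_ι_apply, genAction_c]
    rw [← diag_mul]; simp
  | x_pow =>
    simp only [gen, map_pow, map_smul, map_sub, map_one, FreeAlgebra.lift_ι_apply]
    rw [x_pow_eq_zero η hl hl', genAction_g]
    have hpow : ∀ r, D.diagAction l lam (D.a, 1) ^ r = D.diagAction l lam (D.a ^ r, 1) := by
      intro r
      induction r with
      | zero => rw [pow_zero, pow_zero]; exact diag_one.symm
      | succ r ih => rw [pow_succ, ih, ← diag_mul, pow_succ]; simp
    rw [hpow]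
    by_cases h0 : D.alpha = 0
    · rw [h0, zero_smul]
    have h1 : D.diagAction l lam (D.a ^ D.n, 1) = 1 := by
      by_cases hD : D.Nilpotent
      · rw [hD.resolve_left h0]; exact diag_one
      · have e1 : lam (D.a, 1) ^ D.n = 1 := by
          have h2 := congrArg (· ^ D.n) (lam_chi hl hlam)
          simp only [mul_pow] at h2
          rw [← zpow_natCast (D.rho ^ _), zpow_comm, rho_zpow_n, one_zpow, mul_one, ← map_pow,
            Prod.pow_mk, chi_pow hD, one_pow] at h2
          rw [← h2]; exact map_one lam
        refine end_ext fun i j _ _ => ?_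
        rw [diag_e, ← pair_pow, map_pow, wt_non hD, diag_comm _ phi_n_a hl hl' hlam,
          Chr.mul_apply, mul_pow, e1, mul_one, ← Chr.pow_apply, ← pow_mul, mul_comm, pow_mul,
          Chr.pow_apply, phi_n_a, one_pow]
        simp
    rw [h1, sub_self, smul_zero]
  | x_g h =>
    simp only [gen, map_mul, map_smul, FreeAlgebra.lift_ι_apply, genAction_g]
    refine end_ext fun i j hi hj => ?_
    rw [LinearMap.smul_apply, Module.End.mul_apply, Module.End.mul_apply, diag_e, map_smul,
      genAction_x_e η hi hj]
    have key : D.diagAction l lam (h, 1) (D.xImage l lam η i j) =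
      (D.phi (h, 1) * D.wt l lam i j (h, 1) : k) • D.xImage l lam η i j := by
      by_cases hD : D.Nilpotent
      · exact diag_x_nil η hD hl hl' hlam _ hi
      · have h1 := diag_x_non η hD hl hl' hlam (h, 1) hi hj
        have h2 : D.phi (h, 1) ^ D.n = 1 := by
          rw [hphi, inv_pow, ← Chr.pow_apply, chi_pow hD, Chr.one_apply, inv_one]
        have h3 : (D.phi (h, 1) : k) ^ D.n = 1 := by
          rw [← Units.val_pow_eq_pow_val, h2, Units.val_one]
        rw [h3, sub_self, zero_mul, zero_mul, zero_smul, add_zero] at h1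
        exact h1
    rw [key, smul_smul, hphi]
    simp
  | xi_pow =>
    simp only [gen, map_pow, map_zero, FreeAlgebra.lift_ι_apply]
    exact xi_pow_eq_zero η hl hl'
  | xi_c γ =>
    simp only [gen, map_mul, map_smul, FreeAlgebra.lift_ι_apply, genAction_c]
    refine end_ext fun i j hi hj => ?_
    rw [LinearMap.smul_apply, Module.End.mul_apply, Module.End.mul_apply, diag_e, map_smul,
      genAction_xi_e η hi hj, ← diag_xi hl hl', hphi']
  | g_c h γ =>
    simp only [gen, map_mul, FreeAlgebra.lift_ι_apply, genAction_c, genAction_g]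
    rw [← diag_mul, ← diag_mul, mul_comm]
  | xi_g h =>
    simp only [gen, map_mul, map_smul, FreeAlgebra.lift_ι_apply, genAction_g]
    refine end_ext fun i j hi hj => ?_
    rw [LinearMap.smul_apply, Module.End.mul_apply, Module.End.mul_apply, diag_e, map_smul,
      genAction_xi_e η hi hj, ← diag_xi hl hl', hphi]
  | x_xi =>
    simp only [gen, map_mul, map_sub, FreeAlgebra.lift_ι_apply, genAction_g, genAction_c]
    exact x_xi_comm η hl hl' hlam
  | x_c_nil hD γ =>
    simp only [gen, map_mul, map_smul, FreeAlgebra.lift_ι_apply, genAction_c]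
    refine end_ext fun i j hi hj => ?_
    rw [LinearMap.smul_apply, Module.End.mul_apply, Module.End.mul_apply, diag_e, map_smul,
      genAction_x_e η hi hj, diag_x_nil η hD hl hl' hlam _ hi, hphi', smul_smul]
  | x_c_non hD γ =>
    simp only [gen, map_mul, map_smul, map_add, map_sub, map_pow, FreeAlgebra.lift_ι_apply,
      genAction_c, genAction_g]
    refine end_ext fun i j hi hj => ?_
    have h1 := diag_x_non η hD hl hl' hlam (1, γ) hi hj
    rw [hphi'] at h1
    rw [LinearMap.smul_apply, Module.End.mul_apply, diag_e, map_smul,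
      genAction_x_e η hi hj, smul_smul, ← h1, LinearMap.add_apply, Module.End.mul_apply,
      genAction_x_e η hi hj, LinearMap.smul_apply, Module.End.mul_apply, Module.End.mul_apply,
      xi_pow_e η hD _ hi hj]
    congr 1
    by_cases hj' : D.n - 1 ≤ j
    · rw [if_pos hj', if_pos hj', show j - (D.n - 1) = 0 by omega, LinearMap.sub_apply,
        LinearMap.smul_apply, diag_e, diag_e, smul_smul, ← sub_smul, map_smul, diag_e, smul_smul,
        smul_smul]
      congr 1
      have ha := diag_comm _ (phi_n_a (D := D)) hl hl' hlam 0 i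
      have hc := diag_comm _ (phi_n_chi (D := D)) hl hl' hlam 0 i
      rw [wt_non hD, ha, hc]
      simp only [pow_zero, one_mul]
      unfold zCoeff
      ring
    · rw [if_neg hj', if_neg hj']; simp

end Rel

/-- The module `M₁(l, λ, η)` for `1 ≤ l ≤ n - 1`, `λ ∈ I_l` and `η ∈ kˣ`: the vector space with
basis `x_j^i`, on which `G × Γ`, `x` and `ξ` act by `wt`, `xImage` and `xiImage`. -/
noncomputable def M1 (D : GroupDatum k G) (l : ℕ) (lam : Weight k G) (η : kˣ) (hl : 1 ≤ l)
    (hl' : l < D.n) (hlam : lam ∈ D.I l) : ModuleCat.{u} D.Double :=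
  letI : Module D.Double D.Space := Module.compHom D.Space
    (RingQuot.liftAlgHom k
      ⟨FreeAlgebra.lift k (D.genAction l lam η), lift_rel η hl hl' hlam⟩).toRingHom
  ModuleCat.of D.Double D.Space

end Basic

end GroupDatum

section ModuleTypes

variable (A : Type u) [Ring A] (M : Type v) [AddCommGroup M] [Module A M]

/-- `M` is indecomposable: nonzero, and not a direct sum of two nonzero submodules. -/
def IsIndecomposableModule : Prop :=
  Nontrivial M ∧ ∀ N K : Submodule A M, IsCompl N K → N = ⊥ ∨ K = ⊥

/-- The socle: the sum of all simple submodules. -/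
def moduleSocle : Submodule A M := sSup {N | IsSimpleModule A N}

/-- `M` is of `(s, t)`-type: it is indecomposable, its radical length is two
(`rad M ≠ 0 = rad² M`), its head `M / rad M` has length `s` and its socle has length `t`. -/
def IsOfType (s t : ℕ) : Prop :=
  IsIndecomposableModule A M ∧
  Module.jacobson A M ≠ ⊥ ∧ Module.jacobson A (Module.jacobson A M) = ⊥ ∧
  Module.length A (M ⧸ Module.jacobson A M) = s ∧ Module.length A (moduleSocle A M) = t

end ModuleTypes

namespace GroupDatum

variable {k : Type u} [Field k] {G : Type v} [CommGroup G] (D : GroupDatum k G)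

/-- `M` is (a model of) the module `M_t(l, λ, η)`. For `t = 1` this means `M ≅ M₁(l, λ, η)`; for
`t ≥ 2` it means that `M` is an indecomposable module of `(tm, tm)`-type with a submodule
`N ≅ M_{t-1}(l, λ, η)` such that `M / N ≅ M₁(l, λ, η)`. -/
def IsM (l : ℕ) (lam : Weight k G) (η : kˣ) (hl : 1 ≤ l) (hl' : l < D.n) (hlam : lam ∈ D.I l) :
    ℕ → ∀ (M : Type w) [AddCommGroup M] [Module D.Double M], Prop
  | 0, _, _, _ => False
  | 1, M, _, _ => Nonempty (M ≃ₗ[D.Double] D.M1 l lam η hl hl' hlam)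
  | t + 2, M, _, _ => IsOfType D.Double M ((t + 2) * D.m) ((t + 2) * D.m) ∧
      ∃ N : Submodule D.Double M, IsM l lam η hl hl' hlam (t + 1) N ∧
        Nonempty ((M ⧸ N) ≃ₗ[D.Double] D.M1 l lam η hl hl' hlam)

end GroupDatum

/-! The order of `φ` is exactly `nm`, so the weights `φ^i λ` form a cycle of length `nm`, cut into
`m` blocks of length `n`. The operator `ξ` moves one step down this cycle. The operator `x` moves
one step up, once its component `corr` of a different degree is removed in the non-nilpotent case
(`grp_xt`). Between the places `i` and `i + 1` one operator is bijective: `ξ` inside a block, and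
the homogeneous part `xt` of `x` across a block boundary (`n ∣ i + 1`), where `ξ` is zero. Inside a
block the commutator relation then determines `xt`: at position `j` the composite `ξ xt` is the
scalar `α_(j+1)(λ)` (`xi_xt_smul`), which vanishes inside a block only for `j + 1 = l`.

Such a module is therefore the same thing as the space of vectors of weight `λ` together with the
monodromy of one full turn, that is, a `k[X]`-module `N` on which `X` is invertible (`Good`,
`Band`). Homomorphisms correspond as well (`exists_map`, `exists_of_map`), hence so do isomorphisms
and indecomposability. The positions `j < l` of the blocks form both the radical and the socle, the
other positions form the head, and each layer has `dim N` simple summands per block (`jacobson_eq`,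
`moduleSocle_eq`, `isOfType`). Under this dictionary `M_t(l, λ, η)` corresponds to `k[X] / (X -
η)^t`.

Existence: in the matrices of `M₁(l, λ, η)` the parameter `η` is replaced by `X`. The defining
relations become identities of polynomials that hold at every nonzero `η`, so they hold over `k[X]`,
and the matrices act on tuples from any `k[X]`-module (`Model.band`). The chain of submodules of the
Jordan module then gives the required filtration (`isM_of_band`).

Uniqueness: an extension of band modules with semisimple radical is again a band module
(`good_of_extension`). An indecomposable extension of `k[X] / (X - η)` by `k[X] / (X - η)^t` is
cyclic, so every choice of `M_t(l, λ, η)` is presented by the same Jordan module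
(`nonempty_band_of_isM`). The Jordan module determines `t` and `η`. Vectors of weight `φ^i λ` killed
by `ξ` exist only for `n ∣ i`, that is, for weights in the `τ`-orbit of `λ`; this determines the
orbit, and with it `l` (`eq_tau_pow`). -/

set_option linter.unusedSectionVars false

namespace GroupDatum

open Finset

/-! ### Relations in the double and the homogeneous part of `x` -/

section Elements

variable {k : Type u} [Field k] {G : Type v} [CommGroup G] (D : GroupDatum k G)

/-- A generator as an element of the Drinfeld double. -/
noncomputable def el (y : Gen k G) : D.Double := RingQuot.mkAlgHom k D.Rel (gen y)

/-- The image of `(h, γ)` in the Drinfeld double. -/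
noncomputable def grp (p : G × Chr k G) : D.Double := D.el (Gen.g p.1) * D.el (Gen.c p.2)

variable {D}

theorem el_rel {y z : FreeAlgebra k (Gen k G)} (h : D.Rel y z) :
    RingQuot.mkAlgHom k D.Rel y = RingQuot.mkAlgHom k D.Rel z := RingQuot.mkAlgHom_rel k h

theorem g_one : D.el (Gen.g 1) = 1 := by simpa [el] using el_rel (D := D) Rel.g_one

theorem c_one : D.el (Gen.c 1) = 1 := by simpa [el] using el_rel (D := D) Rel.c_one

theorem g_mul (h h' : G) : D.el (Gen.g (h * h')) = D.el (Gen.g h) * D.el (Gen.g h') := by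
  simpa [el] using el_rel (D := D) (Rel.g_mul h h')

theorem c_mul (γ γ' : Chr k G) : D.el (Gen.c (γ * γ')) = D.el (Gen.c γ) * D.el (Gen.c γ') := by
  simpa [el] using el_rel (D := D) (Rel.c_mul γ γ')

theorem g_c (h : G) (γ : Chr k G) :
    D.el (Gen.g h) * D.el (Gen.c γ) = D.el (Gen.c γ) * D.el (Gen.g h) := by
  simpa [el] using el_rel (D := D) (Rel.g_c h γ)

theorem grp_mul (p q : G × Chr k G) : D.grp (p * q) = D.grp p * D.grp q := by
  unfold grp
  rw [Prod.fst_mul, Prod.snd_mul, g_mul, c_mul, mul_assoc, mul_assoc, ← mul_assoc _ _ (D.el (.c q.2)),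
    g_c, mul_assoc]

theorem grp_left (h : G) : D.grp (h, 1) = D.el (Gen.g h) := by simp [grp, c_one]

theorem grp_right (γ : Chr k G) : D.grp (1, γ) = D.el (Gen.c γ) := by simp [grp, g_one]

theorem grp_comm (p q : G × Chr k G) : D.grp p * D.grp q = D.grp q * D.grp p := by
  rw [← grp_mul, mul_comm, grp_mul]

theorem xi_g (h : G) : D.el Gen.xi * D.el (Gen.g h) =
    (((D.chi h)⁻¹ : kˣ) : k) • (D.el (Gen.g h) * D.el Gen.xi) := by
  simpa only [el, map_mul, map_smul] using el_rel (D := D) (Rel.xi_g h)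

theorem xi_c (γ : Chr k G) : D.el Gen.xi * D.el (Gen.c γ) =
    (γ D.a : k) • (D.el (Gen.c γ) * D.el Gen.xi) := by
  simpa only [el, map_mul, map_smul] using el_rel (D := D) (Rel.xi_c γ)

theorem x_g (h : G) : D.el Gen.x * D.el (Gen.g h) =
    (D.chi h : k) • (D.el (Gen.g h) * D.el Gen.x) := by
  simpa only [el, map_mul, map_smul] using el_rel (D := D) (Rel.x_g h)

theorem xi_pow : D.el Gen.xi ^ D.n = 0 := by
  simpa only [el, map_pow, map_zero] using el_rel (D := D) Rel.xi_pow

theorem x_xi : D.el Gen.x * D.el Gen.xi - D.el Gen.xi * D.el Gen.x =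
    D.el (Gen.g D.a) - D.el (Gen.c D.chi) := by
  simpa only [el, map_mul, map_sub] using el_rel (D := D) Rel.x_xi

theorem xi_grp (p : G × Chr k G) : D.el Gen.xi * D.grp p =
    (D.phi p : k) • (D.grp p * D.el Gen.xi) := by
  obtain ⟨h, γ⟩ := p
  unfold grp
  rw [← mul_assoc, xi_g, smul_mul_assoc, mul_assoc, xi_c, mul_smul_comm, smul_smul, phi_apply,
    Units.val_mul, mul_assoc]

theorem xi_pow_grp (p : G × Chr k G) (r : ℕ) : D.el Gen.xi ^ r * D.grp p =
    ((D.phi p : k) ^ r) • (D.grp p * D.el Gen.xi ^ r) := by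
  induction r with
  | zero => simp
  | succ r ih =>
    rw [pow_succ, mul_assoc, xi_grp, mul_smul_comm, ← mul_assoc, ih, smul_mul_assoc, smul_smul,
      mul_assoc, pow_succ, mul_comm]

variable (D)

/-- The difference between `x` and its homogeneous part. -/
noncomputable def corr : D.Double :=
  (qFactorial (D.rho : k) (D.n - 1))⁻¹ •
    (((D.rho : k) • D.grp (D.a, 1) - D.grp (1, D.chi)) * D.el Gen.xi ^ (D.n - 1))

open Classical in
/-- The component of `x` that is homogeneous for the action of `G × Γ`. -/
noncomputable def xt : D.Double := if D.Nilpotent then D.el Gen.x else D.el Gen.x - D.corr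

variable {D}

open Classical in
theorem x_eq : D.el Gen.x = if D.Nilpotent then D.xt else D.xt + D.corr := by
  unfold xt
  split_ifs <;> simp

/-- The factor `ξ^(n-1)` shifts weights by `φ^(1-n)` and the group elements in front commute with `G
× Γ`. Thus `x` is a sum of components of degrees `φ` and `φ^(1-n)`. -/
theorem corr_grp (p : G × Chr k G) : D.corr * D.grp p =
    ((D.phi p : k) ^ (D.n - 1)) • (D.grp p * D.corr) := by
  unfold corr
  rw [smul_mul_assoc, mul_assoc, xi_pow_grp, mul_smul_comm, mul_smul_comm, smul_comm,
    ← mul_assoc, ← mul_assoc, sub_mul, mul_sub, smul_mul_assoc, grp_comm, grp_comm (1, _),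
    mul_smul_comm]

theorem phi_g (h : G) : D.phi (h, 1) = (D.chi h)⁻¹ := by
  rw [phi_apply, Chr.one_apply, mul_one]

theorem phi_c (γ : Chr k G) : D.phi (1, γ) = γ D.a := by
  rw [phi_apply, map_one, inv_one, one_mul]

theorem grp_x_of {y : D.Double}
    (hg : ∀ h, y * D.grp (h, 1) = (D.chi h : k) • (D.grp (h, 1) * y))
    (hc : ∀ γ : Chr k G, (γ D.a : k) • (y * D.grp (1, γ)) = D.grp (1, γ) * y)
    (p : G × Chr k G) : D.grp p * y = (D.phi p : k) • (y * D.grp p) := by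
  obtain ⟨h, γ⟩ := p
  have e : D.grp (h, γ) = D.grp (h, 1) * D.grp (1, γ) := by rw [← grp_mul]; simp
  have e1 : D.grp (h, 1) * y = ((D.chi h)⁻¹ : k) • (y * D.grp (h, 1)) := by
    rw [hg, smul_smul]; simp
  rw [e, mul_assoc, ← hc, mul_smul_comm, ← mul_assoc, e1, smul_mul_assoc, smul_smul, phi_apply,
    mul_assoc]
  push_cast
  rw [mul_comm]

/-- In the non-nilpotent case the extra term in the relation between `x` and `γ` is exactly the
defect of `corr` from having degree `φ`. -/
theorem grp_xt (hn : 0 < D.n) (p : G × Chr k G) :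
    D.grp p * D.xt = (D.phi p : k) • (D.xt * D.grp p) := by
  revert p
  by_cases hD : D.Nilpotent
  · simp only [xt, if_pos hD]
    refine grp_x_of (fun h => ?_) (fun γ => ?_)
    · rw [grp_left, x_g]
    · rw [grp_right]
      simpa only [el, map_mul, map_smul] using el_rel (D := D) (Rel.x_c_nil hD γ)
  · simp only [xt, if_neg hD]
    refine grp_x_of (fun h => ?_) (fun γ => ?_)
    -- Non-nilpotent type forces `χ^n = 1`, so the degrees `φ` and `φ^(1-n)` agree on `G`.
    · have h2 : (D.chi h : k) ^ D.n = 1 := by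
        rw [← Units.val_pow_eq_pow_val, ← Chr.pow_apply, chi_pow hD, Chr.one_apply, Units.val_one]
      have h3 : ((D.phi (h, 1) : kˣ) : k) ^ (D.n - 1) = D.chi h := by
        rw [phi_g, Units.val_inv_eq_inv_val, inv_pow]
        refine inv_eq_of_mul_eq_one_right ?_
        rw [← pow_succ, Nat.sub_add_cancel hn, h2]
      rw [sub_mul, mul_sub, corr_grp, h3, grp_left, x_g, smul_sub]
    · have h1 : (γ D.a : k) • (D.el Gen.x * D.grp (1, γ)) = D.grp (1, γ) * D.el Gen.x +
          ((γ D.a : k) ^ D.n - 1) • (D.grp (1, γ) * D.corr) := by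
        have h := el_rel (D := D) (Rel.x_c_non hD γ)
        simp only [map_mul, map_smul, map_add, map_sub, map_pow] at h
        unfold corr
        rw [mul_smul_comm, smul_smul, ← div_eq_mul_inv, ← mul_assoc, grp_right, grp_left, grp_right]
        exact h
      rw [sub_mul, smul_sub, h1, corr_grp, phi_c, smul_smul, ← pow_succ', Nat.sub_add_cancel hn,
        mul_sub]
      module

/-- The correction is annihilated by `ξ` from both sides because `ξ^n = 0`, so it does not
contribute to the commutator. -/
theorem xt_xi (hn : 0 < D.n) : D.xt * D.el Gen.xi - D.el Gen.xi * D.xt =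
    D.grp (D.a, 1) - D.grp (1, D.chi) := by
  rw [grp_left, grp_right, ← x_xi]
  unfold xt
  split_ifs with hD
  · rfl
  · have h1 : D.corr * D.el Gen.xi = 0 := by
      unfold corr
      rw [smul_mul_assoc, mul_assoc, ← pow_succ, Nat.sub_add_cancel hn, xi_pow]; simp
    have h2 : D.el Gen.xi * D.corr = 0 := by
      unfold corr
      rw [mul_smul_comm, ← mul_assoc, mul_sub, mul_smul_comm, xi_grp, xi_grp, sub_mul,
        smul_mul_assoc, smul_mul_assoc, smul_mul_assoc, mul_assoc, mul_assoc, ← pow_succ',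
        Nat.sub_add_cancel hn, xi_pow]
      simp
    rw [sub_mul, mul_sub, h1, h2, sub_zero, sub_zero]

theorem phi_pow_add (i : ℕ) : D.phi ^ (i + D.n * D.m) = D.phi ^ i := by
  rw [pow_add, phi_pow_eq_one, mul_one]

/-- A subalgebra of the double that contains `G`, `Γ`, `ξ` and the homogeneous part of `x` is
everything. -/
theorem subalgebra_eq_top (B : Subalgebra k D.Double) (hg : ∀ p, D.grp p ∈ B) (hx : D.xt ∈ B)
    (hxi : D.el Gen.xi ∈ B) : B = ⊤ := by
  have hgen : ∀ y, D.el y ∈ B := by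
    intro y
    cases y with
    | g h => rw [← grp_left]; exact hg _
    | c γ => rw [← grp_right]; exact hg _
    | xi => exact hxi
    | x =>
      rw [x_eq]
      split_ifs
      · exact hx
      · exact B.add_mem hx (B.smul_mem (B.mul_mem (B.sub_mem (B.smul_mem (hg _) _) (hg _))
          (B.pow_mem hxi _)) _)
  rw [eq_top_iff]
  intro d _
  obtain ⟨f, rfl⟩ := RingQuot.mkAlgHom_surjective k D.Rel d
  induction f using FreeAlgebra.induction with
  | grade0 r => rw [AlgHom.commutes]; exact B.algebraMap_mem r
  | grade1 y => exact hgen y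
  | mul a b ha hb => rw [map_mul]; exact B.mul_mem (ha trivial) (hb trivial)
  | add a b ha hb => rw [map_add]; exact B.add_mem (ha trivial) (hb trivial)

end Elements

/-! ### Weight idempotents and the order of `φ` -/

section Idempotents

variable {k : Type u} [Field k] [IsAlgClosed k] [CharZero k] {G : Type v} [CommGroup G] [Finite G]

/-- Enough roots of unity make `Γ` finite and let it separate the points of `G`; both the
idempotents and the order of `φ` depend on this. -/
instance enoughRoots : HasEnoughRootsOfUnity k (Monoid.exponent G) :=
  have : NeZero (Monoid.exponent G) := ⟨Monoid.exponent_ne_zero_of_finite⟩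
  inferInstance

instance finite_chr : Finite (Chr k G) := inferInstanceAs (Finite (G →* kˣ))

noncomputable instance fintypeGroup : Fintype (G × Chr k G) := Fintype.ofFinite _

theorem exists_chr_ne {h : G} (hh : h ≠ 1) : ∃ γ : Chr k G, γ h ≠ 1 :=
  CommGroup.exists_apply_ne_one_of_hasEnoughRootsOfUnity G k hh

variable (D : GroupDatum k G)

/-- The idempotent that projects onto the vectors of weight `μ`. -/
noncomputable def idem (mu : Weight k G) : D.Double :=
  (Fintype.card (G × Chr k G) : k)⁻¹ • ∑ p, (((mu p)⁻¹ : kˣ) : k) • D.grp p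

variable {D}

theorem grp_idem (p : G × Chr k G) (mu : Weight k G) :
    D.grp p * D.idem mu = (mu p : k) • D.idem mu := by
  unfold idem
  rw [mul_smul_comm, smul_comm (mu p : k), mul_sum, Finset.smul_sum (r := (mu p : k))]
  refine congrArg _ (Fintype.sum_equiv (Equiv.mulLeft p)
    (fun q => D.grp p * ((((mu q)⁻¹ : kˣ) : k) • D.grp q)) _ fun q => ?_)
  rw [Equiv.coe_mulLeft, mul_smul_comm, ← grp_mul, smul_smul, map_mul]
  congr 1
  simp [mul_comm]

-- Orthogonality of characters: the sum of a nontrivial character over the finite group `G × Γ`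
-- vanishes.
open Classical in
theorem idem_mul (mu nu : Weight k G) :
    D.idem mu * D.idem nu = if mu = nu then D.idem nu else 0 := by
  have h1 : D.idem mu * D.idem nu = ((Fintype.card (G × Chr k G) : k)⁻¹ *
      ∑ p, (((nu * mu⁻¹) p : kˣ) : k)) • D.idem nu := by
    conv_lhs => unfold idem
    rw [smul_mul_assoc, sum_mul]
    conv_lhs =>
      enter [2, 2, p]
      rw [smul_mul_assoc]
      erw [grp_idem]
    rw [mul_smul, sum_smul]
    congr 2
    funext p
    rw [smul_smul, Chr.mul_apply, Chr.inv_apply, mul_comm, Units.val_mul]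
  rw [h1]
  split_ifs with h
  · subst h
    simp [Chr.one_apply]
  · rw [show ∑ p, (((nu * mu⁻¹) p : kˣ) : k) = 0 from ?_, mul_zero, zero_smul]
    have h2 := sum_hom_units_eq_zero ((Units.coeHom k).comp (nu * mu⁻¹ : (G × Chr k G) →* kˣ)) ?_
    · exact h2
    · intro h3
      refine h ?_
      have : nu * mu⁻¹ = 1 := by
        refine DFunLike.ext _ _ fun p => Units.ext ?_
        exact DFunLike.congr_fun h3 p
      exact (mul_inv_eq_one.mp this).symm

theorem xt_idem (hn : 0 < D.n) (mu : Weight k G) :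
    D.xt * D.idem mu = D.idem (D.phi * mu) * D.xt := by
  unfold idem
  rw [mul_smul_comm, smul_mul_assoc, mul_sum, sum_mul]
  congr 2
  funext p
  rw [smul_mul_assoc, grp_xt hn, mul_smul_comm, smul_smul, Chr.mul_apply]
  simp

theorem idem_xi (mu : Weight k G) :
    D.idem mu * D.el Gen.xi = D.el Gen.xi * D.idem (D.phi * mu) := by
  unfold idem
  rw [mul_smul_comm, smul_mul_assoc, mul_sum, sum_mul]
  congr 2
  funext p
  rw [mul_smul_comm, xi_grp, smul_mul_assoc, smul_smul, Chr.mul_apply]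
  simp

/-- Restricted to `Γ`, `φ^i` is evaluation at `a^i`, and characters separate points, so `ord(a) ∣
i`; restricted to `G` it is `χ^(-i)`, so `ord(χ) ∣ i`. With `phi_pow_eq_one` this makes `nm` the
exact order of `φ`. -/
theorem dvd_of_phi_pow {i : ℕ} (h : D.phi ^ i = 1) : D.n * D.m ∣ i := by
  have h1 : orderOf D.a ∣ i := by
    rw [orderOf_dvd_iff_pow_eq_one]
    by_contra h2
    obtain ⟨γ, hγ⟩ := exists_chr_ne (k := k) h2
    apply hγ
    have := DFunLike.congr_fun h (1, γ)
    rwa [Chr.pow_apply, phi_c, ← map_pow] at this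
  have h2 : orderOf D.chi ∣ i := by
    rw [orderOf_dvd_iff_pow_eq_one]
    refine DFunLike.ext _ _ fun g => ?_
    have := DFunLike.congr_fun h (g, 1)
    rw [Chr.pow_apply, phi_g, inv_pow, Chr.one_apply, inv_eq_one] at this
    rw [Chr.pow_apply, this, Chr.one_apply]
  unfold m
  split_ifs with hD
  · rw [Nat.mul_div_cancel' (n_dvd.trans (Nat.dvd_lcm_left _ _))]
    exact Nat.lcm_dvd h1 h2
  · rw [Nat.mul_div_cancel' n_dvd]
    exact h1

theorem phi_pow_inj {i j : ℕ} {lam : Weight k G} (h : D.phi ^ i * lam = D.phi ^ j * lam) :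
    i ≡ j [MOD D.n * D.m] := by
  have h1 : D.phi ^ i = D.phi ^ j := mul_right_cancel h
  wlog hij : i ≤ j generalizing i j
  · exact (this h.symm h1.symm (by omega)).symm
  obtain ⟨r, rfl⟩ := Nat.exists_eq_add_of_le hij
  rw [pow_add] at h1
  have h2 := dvd_of_phi_pow (left_eq_mul.mp h1)
  exact (Nat.modEq_iff_dvd' hij).mpr (by simpa using h2)

end Idempotents

end GroupDatum

namespace GroupDatum

open Finset Polynomial

/-! ### Maps and submodules tested on generators; the structure scalars -/

section Modules

variable {k : Type u} [Field k] {G : Type v} [CommGroup G] {D : GroupDatum k G}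

variable {M : Type*} [AddCommGroup M] [Module D.Double M] [Module k M] [IsScalarTower k D.Double M]
  {M' : Type*} [AddCommGroup M'] [Module D.Double M'] [Module k M'] [IsScalarTower k D.Double M']

/-- A `k`-linear map that commutes with `G`, `Γ`, `ξ` and the homogeneous part of `x` is linear
over the double. -/
def linearMapOfGens (F : M →ₗ[k] M') (hg : ∀ p u, F (D.grp p • u) = D.grp p • F u)
    (hx : ∀ u, F (D.xt • u) = D.xt • F u)
    (hxi : ∀ u, F (D.el Gen.xi • u) = D.el Gen.xi • F u) : M →ₗ[D.Double] M' where
  toFun := F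
  map_add' := F.map_add
  map_smul' := by
    -- The elements that commute with `F` form a subalgebra, which contains the generators.
    let B : Subalgebra k D.Double :=
      { carrier := {d | ∀ u, F (d • u) = d • F u}
        mul_mem' := fun {a b} ha hb u => by rw [mul_smul, ha, hb, mul_smul]
        add_mem' := fun {a b} ha hb u => by rw [add_smul, map_add, ha, hb, add_smul]
        algebraMap_mem' := fun r u => by rw [algebraMap_smul, algebraMap_smul, map_smul] }
    have hB := subalgebra_eq_top B hg hx hxi
    intro d u
    have : d ∈ B := hB ▸ Algebra.mem_top
    exact this u

/-- A subspace stable under `G`, `Γ`, `ξ` and the homogeneous part of `x` is a submodule. -/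
def submoduleOfGens (U : Submodule k M) (hg : ∀ p, ∀ u ∈ U, D.grp p • u ∈ U)
    (hx : ∀ u ∈ U, D.xt • u ∈ U) (hxi : ∀ u ∈ U, D.el Gen.xi • u ∈ U) :
    Submodule D.Double M where
  carrier := U
  add_mem' := U.add_mem
  zero_mem' := U.zero_mem
  smul_mem' := by
    let B : Subalgebra k D.Double :=
      { carrier := {d | ∀ u ∈ U, d • u ∈ U}
        mul_mem' := fun {a b} ha hb u hu => by rw [mul_smul]; exact ha _ (hb _ hu)
        add_mem' := fun {a b} ha hb u hu => by
          rw [add_smul]; exact U.add_mem (ha _ hu) (hb _ hu)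
        algebraMap_mem' := fun r u hu => by rw [algebraMap_smul]; exact U.smul_mem _ hu }
    have hB := subalgebra_eq_top B hg hx hxi
    intro d u hu
    have : d ∈ B := hB ▸ Algebra.mem_top
    exact this u hu

theorem rho_pow_ne {i j : ℕ} (hi : i < D.n) (hj : j < D.n) (h : i ≠ j) :
    (D.rho : k) ^ i ≠ (D.rho : k) ^ j := by
  intro h'
  refine h (pow_injOn_Iio_orderOf (x := D.rho) hi hj (Units.ext ?_))
  simpa using h'

/-- For `λ ∈ I_l` one has `α_i(λ) = (i)_ρ λ(a) (ρ^(1-l) - ρ^(1-i))`. As `ρ` has order `n`, neither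
factor vanishes in this range unless `i = l`. -/
theorem alphaCoeff_ne_zero {l : ℕ} {lam : Weight k G} (hl : 1 ≤ l) (hl' : l < D.n)
    (hlam : lam ∈ D.I l) {i : ℕ} (hi : 1 ≤ i) (hi' : i < D.n) (hil : i ≠ l) :
    D.alphaCoeff i lam ≠ 0 := by
  unfold alphaCoeff
  refine mul_ne_zero (fun h => ?_) (fun h => ?_)
  · have h1 := geom_sum_mul (D.rho : k) i
    unfold qNumber at h
    rw [h, zero_mul] at h1
    refine rho_pow_ne hi' (show 0 < D.n by omega) (by omega) ?_
    rw [pow_zero]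
    exact (sub_eq_zero.mp h1.symm)
  · rw [lam_chi hl hlam, Units.val_mul, ← mul_sub, mul_eq_zero, sub_eq_zero] at h
    rcases h with h | h
    · exact Units.ne_zero _ h
    · have h1 : D.rho ^ (1 - (l : ℤ)) = D.rho ^ (1 - (i : ℤ)) := Units.ext h
      rw [zpow_sub, zpow_sub, mul_right_inj, inv_inj, zpow_natCast, zpow_natCast] at h1
      exact hil (pow_injOn_Iio_orderOf (x := D.rho) hi' hl' h1.symm)

open Classical in
/-- The coefficient of the action of `ξ` on the vectors at position `j` of a block of length `n`. -/
noncomputable def xiCoeff (D : GroupDatum k G) (l : ℕ) (lam : Weight k G) (j : ℕ) : k :=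
  -- Since `α_l(λ) = 0`, position `l` needs its own value in the nilpotent case: there `ξ x_0^k =
  -- x_(n-1)^k`, with coefficient `1`.
  if j = 0 then 0 else if D.Nilpotent ∧ j ≠ l then D.alphaCoeff j lam else 1

theorem xiCoeff_zero (l : ℕ) (lam : Weight k G) : D.xiCoeff l lam 0 = 0 := if_pos rfl

theorem xiCoeff_ne_zero {l : ℕ} {lam : Weight k G} (hl : 1 ≤ l) (hl' : l < D.n)
    (hlam : lam ∈ D.I l) {j : ℕ} (hj : 1 ≤ j) (hj' : j < D.n) : D.xiCoeff l lam j ≠ 0 := by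
  unfold xiCoeff
  rw [if_neg (by omega)]
  split_ifs with h
  · exact alphaCoeff_ne_zero hl hl' hlam hj hj' h.2
  · exact one_ne_zero

end Modules

/-! ### Modules of band type and their presentation by `k[X]`-modules -/

section Bands

variable {k : Type u} [Field k] [IsAlgClosed k] [CharZero k] {G : Type v} [CommGroup G] [Finite G]

/-- `u` is a vector of weight `φ^i λ`. -/
def IsWt (D : GroupDatum k G) (lam : Weight k G) {M : Type*} [AddCommGroup M] [Module D.Double M]
    (i : ℕ) (u : M) : Prop := D.idem (D.phi ^ i * lam) • u = u

variable {D : GroupDatum k G} {l : ℕ} {lam : Weight k G}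

section IsWt

variable {M : Type*} [AddCommGroup M] [Module D.Double M] {M' : Type*} [AddCommGroup M']
  [Module D.Double M']

theorem IsWt.map {i : ℕ} {u : M} (h : D.IsWt lam i u) (F : M →ₗ[D.Double] M') :
    D.IsWt lam i (F u) := by
  unfold IsWt; rw [← map_smul, h]

theorem IsWt.add {i : ℕ} {u v : M} (h : D.IsWt lam i u) (h' : D.IsWt lam i v) :
    D.IsWt lam i (u + v) := by
  unfold IsWt; rw [smul_add, h, h']

theorem IsWt.sub {i : ℕ} {u v : M} (h : D.IsWt lam i u) (h' : D.IsWt lam i v) :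
    D.IsWt lam i (u - v) := by
  unfold IsWt; rw [smul_sub, h, h']

theorem isWt_zero {i : ℕ} : D.IsWt lam i (0 : M) := smul_zero _

theorem isWt_idem (i : ℕ) (u : M) : D.IsWt lam i (D.idem (D.phi ^ i * lam) • u) := by
  classical
  unfold IsWt
  rw [← mul_smul, idem_mul, if_pos rfl]

theorem IsWt.xt {i : ℕ} {u : M} (h : D.IsWt lam i u) : D.IsWt lam (i + 1) (D.xt • u) := by
  unfold IsWt
  rw [pow_succ', mul_assoc, ← mul_smul, ← xt_idem n_pos, mul_smul, h]

theorem IsWt.xi {i : ℕ} {u : M} (h : D.IsWt lam (i + 1) u) :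
    D.IsWt lam i (D.el Gen.xi • u) := by
  unfold IsWt
  rw [← mul_smul, idem_xi, ← mul_assoc, ← pow_succ', mul_smul, h]

theorem isWt_add_iff {i : ℕ} {u : M} : D.IsWt lam (i + D.n * D.m) u ↔ D.IsWt lam i u := by
  unfold IsWt
  rw [phi_pow_add]

theorem IsWt.idem_smul_of_ne {i : ℕ} {u : M} (h : D.IsWt lam i u) {mu : Weight k G}
    (hmu : mu ≠ D.phi ^ i * lam) : D.idem mu • u = 0 := by
  classical
  rw [← h, ← mul_smul, idem_mul, if_neg hmu, zero_smul]

theorem IsWt.idem_smul {i j : ℕ} {u : M} (h : D.IsWt lam i u) (hi : i < D.n * D.m)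
    (hj : j < D.n * D.m) (hij : j ≠ i) : D.idem (D.phi ^ j * lam) • u = 0 := by
  refine h.idem_smul_of_ne fun h' => hij ?_
  have := phi_pow_inj h'
  rwa [Nat.ModEq, Nat.mod_eq_of_lt hi, Nat.mod_eq_of_lt hj] at this

variable [Module k M] [IsScalarTower k D.Double M]

theorem IsWt.smul {i : ℕ} {u : M} (h : D.IsWt lam i u) (c : k) : D.IsWt lam i (c • u) := by
  unfold IsWt; rw [smul_comm, h]

theorem IsWt.grp {i : ℕ} {u : M} (h : D.IsWt lam i u) (p : G × Chr k G) :
    D.grp p • u = ((D.phi ^ i * lam) p : k) • u := by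
  conv_lhs => rw [← h, ← mul_smul, grp_idem, smul_assoc, h]

/-- The commutator acts by the difference of the values of the weight at `a` and `χ`. Since `φ^n` is
trivial at both, only `i` modulo `n` matters, and the scalar telescopes by `alpha_sub`. -/
theorem IsWt.comm {i : ℕ} {u : M} (h : D.IsWt lam i u) :
    D.xt • D.el Gen.xi • u - D.el Gen.xi • D.xt • u =
      (D.alphaCoeff (i % D.n) lam - D.alphaCoeff (i % D.n + 1) lam) • u := by
  rw [← mul_smul, ← mul_smul, ← sub_smul, xt_xi n_pos, sub_smul, h.grp, h.grp, ← sub_smul,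
    alpha_sub]
  have key : ∀ p, (D.phi ^ D.n) p = 1 → (D.phi ^ i * lam) p = (D.phi ^ (i % D.n) * lam) p := by
    intro p hp
    conv_lhs => rw [← Nat.mod_add_div i D.n]
    rw [pow_add, pow_mul, Chr.mul_apply, Chr.mul_apply, Chr.mul_apply, Chr.pow_apply (D.phi ^ D.n),
      hp, one_pow, mul_one]
  rw [key _ phi_n_a, key _ phi_n_chi]

/-- Induction along a block. At its start `ξ u = 0` and the commutator alone gives the scalar; each
further step adds one difference of consecutive `α`. So `ξ` determines `xt` inside blocks. -/
theorem xi_xt_smul (h0 : ∀ (i : ℕ) (u : M), D.n ∣ i → D.IsWt lam i u → D.el Gen.xi • u = 0)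
    (hinj : ∀ (i : ℕ) (u : M), ¬ D.n ∣ i + 1 → D.IsWt lam (i + 1) u → D.el Gen.xi • u = 0 → u = 0)
    (i : ℕ) (u : M) (h : D.IsWt lam i u) :
    D.el Gen.xi • D.xt • u = D.alphaCoeff (i % D.n + 1) lam • u := by
  have base : ∀ (i : ℕ) (u : M), D.n ∣ i → D.IsWt lam i u →
      D.el Gen.xi • D.xt • u = D.alphaCoeff (i % D.n + 1) lam • u := by
    intro i u hi h
    have h1 := h.comm
    rw [h0 i u hi h, smul_zero, Nat.mod_eq_zero_of_dvd hi, alpha_zero, zero_sub, zero_sub,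
      neg_smul, neg_inj] at h1
    rw [h1, Nat.mod_eq_zero_of_dvd hi]
  induction i generalizing u with
  | zero => exact base 0 u (dvd_zero _) h
  | succ i ih =>
    by_cases hi : D.n ∣ i + 1
    · exact base _ u hi h
    · have h1 := h.comm
      have h2 : D.xt • D.el Gen.xi • u = D.alphaCoeff (i % D.n + 1) lam • u := by
        -- Both sides have weight `φ^(i+1) λ`, where `ξ` is injective, so they may be compared after
        -- applying `ξ`; then the induction hypothesis for `ξ u` applies.
        refine sub_eq_zero.mp (hinj i _ hi (h.xi.xt.sub (h.smul _)) ?_)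
        rw [smul_sub, ih _ h.xi, smul_comm, sub_self]
      have h3 : (i + 1) % D.n = i % D.n + 1 := by
        have h4 := Nat.mod_lt i (n_pos (D := D))
        rw [← Nat.mod_add_mod, Nat.mod_eq_of_lt]
        refine lt_of_le_of_ne h4 fun h5 => hi ?_
        rw [Nat.dvd_iff_mod_eq_zero, ← Nat.mod_add_mod, h5, Nat.mod_self]
      rw [h2, h3, sub_smul, sub_right_inj] at h1
      rw [h1, h3]

end IsWt

/-- A module of band type: `ξ` and the homogeneous part of `x` connect the spaces of vectors of
weight `φ^i λ` cyclically. -/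
structure Good (D : GroupDatum k G) (lam : Weight k G) (M : Type*) [AddCommGroup M]
    [Module D.Double M] : Prop where
  xi_zero : ∀ (i : ℕ) (u : M), D.n ∣ i → D.IsWt lam i u → D.el Gen.xi • u = 0
  xi_inj : ∀ (i : ℕ) (u : M), ¬ D.n ∣ i + 1 → D.IsWt lam (i + 1) u → D.el Gen.xi • u = 0 → u = 0
  xi_surj : ∀ (i : ℕ) (u : M), ¬ D.n ∣ i + 1 → D.IsWt lam i u →
    ∃ v, D.IsWt lam (i + 1) v ∧ D.el Gen.xi • v = u
  x_inj : ∀ (i : ℕ) (u : M), D.n ∣ i + 1 → D.IsWt lam i u → D.xt • u = 0 → u = 0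
  x_surj : ∀ (i : ℕ) (u : M), D.n ∣ i + 1 → D.IsWt lam (i + 1) u →
    ∃ v, D.IsWt lam i v ∧ D.xt • v = u
  span : ∀ u : M, ∑ i ∈ range (D.n * D.m), D.idem (D.phi ^ i * lam) • u = u

/-- A presentation of a module of band type by a `k[X]`-module `N`, on which `X` is the
monodromy. -/
structure Band (D : GroupDatum k G) (l : ℕ) (lam : Weight k G) (M : Type*) [AddCommGroup M]
    [Module D.Double M] [Module k M] (N : Type*) [AddCommGroup N] [Module k N]
    [Module k[X] N] where
  w : ℕ → N →ₗ[k] M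
  wt : ∀ i v, D.IsWt lam i (w i v)
  xi : ∀ i v, D.el Gen.xi • w (i + 1) v = D.xiCoeff l lam ((i + 1) % D.n) • w i v
  xt : ∀ i v, D.n ∣ i + 1 → D.xt • w i v = w (i + 1) v
  -- The index runs over all of `ℕ`, so the links need no wrap-around case; the cyclic structure
  -- enters only here.
  per : ∀ i v, w (i + D.n * D.m) v = w i ((X : k[X]) • v)
  inj : ∀ i v, w i v = 0 → v = 0
  surj : ∀ i u, D.IsWt lam i u → ∃ v, w i v = u
  span : ∀ u : M, ∑ i ∈ range (D.n * D.m), D.idem (D.phi ^ i * lam) • u = u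

namespace Band

variable {M : Type*} [AddCommGroup M] [Module D.Double M] [Module k M] [IsScalarTower k D.Double M]
  {M' : Type*} [AddCommGroup M'] [Module D.Double M'] [Module k M'] [IsScalarTower k D.Double M']
  {M'' : Type*} [AddCommGroup M''] [Module D.Double M''] [Module k M'']
  [IsScalarTower k D.Double M'']
  {N : Type*} [AddCommGroup N] [Module k N] [Module k[X] N]
  {N' : Type*} [AddCommGroup N'] [Module k N'] [Module k[X] N']
  {N'' : Type*} [AddCommGroup N''] [Module k N''] [Module k[X] N'']

theorem injective (b : Band D l lam M N) (i : ℕ) : Function.Injective (b.w i) :=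
  (injective_iff_map_eq_zero _).mpr (b.inj i)

theorem xi_dvd (b : Band D l lam M N) (i : ℕ) (v : N) (h : D.n ∣ i + 1) :
    D.el Gen.xi • b.w (i + 1) v = 0 := by
  rw [b.xi, Nat.mod_eq_zero_of_dvd h, xiCoeff_zero, zero_smul]

theorem mod_ne (h : ¬ D.n ∣ i + 1) : 1 ≤ (i + 1) % D.n ∧ (i + 1) % D.n < D.n :=
  ⟨Nat.one_le_iff_ne_zero.mpr fun h' => h (Nat.dvd_of_mod_eq_zero h'), Nat.mod_lt _ n_pos⟩

theorem good (b : Band D l lam M N) (hl : 1 ≤ l) (hl' : l < D.n) (hlam : lam ∈ D.I l)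
    (hm : 0 < D.m) : Good D lam M where
  xi_zero i u hi hu := by
    -- One full turn is added to `i` because `Band.xi` speaks of successors only and `i` may be `0`.
    obtain ⟨v, rfl⟩ := b.surj _ _ (isWt_add_iff.mpr hu)
    obtain ⟨j, hj⟩ : ∃ j, i + D.n * D.m = j + 1 :=
      ⟨_, (Nat.succ_pred_eq_of_pos (by have := Nat.mul_pos (n_pos (D := D)) hm; omega)).symm⟩
    rw [hj]
    exact b.xi_dvd _ _ (hj ▸ (hi.add (dvd_mul_right _ _)))
  xi_inj i u hi hu h := by
    obtain ⟨v, rfl⟩ := b.surj _ _ hu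
    have h1 := xiCoeff_ne_zero hl hl' hlam (mod_ne hi).1 (mod_ne hi).2
    rw [b.xi, smul_eq_zero_iff_right h1] at h
    rw [b.inj _ _ h, map_zero]
  xi_surj i u hi hu := by
    obtain ⟨v, rfl⟩ := b.surj _ _ hu
    have h1 := xiCoeff_ne_zero hl hl' hlam (mod_ne hi).1 (mod_ne hi).2
    refine ⟨b.w (i + 1) ((D.xiCoeff l lam ((i + 1) % D.n))⁻¹ • v), b.wt _ _, ?_⟩
    rw [b.xi, map_smul, smul_smul, mul_inv_cancel₀ h1, one_smul]
  x_inj i u hi hu h := by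
    obtain ⟨v, rfl⟩ := b.surj _ _ hu
    rw [b.xt _ _ hi] at h
    rw [b.inj _ _ h, map_zero]
  x_surj i u hi hu := by
    obtain ⟨v, rfl⟩ := b.surj _ _ hu
    exact ⟨b.w i v, b.wt _ _, b.xt _ _ hi⟩
  span := b.span

/-- The two sides agree after applying `ξ`, which is injective at this place. This is why a band
need only prescribe `xt` across block boundaries. -/
theorem xt_not_dvd (b : Band D l lam M N) (hl : 1 ≤ l) (hl' : l < D.n) (hlam : lam ∈ D.I l)
    (hm : 0 < D.m) (i : ℕ) (v : N) (hi : ¬ D.n ∣ i + 1) :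
    D.xt • b.w i v = (D.alphaCoeff (i % D.n + 1) lam / D.xiCoeff l lam ((i + 1) % D.n)) •
      b.w (i + 1) v := by
  have hg := b.good hl hl' hlam hm
  have h1 := xiCoeff_ne_zero hl hl' hlam (mod_ne hi).1 (mod_ne hi).2
  refine sub_eq_zero.mp (hg.xi_inj i _ hi ((b.wt _ _).xt.sub ((b.wt _ _).smul _)) ?_)
  rw [smul_sub, xi_xt_smul hg.xi_zero hg.xi_inj _ _ (b.wt _ _), smul_comm (D.el Gen.xi), b.xi,
    smul_smul, div_mul_cancel₀ _ h1, sub_self]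

/-- The coordinate of a vector in the space of vectors of weight `φ^i λ`. -/
noncomputable def coord (b : Band D l lam M N) (i : ℕ) : M →ₗ[k] N :=
  (LinearEquiv.ofInjective (b.w i) (b.injective i)).symm.toLinearMap ∘ₗ
    LinearMap.codRestrict (LinearMap.range (b.w i))
      (Algebra.lsmul k k M (D.idem (D.phi ^ i * lam))) (fun u => b.surj i _ (isWt_idem i u))

theorem w_coord (b : Band D l lam M N) (i : ℕ) (u : M) :
    b.w i (b.coord i u) = D.idem (D.phi ^ i * lam) • u := by
  have := congrArg Subtype.val ((LinearEquiv.ofInjective (b.w i) (b.injective i)).apply_symm_apply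
    (LinearMap.codRestrict (LinearMap.range (b.w i))
      (Algebra.lsmul k k M (D.idem (D.phi ^ i * lam))) (fun u => b.surj i _ (isWt_idem i u)) u))
  exact this

theorem coord_w (b : Band D l lam M N) (i : ℕ) (v : N) : b.coord i (b.w i v) = v :=
  b.injective i (by rw [w_coord, b.wt])

theorem coord_w_ne (b : Band D l lam M N) {i j : ℕ} (hi : i < D.n * D.m) (hj : j < D.n * D.m)
    (hij : j ≠ i) (v : N) : b.coord j (b.w i v) = 0 :=
  b.injective j (by rw [w_coord, (b.wt i v).idem_smul hi hj hij, map_zero])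

theorem sum_coord (b : Band D l lam M N) (u : M) :
    ∑ i ∈ range (D.n * D.m), b.w i (b.coord i u) = u := by
  simp_rw [w_coord]
  exact b.span u

/-- Induction principle: a property closed under sums that holds for the vectors `w i v` with
`1 ≤ i`. -/
theorem induction_on (b : Band D l lam M N) {p : M → Prop} (u : M)
    (h : ∀ i v, p (b.w (i + 1) v)) (hz : p 0) (hadd : ∀ u v, p u → p v → p (u + v)) : p u := by
  rw [← b.sum_coord u]
  refine sum_induction _ p hadd hz fun i hi => ?_
  cases i with
  | succ i => exact h _ _
  | zero =>
    -- Place `0` has no predecessor, so the vector is rewritten as one at place `nm`, which carries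
    -- the same weight.
    have h1 : b.w 0 (b.coord 0 u) =
        b.w (D.n * D.m - 1 + 1) (b.coord (D.n * D.m - 1 + 1) (b.w 0 (b.coord 0 u))) := by
      rw [w_coord _ (D.n * D.m - 1 + 1), Nat.sub_add_cancel (mem_range.mp hi)]
      have := isWt_add_iff.mpr (b.wt 0 (b.coord 0 u))
      rw [zero_add] at this
      exact this.symm
    rw [h1]
    exact h _ _

theorem hom_ext (b : Band D l lam M N) {F F' : M →ₗ[D.Double] M'}
    (h : ∀ i v, F (b.w i v) = F' (b.w i v)) : F = F' := by
  refine LinearMap.ext fun u => b.induction_on (p := fun u => F u = F' u) u (fun _ _ => h _ _) ?_ fun u v hu hv => ?_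
  · rw [map_zero, map_zero]
  rw [map_add, map_add, hu, hv]

section Hom

variable [IsScalarTower k k[X] N] [IsScalarTower k k[X] N'] [IsScalarTower k k[X] N'']

/-- A homomorphism of `k[X]`-modules induces a homomorphism of modules of band type. -/
theorem exists_map (b : Band D l lam M N) (b' : Band D l lam M' N') (hl : 1 ≤ l) (hl' : l < D.n)
    (hlam : lam ∈ D.I l) (hm : 0 < D.m) (g : N →ₗ[k[X]] N') :
    ∃ F : M →ₗ[D.Double] M', ∀ i v, F (b.w i v) = b'.w i (g v) := by
  -- On one period of places `F` applies `g` to each coordinate; compatibility with `X` extends the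
  -- formula to all places.
  let F : M →ₗ[k] M' :=
    ∑ i ∈ range (D.n * D.m), b'.w i ∘ₗ g.restrictScalars k ∘ₗ b.coord i
  have hnm := Nat.mul_pos (n_pos (D := D)) hm
  have hF : ∀ i v, F (b.w i v) = b'.w i (g v) := by
    intro i
    induction i using Nat.strong_induction_on with
    | _ i ih =>
      intro v
      by_cases hi : i < D.n * D.m
      · simp only [F, LinearMap.sum_apply, LinearMap.comp_apply]
        rw [sum_eq_single i]
        · rw [coord_w]; rfl
        · intro j hj hji
          rw [b.coord_w_ne hi (mem_range.mp hj) hji, map_zero, map_zero]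
        · intro h; exact absurd (mem_range.mpr hi) h
      · obtain ⟨j, rfl⟩ := Nat.exists_eq_add_of_le' (not_lt.mp hi)
        rw [b.per, b'.per, ih j (by omega), map_smul]
  refine ⟨linearMapOfGens F (fun p u => ?_) (fun u => ?_) (fun u => ?_), hF⟩
  · refine b.induction_on (p := fun u => F (D.grp p • u) = D.grp p • F u) u
      (fun i v => ?_) ?_ (fun u v hu hv => ?_)
    · rw [(b.wt _ _).grp, map_smul, hF, (b'.wt _ _).grp]
    · rw [smul_zero, map_zero, smul_zero]
    · rw [smul_add, map_add, hu, hv, map_add, smul_add]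
  · refine b.induction_on (p := fun u => F (D.xt • u) = D.xt • F u) u
      (fun i v => ?_) ?_ (fun u v hu hv => ?_)
    · by_cases h : D.n ∣ i + 1 + 1
      · rw [b.xt _ _ h, hF, hF, b'.xt _ _ h]
      · rw [b.xt_not_dvd hl hl' hlam hm _ _ h, map_smul, hF, hF,
          b'.xt_not_dvd hl hl' hlam hm _ _ h]
    · rw [smul_zero, map_zero, smul_zero]
    · rw [smul_add, map_add, hu, hv, map_add, smul_add]
  · refine b.induction_on (p := fun u => F (D.el Gen.xi • u) = D.el Gen.xi • F u) u
      (fun i v => ?_) ?_ (fun u v hu hv => ?_)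
    · rw [b.xi, map_smul, hF, hF, b'.xi]
    · rw [smul_zero, map_zero, smul_zero]
    · rw [smul_add, map_add, hu, hv, map_add, smul_add]

/-- A homomorphism of modules of band type comes from a homomorphism of `k[X]`-modules. -/
theorem exists_of_map (b : Band D l lam M N) (b' : Band D l lam M' N') (hl : 1 ≤ l)
    (hl' : l < D.n) (hlam : lam ∈ D.I l) (F : M →ₗ[D.Double] M') :
    ∃ g : N →ₗ[k[X]] N', ∀ i v, F (b.w i v) = b'.w i (g v) := by
  -- `g i` is `F` on the weight space at place `i`, read in the coordinates of the two
  -- presentations.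
  let g : ℕ → N →ₗ[k] N' := fun i => b'.coord i ∘ₗ F.restrictScalars k ∘ₗ b.w i
  have hg : ∀ i v, F (b.w i v) = b'.w i (g i v) := by
    intro i v
    change _ = b'.w i (b'.coord i (F (b.w i v)))
    rw [w_coord, (b.wt i v).map F]
  -- Neighbouring places are linked by `xt` or by `ξ` with the same nonzero coefficient on both
  -- sides, and `F` commutes with the link.
  have hsucc : ∀ i v, g (i + 1) v = g i v := by
    intro i v
    by_cases h : D.n ∣ i + 1
    · apply b'.injective (i + 1)
      rw [← hg, ← b'.xt _ _ h, ← hg, ← map_smul, b.xt _ _ h]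
    · apply b'.injective i
      have h1 := xiCoeff_ne_zero hl hl' hlam (mod_ne h).1 (mod_ne h).2
      have h2 : D.el Gen.xi • F (b.w (i + 1) v) = F (D.el Gen.xi • b.w (i + 1) v) := by
        rw [map_smul]
      rw [hg, b'.xi, b.xi, LinearMap.map_smul_of_tower, hg] at h2
      exact smul_right_injective _ h1 h2
  have h0 : ∀ i v, g i v = g 0 v := by
    intro i v
    induction i with
    | zero => rfl
    | succ i ih => rw [hsucc, ih]
  -- Since `g` does not depend on the place, comparing places `0` and `nm` yields compatibility with
  -- the monodromy.
  have hX : ∀ v, g 0 ((X : k[X]) • v) = (X : k[X]) • g 0 v := by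
    intro v
    apply b'.injective 0
    rw [← hg, ← b.per, ← b'.per, hg, h0]
  refine ⟨{ toFun := g 0, map_add' := map_add _, map_smul' := fun f v => ?_ }, fun i v => ?_⟩
  · induction f using Polynomial.induction_on' with
    | add p q hp hq => rw [add_smul, map_add, hp, hq]; exact (add_smul p q _).symm
    | monomial r c =>
      have : ∀ v, g 0 ((X : k[X]) ^ r • v) = (X : k[X]) ^ r • g 0 v := by
        induction r with
        | zero => simp
        | succ r ih => intro v; rw [pow_succ', mul_smul, hX, ih, mul_smul]
      rw [← C_mul_X_pow_eq_monomial, ← smul_eq_C_mul, smul_assoc, map_smul, this, RingHom.id_apply,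
        smul_assoc]
  · rw [hg, h0]; rfl

/-- The correspondence of homomorphisms is compatible with composition and faithful, so inverse
pairs correspond in both directions. -/
theorem equiv_of_equiv (b : Band D l lam M N) (b' : Band D l lam M' N') (hl : 1 ≤ l)
    (hl' : l < D.n) (hlam : lam ∈ D.I l) (hm : 0 < D.m) (g : N ≃ₗ[k[X]] N') :
    Nonempty (M ≃ₗ[D.Double] M') := by
  obtain ⟨F, hF⟩ := b.exists_map b' hl hl' hlam hm g.toLinearMap
  obtain ⟨F', hF'⟩ := b'.exists_map b hl hl' hlam hm g.symm.toLinearMap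
  refine ⟨LinearEquiv.ofLinearMap F F' (b'.hom_ext fun i v => ?_) (b.hom_ext fun i v => ?_)⟩
  · simp [hF, hF']
  · simp [hF, hF']

theorem equiv_of_equiv' (b : Band D l lam M N) (b' : Band D l lam M' N') (hl : 1 ≤ l)
    (hl' : l < D.n) (hlam : lam ∈ D.I l) (F : M ≃ₗ[D.Double] M') :
    Nonempty (N ≃ₗ[k[X]] N') := by
  obtain ⟨g, hg⟩ := b.exists_of_map b' hl hl' hlam F.toLinearMap
  obtain ⟨g', hg'⟩ := b'.exists_of_map b hl hl' hlam F.symm.toLinearMap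
  refine ⟨LinearEquiv.ofLinearMap g g' (LinearMap.ext fun v => b'.injective 0 ?_)
    (LinearMap.ext fun v => b.injective 0 ?_)⟩
  · rw [LinearMap.comp_apply, ← hg, ← hg']; simp
  · rw [LinearMap.comp_apply, ← hg', ← hg]; simp

end Hom

/-- Transport along an isomorphism. -/
def congr (b : Band D l lam M N) (F : M ≃ₗ[D.Double] M') : Band D l lam M' N where
  w i := (F.toLinearMap.restrictScalars k) ∘ₗ b.w i
  wt i v := (b.wt i v).map F.toLinearMap
  xi i v := by
    change D.el Gen.xi • F (b.w _ v) = _ • F (b.w i v)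
    rw [← map_smul, b.xi]
    exact LinearMap.map_smul_of_tower F.toLinearMap _ _
  xt i v h := by
    change D.xt • F (b.w _ v) = F (b.w _ v)
    rw [← map_smul, b.xt _ _ h]
  per i v := congrArg F (b.per i v)
  inj i v h := b.inj i v (F.map_eq_zero_iff.mp h)
  surj i u h := by
    obtain ⟨v, hv⟩ := b.surj i (F.symm u) (h.map F.symm.toLinearMap)
    exact ⟨v, by change F (b.w i v) = u; rw [hv, F.apply_symm_apply]⟩
  span u := by
    have := congrArg F (b.span (F.symm u))
    simpa only [map_sum, map_smul, F.apply_symm_apply] using this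

/-- Replacing the `k[X]`-module of a presentation by an isomorphic one. -/
theorem nonempty_of_equiv [IsScalarTower k k[X] N] [IsScalarTower k k[X] N']
    (b : Band D l lam M N) (e : N ≃ₗ[k[X]] N') : Nonempty (Band D l lam M N') :=
  ⟨{ w := fun i => b.w i ∘ₗ (e.symm.restrictScalars k).toLinearMap
     wt := fun i v => b.wt i _
     xi := fun i v => b.xi i _
     xt := fun i v h => b.xt i _ h
     per := fun i v => by
      change b.w _ (e.symm v) = b.w i (e.symm (X • v))
      rw [b.per, e.symm.map_smul]
     inj := fun i v h => e.symm.map_eq_zero_iff.mp (b.inj i _ h)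
     surj := fun i u h => by
      obtain ⟨v, hv⟩ := b.surj i u h
      refine ⟨e v, ?_⟩
      change b.w i (e.symm (e v)) = u
      rw [e.symm_apply_apply, hv]
     span := b.span }⟩

theorem phi_pow_tau (hl : 1 ≤ l) (hl' : l < D.n) (hlam : lam ∈ D.I l) (i : ℕ) :
    D.phi ^ i * D.tau lam = D.phi ^ (i + D.n) * lam := by
  rw [(tau_eq hl hl' hlam).1, ← mul_assoc, ← pow_add]

/-- The scalars see a weight only through its values at `a` and `χ`, and `τ(λ) = φ^n λ` has the same
values there as `λ`. -/
theorem xiCoeff_tau (hl : 1 ≤ l) (hl' : l < D.n) (hlam : lam ∈ D.I l) (j : ℕ) :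
    D.xiCoeff l (D.tau lam) j = D.xiCoeff l lam j := by
  have h : D.alphaCoeff j (D.tau lam) = D.alphaCoeff j lam := by
    unfold alphaCoeff
    rw [(tau_eq hl hl' hlam).1, Chr.mul_apply, Chr.mul_apply, phi_n_a, phi_n_chi, one_mul, one_mul]
  unfold xiCoeff
  rw [h]

/-- Shifting the indices replaces `λ` by `τ(λ)`. -/
noncomputable def shift (b : Band D l lam M N) (hl : 1 ≤ l) (hl' : l < D.n) (hlam : lam ∈ D.I l) :
    Band D l (D.tau lam) M N where
  w i := b.w (i + D.n)
  wt i v := by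
    unfold IsWt
    rw [phi_pow_tau hl hl' hlam]; exact b.wt _ _
  xi i v := by
    rw [xiCoeff_tau hl hl' hlam, add_right_comm, b.xi, ← add_right_comm, Nat.add_mod_right]
  xt i v h := by
    rw [add_right_comm]
    exact b.xt _ _ (by rw [add_right_comm]; exact h.add dvd_rfl)
  per i v := by rw [add_right_comm, b.per]
  inj i v h := b.inj _ _ h
  surj i u h := by
    unfold IsWt at h
    rw [phi_pow_tau hl hl' hlam] at h
    exact b.surj _ _ h
  span u := by
    have h1 : ∀ i, D.idem (D.phi ^ (i + D.n * D.m) * lam) • u = D.idem (D.phi ^ i * lam) • u := by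
      intro i; rw [phi_pow_add]
    -- The summands are periodic of period `nm`, so the window of summation may be moved one step at
    -- a time.
    have h2 : ∀ r, ∑ i ∈ range (D.n * D.m), D.idem (D.phi ^ (i + r) * lam) • u = u := by
      intro r
      induction r with
      | zero => exact b.span u
      | succ r ih =>
        have h3 := sum_range_succ (fun i => D.idem (D.phi ^ (i + r) * lam) • u) (D.n * D.m)
        rw [sum_range_succ', ih, zero_add, add_comm (D.n * D.m), h1] at h3
        refine Eq.trans ?_ (add_right_cancel h3)
        refine sum_congr rfl fun i _ => ?_
        rw [add_assoc, add_comm 1]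
    simp_rw [phi_pow_tau hl hl' hlam]
    exact h2 D.n

theorem shift_pow (b : Band D l lam M N) (hl : 1 ≤ l) (hl' : l < D.n) (hlam : lam ∈ D.I l) (r : ℕ) :
    Nonempty (Band D l ((D.tau ^ r) lam) M N) := by
  induction r with
  | zero => exact ⟨b⟩
  | succ r ih =>
    obtain ⟨b'⟩ := ih
    rw [pow_succ']
    exact ⟨b'.shift hl hl' (tau_pow_eq hl hl' hlam r).2⟩

end Band

end Bands

end GroupDatum

/-! ### Idempotent endomorphisms, socle and length -/

section General

variable {A : Type u} [Ring A] {M : Type v} [AddCommGroup M] [Module A M]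

/-- Decompositions into two summands are idempotent endomorphisms. In this form indecomposability
passes through the correspondence of homomorphisms. -/
theorem isIndecomposableModule_iff : IsIndecomposableModule A M ↔
    Nontrivial M ∧ ∀ f : M →ₗ[A] M, f ∘ₗ f = f → f = 0 ∨ f = LinearMap.id := by
  refine and_congr_right fun _ => ⟨fun h f hf => ?_, fun h N K hNK => ?_⟩
  · have hf' : IsIdempotentElem f := hf
    rcases h _ _ (LinearMap.IsIdempotentElem.isCompl hf') with h1 | h1
    · exact Or.inl (LinearMap.range_eq_bot.mp h1)
    · refine Or.inr (LinearMap.ext fun u => LinearMap.ker_eq_bot.mp h1 ?_)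
      exact LinearMap.congr_fun hf u
  · rcases h (N.projection K hNK) (Submodule.isIdempotentElem_projection hNK) with h1 | h1
    · left
      rw [← Submodule.range_projection hNK, h1, LinearMap.range_zero]
    · right
      rw [← Submodule.ker_projection hNK, h1, LinearMap.ker_id]

/-- `P` is the sum of its simple submodules, and their images in `M` are simple submodules of `M`.
-/
theorem le_moduleSocle (P : Submodule A M) [IsSemisimpleModule A P] : P ≤ moduleSocle A M := by
  have h1 : P = Submodule.map P.subtype (sSup {m | IsSimpleModule A m}) := by
    rw [IsSemisimpleModule.sSup_simples_eq_top, Submodule.map_top, Submodule.range_subtype]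
  rw [h1, Submodule.map_le_iff_le_comap, sSup_le_iff]
  intro m hm
  rw [← Submodule.map_le_iff_le_comap]
  refine le_sSup ?_
  have : IsSimpleModule A m := hm
  exact IsSimpleModule.congr (Submodule.equivMapOfInjective _ P.subtype_injective m).symm

theorem length_eq_of_iSupIndep {ι : Type*} [Fintype ι] (L : ι → Submodule A M)
    (hs : ∀ i, IsSimpleModule A (L i)) (hind : iSupIndep L) (htop : iSup L = ⊤) :
    Module.length A M = Fintype.card ι := by
  classical
  have h1 := DirectSum.isInternal_submodule_of_iSupIndep_of_iSup_eq_top hind htop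
  rw [← (LinearEquiv.ofBijective (DirectSum.coeLinearMap L) h1).length_eq,
    (DirectSum.linearEquivFunOnFintype A ι fun i => L i).length_eq, Module.length_pi_of_fintype]
  simp [Module.length_eq_one]

end General

namespace GroupDatum

open Finset Polynomial

/-! ### Semisimple modules made of chains -/

section Blocks

variable {k : Type u} [Field k] [IsAlgClosed k] [CharZero k] {G : Type v} [CommGroup G] [Finite G]
  {D : GroupDatum k G} {l : ℕ} {lam : Weight k G}

variable {T : Type*} [AddCommGroup T] [Module D.Double T] [Module k T] [IsScalarTower k D.Double T]

theorem IsWt.idem_smul_of_mod {M : Type*} [AddCommGroup M] [Module D.Double M] {i j : ℕ} {u : M}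
    (h : D.IsWt lam i u) (hij : ¬ j ≡ i [MOD D.n]) : D.idem (D.phi ^ j * lam) • u = 0 :=
  h.idem_smul_of_ne fun h' => hij ((phi_pow_inj h').of_mul_right _)

/-- A module that is spanned by chains of length `r`, connected by `ξ` and `x`. -/
structure Blocks (D : GroupDatum k G) (lam : Weight k G) (T : Type*) [AddCommGroup T]
    [Module D.Double T] [Module k T] (N : Type*) [AddCommGroup N] [Module k N] (r s : ℕ) where
  u : ℕ → ℕ → N →ₗ[k] T
  wt : ∀ i j v, j < r → D.IsWt lam (D.n * i + (s + j)) (u i j v)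
  xi : ∀ i j v, j + 1 < r → ∃ c : k, c ≠ 0 ∧ D.el Gen.xi • u i (j + 1) v = c • u i j v
  xi_zero : ∀ i v, D.el Gen.xi • u i 0 v = 0
  xt : ∀ i j v, j + 1 < r → ∃ c : k, c ≠ 0 ∧ D.xt • u i j v = c • u i (j + 1) v
  xt_last : ∀ i v, D.xt • u i (r - 1) v = 0
  inj : ∀ i j v, j < r → u i j v = 0 → v = 0
  span : ∀ p : Submodule k T, (∀ i j v, i < D.m → j < r → u i j v ∈ p) → p = ⊤

namespace Blocks

variable {N : Type*} [AddCommGroup N] [Module k N] {r s : ℕ}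

/-- The span of a chain. -/
noncomputable def chain (B : Blocks D lam T N r s) (i : ℕ) (v : N) : Submodule D.Double T :=
  submoduleOfGens (Submodule.span k {t | ∃ j < r, t = B.u i j v})
    (by
      intro p t ht
      induction ht using Submodule.span_induction with
      | mem t ht =>
        obtain ⟨j, hj, rfl⟩ := ht
        rw [(B.wt i j v hj).grp]
        exact Submodule.smul_mem _ _ (Submodule.subset_span ⟨j, hj, rfl⟩)
      | zero => rw [smul_zero]; exact Submodule.zero_mem _
      | add x y _ _ hx hy => rw [smul_add]; exact Submodule.add_mem _ hx hy
      | smul c x _ hx => rw [smul_comm]; exact Submodule.smul_mem _ _ hx)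
    (by
      intro t ht
      induction ht using Submodule.span_induction with
      | mem t ht =>
        obtain ⟨j, hj, rfl⟩ := ht
        by_cases h : j + 1 < r
        · obtain ⟨c, -, hc⟩ := B.xt i j v h
          rw [hc]
          exact Submodule.smul_mem _ _ (Submodule.subset_span ⟨j + 1, h, rfl⟩)
        · rw [show j = r - 1 by omega, B.xt_last]; exact Submodule.zero_mem _
      | zero => rw [smul_zero]; exact Submodule.zero_mem _
      | add x y _ _ hx hy => rw [smul_add]; exact Submodule.add_mem _ hx hy
      | smul c x _ hx => rw [smul_comm]; exact Submodule.smul_mem _ _ hx)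
    (by
      intro t ht
      induction ht using Submodule.span_induction with
      | mem t ht =>
        obtain ⟨j, hj, rfl⟩ := ht
        cases j with
        | succ j =>
          obtain ⟨c, -, hc⟩ := B.xi i j v hj
          rw [hc]
          exact Submodule.smul_mem _ _ (Submodule.subset_span ⟨j, by omega, rfl⟩)
        | zero => rw [B.xi_zero]; exact Submodule.zero_mem _
      | zero => rw [smul_zero]; exact Submodule.zero_mem _
      | add x y _ _ hx hy => rw [smul_add]; exact Submodule.add_mem _ hx hy
      | smul c x _ hx => rw [smul_comm]; exact Submodule.smul_mem _ _ hx)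

theorem u_mem_chain (B : Blocks D lam T N r s) (i : ℕ) (v : N) {j : ℕ} (hj : j < r) :
    B.u i j v ∈ B.chain i v := Submodule.subset_span ⟨j, hj, rfl⟩

/-- Since `s + j < n`, the exponent lies in one period of `φ`, and `i` and `s + j` are its quotient
and remainder by `n`. -/
theorem index_eq (hr : s + r ≤ D.n) {i j i' j' : ℕ} (hi : i < D.m) (hi' : i' < D.m) (hj : j < r)
    (hj' : j' < r) (h : D.phi ^ (D.n * i + (s + j)) * lam = D.phi ^ (D.n * i' + (s + j')) * lam) :
    i = i' ∧ j = j' := by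
  have hlt : ∀ i j, i < D.m → j < r → D.n * i + (s + j) < D.n * D.m := by
    intro i j hi hj
    calc D.n * i + (s + j) < D.n * i + D.n := by omega
      _ = D.n * (i + 1) := by ring
      _ ≤ D.n * D.m := Nat.mul_le_mul_left _ hi
  have h1 := phi_pow_inj h
  rw [Nat.ModEq, Nat.mod_eq_of_lt (hlt _ _ hi hj), Nat.mod_eq_of_lt (hlt _ _ hi' hj')] at h1
  have h2 := congrArg (· % D.n) h1
  simp only [Nat.mul_add_mod] at h2
  rw [Nat.mod_eq_of_lt (by omega), Nat.mod_eq_of_lt (by omega)] at h2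
  have h3 : j = j' := by omega
  subst h3
  exact ⟨Nat.eq_of_mul_eq_mul_left n_pos (Nat.add_right_cancel h1), rfl⟩

theorem idem_chain (B : Blocks D lam T N r s) (hr : s + r ≤ D.n) {i i' j : ℕ} (hi : i < D.m)
    (hi' : i' < D.m) (hj : j < r) {v : N} {t : T} (ht : t ∈ B.chain i v) :
    ∃ c : k, D.idem (D.phi ^ (D.n * i' + (s + j)) * lam) • t =
      if i = i' then c • B.u i j v else 0 := by
  have ht' : t ∈ Submodule.span k {t | ∃ j < r, t = B.u i j v} := ht
  induction ht' using Submodule.span_induction with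
  | mem t h0 =>
    obtain ⟨j', hj', rfl⟩ := h0
    by_cases h : i = i' ∧ j' = j
    · obtain ⟨rfl, rfl⟩ := h
      refine ⟨1, ?_⟩
      rw [if_pos rfl, one_smul]
      exact B.wt i j' v hj'
    · refine ⟨0, ?_⟩
      rw [(B.wt i j' v hj').idem_smul_of_ne, zero_smul, ite_self]
      intro h'
      have := index_eq hr hi' hi hj hj' h'
      exact h ⟨this.1.symm, this.2.symm⟩
  | zero => exact ⟨0, by simp⟩
  | add x y hx hy h1 h2 =>
    obtain ⟨c, hc⟩ := h1 hx
    obtain ⟨c', hc'⟩ := h2 hy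
    refine ⟨c + c', ?_⟩
    rw [smul_add, hc, hc']
    split_ifs
    · rw [add_smul]
    · rw [add_zero]
  | smul a x hx h1 =>
    obtain ⟨c, hc⟩ := h1 hx
    refine ⟨a * c, ?_⟩
    rw [smul_comm, hc]
    split_ifs
    · rw [mul_smul]
    · rw [smul_zero]

theorem sum_idem_chain (B : Blocks D lam T N r s) (hr : s + r ≤ D.n) {i : ℕ} (hi : i < D.m)
    {v : N} {t : T} (ht : t ∈ B.chain i v) :
    ∑ j ∈ range r, D.idem (D.phi ^ (D.n * i + (s + j)) * lam) • t = t := by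
  have ht' : t ∈ Submodule.span k {t | ∃ j < r, t = B.u i j v} := ht
  induction ht' using Submodule.span_induction with
  | mem t h0 =>
    obtain ⟨j', hj', rfl⟩ := h0
    rw [sum_eq_single j']
    · exact B.wt i j' v hj'
    · intro j hj hjj
      refine (B.wt i j' v hj').idem_smul_of_ne fun h => hjj ?_
      exact (index_eq hr hi hi (mem_range.mp hj) hj' h).2
    · intro h; exact absurd (mem_range.mpr hj') h
  | zero => simp
  | add x y hx hy h1 h2 => simp_rw [smul_add]; rw [sum_add_distrib, h1 hx, h2 hy]
  | smul a x hx h1 => simp_rw [smul_comm _ a]; rw [← smul_sum, h1 hx]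

/-- From any vector of the chain `ξ` leads down to position `0`, and from there `xt` reaches every
position, always with nonzero coefficients. -/
theorem chain_le (B : Blocks D lam T N r s) {i j : ℕ} (hj : j < r) {v : N}
    {K : Submodule D.Double T} (h : B.u i j v ∈ K) : B.chain i v ≤ K := by
  have hK : ∀ (c : k) (t : T), c ≠ 0 → c • t ∈ K → t ∈ K := by
    intro c t hc ht
    have := (K.restrictScalars k).smul_mem c⁻¹ ht
    rwa [smul_smul, inv_mul_cancel₀ hc, one_smul] at this
  have hdown : ∀ j, j < r → B.u i j v ∈ K → B.u i 0 v ∈ K := by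
    intro j
    induction j with
    | zero => exact fun _ h => h
    | succ j ih =>
      intro hj h
      obtain ⟨c, hc, hc'⟩ := B.xi i j v hj
      exact ih (by omega) (hK c _ hc (hc' ▸ K.smul_mem _ h))
  have hup : ∀ j, j < r → B.u i j v ∈ K := by
    intro j'
    induction j' with
    | zero => exact fun _ => hdown j hj h
    | succ j ih =>
      intro hj
      obtain ⟨c, hc, hc'⟩ := B.xt i j v hj
      exact hK c _ hc (hc' ▸ K.smul_mem _ (ih (by omega)))
  intro t ht
  have ht' : t ∈ Submodule.span k {t | ∃ j < r, t = B.u i j v} := ht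
  have : Submodule.span k {t | ∃ j < r, t = B.u i j v} ≤ K.restrictScalars k := by
    rw [Submodule.span_le]
    rintro _ ⟨j, hj, rfl⟩
    exact hup j hj
  exact this ht'

/-- The weights along a chain are distinct, so a nonzero element of a submodule has a weight
component that is a nonzero multiple of some `u i j v`; this vector generates the chain. -/
theorem isSimpleModule_chain (B : Blocks D lam T N r s) (hr0 : 0 < r) (hr : s + r ≤ D.n) {i : ℕ}
    (hi : i < D.m) {v : N} (hv : v ≠ 0) : IsSimpleModule D.Double (B.chain i v) := by
  rw [isSimpleModule_iff_isAtom]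
  refine ⟨fun h => hv (B.inj i 0 v hr0 ?_), fun K hK => ?_⟩
  · have := B.u_mem_chain i v hr0
    rwa [h, Submodule.mem_bot] at this
  · by_contra hne
    obtain ⟨t, ht, ht0⟩ := Submodule.exists_mem_ne_zero_of_ne_bot hne
    have h1 := B.sum_idem_chain hr hi (hK.le ht)
    obtain ⟨j, hj, hj0⟩ : ∃ j ∈ range r, D.idem (D.phi ^ (D.n * i + (s + j)) * lam) • t ≠ 0 := by
      by_contra hcon
      push Not at hcon
      rw [sum_eq_zero hcon] at h1
      exact ht0 h1.symm
    rw [mem_range] at hj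
    obtain ⟨c, hc⟩ := B.idem_chain hr hi hi hj (hK.le ht)
    rw [if_pos rfl] at hc
    have hc0 : c ≠ 0 := by
      rintro rfl
      rw [hc, zero_smul] at hj0
      exact hj0 rfl
    have h2 : B.u i j v ∈ K := by
      have := (K.restrictScalars k).smul_mem c⁻¹ (hc ▸ K.smul_mem _ ht : c • B.u i j v ∈ K)
      rwa [smul_smul, inv_mul_cancel₀ hc0, one_smul] at this
    exact absurd (B.chain_le hj h2) (not_le_of_gt hK)

variable [Module.Finite k N]

/-- The chains that start from the vectors of a basis. -/
noncomputable def basisChain (B : Blocks D lam T N r s)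
    (p : Fin D.m × Fin (Module.finrank k N)) : Submodule D.Double T :=
  B.chain p.1 (Module.finBasis k N p.2)

theorem isSimpleModule_basisChain (B : Blocks D lam T N r s) (hr0 : 0 < r) (hr : s + r ≤ D.n)
    (p : Fin D.m × Fin (Module.finrank k N)) : IsSimpleModule D.Double (B.basisChain p) :=
  B.isSimpleModule_chain hr0 hr p.1.2 ((Module.finBasis k N).ne_zero _)

theorem iSup_basisChain (B : Blocks D lam T N r s) : iSup B.basisChain = ⊤ := by
  have h := B.span ((iSup B.basisChain).restrictScalars k) ?_
  · rwa [Submodule.restrictScalars_eq_top_iff] at h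
  · intro i j v hi hj
    rw [← (Module.finBasis k N).sum_repr v, map_sum]
    refine Submodule.sum_mem _ fun b _ => ?_
    rw [map_smul]
    refine Submodule.smul_mem _ _ ?_
    exact Submodule.mem_iSup_of_mem (p := B.basisChain) (⟨i, hi⟩, b) (B.u_mem_chain _ _ hj)

/-- Chains with different first index are separated by their weights. Chains with the same first
index are independent because `u i j` is injective and the chains start from basis vectors. -/
theorem iSupIndep_basisChain (B : Blocks D lam T N r s) (hr : s + r ≤ D.n) :
    iSupIndep B.basisChain := by
  rw [iSupIndep_iff_finsetSum_eq_zero_imp_eq_zero]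
  intro S t ht hsum p hp
  rw [← B.sum_idem_chain hr p.1.2 (ht p hp)]
  refine sum_eq_zero fun j hj => ?_
  rw [mem_range] at hj
  have h1 : ∀ q : Fin D.m × Fin (Module.finrank k N), ∃ c : k, q ∈ S →
      D.idem (D.phi ^ (D.n * p.1 + (s + j)) * lam) • t q =
        if q.1 = p.1 then c • B.u p.1 j (Module.finBasis k N q.2) else 0 := by
    intro q
    by_cases hq : q ∈ S
    · obtain ⟨c, hc⟩ := B.idem_chain hr q.1.2 p.1.2 hj (ht q hq)
      refine ⟨c, fun _ => ?_⟩
      rw [hc]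
      simp only [Fin.val_inj]
      split_ifs with h
      · rw [h]
      · rfl
    · exact ⟨0, fun h => absurd h hq⟩
  choose c hc using h1
  -- The weight idempotent turns the vanishing sum into the image of one linear combination of basis
  -- vectors.
  have h2 : B.u p.1 j (∑ q ∈ S, if q.1 = p.1 then c q • Module.finBasis k N q.2 else 0) = 0 := by
    have h0 := congrArg (D.idem (D.phi ^ (D.n * p.1 + (s + j)) * lam) • ·) hsum
    simp only [smul_zero, smul_sum] at h0
    rw [map_sum, ← h0]
    refine sum_congr rfl fun q hq => ?_
    rw [hc q hq]
    split_ifs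
    · rw [map_smul]
    · rw [map_zero]
  have h3 := congrArg (fun v => (Module.finBasis k N).repr v p.2) (B.inj _ _ _ hj h2)
  simp only [map_sum, map_zero, Finsupp.zero_apply, Finsupp.finsetSum_apply] at h3
  rw [sum_eq_single p] at h3
  · rw [if_pos rfl, map_smul, Finsupp.smul_apply, Module.Basis.repr_self, Finsupp.single_eq_same,
      smul_eq_mul, mul_one] at h3
    rw [hc p hp, if_pos rfl, h3, zero_smul]
  · intro q _ hqp
    split_ifs with h
    · rw [map_smul, Finsupp.smul_apply, Module.Basis.repr_self, Finsupp.single_apply, if_neg,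
        smul_zero]
      intro h'
      exact hqp (Prod.ext h h')
    · rw [map_zero, Finsupp.zero_apply]
  · intro h; exact absurd hp h

theorem isSemisimpleModule (B : Blocks D lam T N r s) (hr0 : 0 < r) (hr : s + r ≤ D.n) :
    IsSemisimpleModule D.Double T := by
  have := B.isSimpleModule_basisChain hr0 hr
  exact isSemisimpleModule_of_isSemisimpleModule_submodule' (p := B.basisChain)
    (fun _ => inferInstance) B.iSup_basisChain

theorem length_eq (B : Blocks D lam T N r s) (hr0 : 0 < r) (hr : s + r ≤ D.n) :
    Module.length D.Double T = ((Module.finrank k N * D.m : ℕ) : ℕ∞) := by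
  rw [length_eq_of_iSupIndep B.basisChain (B.isSimpleModule_basisChain hr0 hr)
    (B.iSupIndep_basisChain hr) B.iSup_basisChain]
  simp [mul_comm]

end Blocks

end Blocks

end GroupDatum

namespace GroupDatum

open Finset Polynomial

/-! ### Radical, socle and head of a band module -/

section Types

variable {k : Type u} [Field k] [IsAlgClosed k] [CharZero k] {G : Type v} [CommGroup G] [Finite G]
  {D : GroupDatum k G} {l : ℕ} {lam : Weight k G}

theorem succ_mod_of_not_dvd {i : ℕ} (hi : ¬ D.n ∣ i + 1) : (i + 1) % D.n = i % D.n + 1 := by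
  have h4 := Nat.mod_lt i (n_pos (D := D))
  rw [← Nat.mod_add_mod, Nat.mod_eq_of_lt]
  refine lt_of_le_of_ne h4 fun h5 => hi ?_
  rw [Nat.dvd_iff_mod_eq_zero, ← Nat.mod_add_mod, h5, Nat.mod_self]

theorem mod_of_dvd_succ {i : ℕ} (hi : D.n ∣ i + 1) : i % D.n = D.n - 1 := by
  by_contra h
  have h4 := Nat.mod_lt i (n_pos (D := D))
  rw [Nat.dvd_iff_mod_eq_zero, ← Nat.mod_add_mod, Nat.mod_eq_of_lt (by omega)] at hi
  omega

theorem mod_block {i j : ℕ} (hj : j < D.n) : (D.n * i + j) % D.n = j := by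
  rw [Nat.mul_add_mod, Nat.mod_eq_of_lt hj]

theorem not_dvd_block {i j : ℕ} (hj : j + 1 < D.n) : ¬ D.n ∣ D.n * i + j + 1 := by
  rw [Nat.dvd_iff_mod_eq_zero, add_assoc, mod_block hj]
  omega

theorem idem_grp (mu : Weight k G) (p : G × Chr k G) :
    D.idem mu * D.grp p = (mu p : k) • D.idem mu := by
  rw [← grp_idem]
  unfold idem
  rw [smul_mul_assoc, mul_smul_comm, sum_mul, mul_sum]
  congr 2
  funext q
  rw [smul_mul_assoc, mul_smul_comm, grp_comm]

namespace Band

variable {M : Type*} [AddCommGroup M] [Module D.Double M] [Module k M] [IsScalarTower k D.Double M]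
  {N : Type*} [AddCommGroup N] [Module k N] [Module k[X] N]

/-- Because `α_l(λ) = 0`, the upward motion breaks between the positions `l - 1` and `l` of each
block. This cut separates the two Loewy layers. -/
theorem xt_smul_w_eq_zero (b : Band D l lam M N) (hl : 1 ≤ l) (hl' : l < D.n) (hlam : lam ∈ D.I l)
    (hm : 0 < D.m) {i : ℕ} (hi : i % D.n + 1 = l) (v : N) : D.xt • b.w i v = 0 := by
  have h : ¬ D.n ∣ i + 1 := fun h => by have := mod_of_dvd_succ h; omega
  rw [b.xt_not_dvd hl hl' hlam hm _ _ h, hi, alpha_l hl hlam, zero_div, zero_smul]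

theorem xt_ne (b : Band D l lam M N) (hl : 1 ≤ l) (hl' : l < D.n) (hlam : lam ∈ D.I l)
    (hm : 0 < D.m) {i : ℕ} (hi : ¬ D.n ∣ i + 1) (hil : i % D.n + 1 ≠ l) (v : N) :
    ∃ c : k, c ≠ 0 ∧ D.xt • b.w i v = c • b.w (i + 1) v := by
  refine ⟨_, ?_, b.xt_not_dvd hl hl' hlam hm _ _ hi⟩
  have h := mod_ne hi
  refine div_ne_zero (alphaCoeff_ne_zero hl hl' hlam (by omega) ?_ hil)
    (xiCoeff_ne_zero hl hl' hlam h.1 h.2)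
  rw [← succ_mod_of_not_dvd hi]; exact h.2

theorem xi_ne (b : Band D l lam M N) (hl : 1 ≤ l) (hl' : l < D.n) (hlam : lam ∈ D.I l)
    {i : ℕ} (hi : ¬ D.n ∣ i + 1) (v : N) :
    ∃ c : k, c ≠ 0 ∧ D.el Gen.xi • b.w (i + 1) v = c • b.w i v :=
  ⟨_, xiCoeff_ne_zero hl hl' hlam (mod_ne hi).1 (mod_ne hi).2, b.xi _ _⟩

theorem xi_eq_zero (b : Band D l lam M N) (hl : 1 ≤ l) (hl' : l < D.n) (hlam : lam ∈ D.I l)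
    (hm : 0 < D.m) {i : ℕ} (hi : D.n ∣ i) (v : N) : D.el Gen.xi • b.w i v = 0 :=
  (b.good hl hl' hlam hm).xi_zero i _ hi (b.wt i v)

theorem exists_w_idem (b : Band D l lam M N) (i : ℕ) (u : M) :
    ∃ v, D.idem (D.phi ^ i * lam) • u = b.w i v := ⟨_, (b.w_coord i u).symm⟩

theorem add_nm_sub (hm : 0 < D.m) (i : ℕ) : i + D.n * D.m = (i + D.n * D.m - 1) + 1 := by
  have := Nat.mul_pos (n_pos (D := D)) hm
  omega

/-- The submodule spanned by the vectors at the positions `j < l` of the blocks. -/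
noncomputable def low (b : Band D l lam M N) (hl : 1 ≤ l) (hl' : l < D.n) (hlam : lam ∈ D.I l)
    (hm : 0 < D.m) : Submodule D.Double M :=
  submoduleOfGens
    { carrier := {u | ∀ i, l ≤ i % D.n → D.idem (D.phi ^ i * lam) • u = 0}
      add_mem' := fun {u v} hu hv i hi => by rw [smul_add, hu i hi, hv i hi, add_zero]
      zero_mem' := fun i _ => smul_zero _
      smul_mem' := fun c u hu i hi => by rw [smul_comm, hu i hi, smul_zero] }
    (fun p u hu i hi => by rw [← mul_smul, idem_grp, smul_assoc, hu i hi, smul_zero])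
    (fun u hu i hi => by
      -- A full turn is added so that the place has a predecessor `i'`, from which `xt` arrives.
      have h1 : (i + D.n * D.m) % D.n = i % D.n := by simp
      rw [← phi_pow_add, add_nm_sub hm] at *
      generalize i + D.n * D.m - 1 = i' at *
      have h2 : ¬ D.n ∣ i' + 1 := fun h => by rw [Nat.mod_eq_zero_of_dvd h] at h1; omega
      rw [pow_succ', mul_assoc, ← mul_smul, ← xt_idem n_pos, mul_smul]
      rw [succ_mod_of_not_dvd h2] at h1
      by_cases h3 : l ≤ i' % D.n
      · rw [hu _ h3, smul_zero]
      -- Here `i'` lies below the cut and its successor above it, so `i'` is at position `l - 1`,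
      -- where `xt` is zero.
      · obtain ⟨v, hv⟩ := b.exists_w_idem i' u
        rw [hv]
        exact b.xt_smul_w_eq_zero hl hl' hlam hm (by omega) v)
    (fun u hu i hi => by
      rw [← mul_smul, idem_xi, ← mul_assoc, ← pow_succ', mul_smul]
      by_cases h : D.n ∣ i + 1
      · obtain ⟨v, hv⟩ := b.exists_w_idem (i + 1) u
        rw [hv]
        exact b.xi_eq_zero hl hl' hlam hm h v
      · rw [hu (i + 1) (by rw [succ_mod_of_not_dvd h]; omega), smul_zero])

variable (b : Band D l lam M N) (hl : 1 ≤ l) (hl' : l < D.n) (hlam : lam ∈ D.I l) (hm : 0 < D.m)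

theorem w_mem_low {i : ℕ} (hi : i % D.n < l) (v : N) : b.w i v ∈ b.low hl hl' hlam hm := by
  intro j hj
  refine (b.wt i v).idem_smul_of_mod fun h => ?_
  rw [Nat.ModEq] at h
  omega

theorem w_zero_of_mem_low {i : ℕ} (hi : l ≤ i % D.n) {v : N}
    (h : b.w i v ∈ b.low hl hl' hlam hm) : v = 0 :=
  b.inj i v (by rw [← h i hi]; exact (b.wt i v).symm)

theorem smul_mem_cancel {K : Submodule D.Double M} {c : k} {u : M} (hc : c ≠ 0) (h : c • u ∈ K) :
    u ∈ K := by
  have := (K.restrictScalars k).smul_mem c⁻¹ h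
  rwa [smul_smul, inv_mul_cancel₀ hc, one_smul] at this

include b hl hl' hlam in
/-- A submodule that contains the vectors at the positions `j ≥ l` is everything. -/
theorem eq_top_of_high {K : Submodule D.Double M}
    (h : ∀ i v, l ≤ i % D.n → b.w i v ∈ K) : K = ⊤ := by
  have key : ∀ r i v, l ≤ i % D.n + r → b.w i v ∈ K := by
    intro r
    induction r with
    | zero => exact fun i v hi => h i v hi
    | succ r ih =>
      intro i v hi
      by_cases h1 : l ≤ i % D.n
      · exact h i v h1
      · have h2 : ¬ D.n ∣ i + 1 := fun h => by have := mod_of_dvd_succ h; omega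
        obtain ⟨c, hc, hc'⟩ := b.xi_ne hl hl' hlam h2 v
        have h3 := ih (i + 1) v (by rw [succ_mod_of_not_dvd h2]; omega)
        exact smul_mem_cancel hc (hc' ▸ K.smul_mem _ h3)
  rw [eq_top_iff]
  intro u _
  rw [← b.sum_coord u]
  exact K.sum_mem fun i _ => key l i _ (by omega)

/-- If a maximal `K` did not contain `low`, then `K + low` would be everything. The idempotents of
the positions `j ≥ l` kill `low`, so `K` would contain all vectors there, and these generate the
module by means of `ξ`. -/
theorem low_le_jacobson : b.low hl hl' hlam hm ≤ Module.jacobson D.Double M := by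
  refine le_sInf fun K hK => ?_
  by_contra hle
  refine hK.1 (b.eq_top_of_high hl hl' hlam fun i v hi => ?_)
  have hsup := hK.2 _ (right_lt_sup.mpr hle)
  obtain ⟨s, hs, κ, hκ, hsum⟩ := Submodule.mem_sup.mp (hsup ▸ Submodule.mem_top : b.w i v ∈ _)
  have h1 : b.w i v = D.idem (D.phi ^ i * lam) • κ := by
    conv_lhs => rw [← b.wt i v, ← hsum]
    rw [smul_add, hs i hi, zero_add]
  rw [h1]
  exact K.smul_mem _ hκ

theorem sum_coord_low {u : M} (hu : u ∈ b.low hl hl' hlam hm) :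
    ∑ i ∈ (range (D.n * D.m)).filter (fun i => i % D.n < l), b.w i (b.coord i u) = u := by
  rw [sum_filter]
  conv_rhs => rw [← b.sum_coord u]
  refine sum_congr rfl fun i _ => ?_
  split_ifs with h
  · rfl
  · rw [w_coord, hu i (not_lt.mp h)]

/-- The chains that span the submodule `low`. -/
noncomputable def lowBlocks : Blocks D lam (b.low hl hl' hlam hm) N l 0 where
  -- The reduction `j % l` keeps the values in `low` for every natural number `j`; it changes
  -- nothing for `j < l`.
  u i j := LinearMap.codRestrict ((b.low hl hl' hlam hm).restrictScalars k) (b.w (D.n * i + j % l))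
    (fun v => b.w_mem_low hl hl' hlam hm
      (by have := Nat.mod_lt j hl; rw [mod_block (by omega)]; exact this) v)
  wt i j v hj := by
    rw [zero_add]
    refine Subtype.ext ?_
    change _ • b.w _ v = b.w (D.n * i + j % l) v
    rw [Nat.mod_eq_of_lt hj]
    exact b.wt _ v
  xi i j v hj := by
    obtain ⟨c, hc, h⟩ := b.xi_ne hl hl' hlam (not_dvd_block (i := i) (j := j) (by omega)) v
    refine ⟨c, hc, Subtype.ext ?_⟩
    change _ • b.w (D.n * i + (j + 1) % l) v = c • b.w (D.n * i + j % l) v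
    rw [Nat.mod_eq_of_lt hj, Nat.mod_eq_of_lt (by omega), ← add_assoc]
    exact h
  xi_zero i v := Subtype.ext (b.xi_eq_zero hl hl' hlam hm (by simp) v)
  xt i j v hj := by
    obtain ⟨c, hc, h⟩ := b.xt_ne hl hl' hlam hm (not_dvd_block (i := i) (j := j) (by omega))
      (by rw [mod_block (by omega)]; omega) v
    refine ⟨c, hc, Subtype.ext ?_⟩
    change _ • b.w (D.n * i + j % l) v = c • b.w (D.n * i + (j + 1) % l) v
    rw [Nat.mod_eq_of_lt hj, Nat.mod_eq_of_lt (by omega), ← add_assoc]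
    exact h
  xt_last i v := by
    refine Subtype.ext (b.xt_smul_w_eq_zero hl hl' hlam hm ?_ v)
    rw [Nat.mod_eq_of_lt (show l - 1 < l by omega), mod_block (by omega)]
    omega
  inj i j v _ h := b.inj _ v (congrArg Subtype.val h)
  span p hp := by
    rw [eq_top_iff]
    intro t _
    have h1 : t.1 ∈ p.map ((b.low hl hl' hlam hm).subtype.restrictScalars k) := by
      rw [← b.sum_coord_low hl hl' hlam hm t.2]
      refine Submodule.sum_mem _ fun i hi => ?_
      rw [mem_filter, mem_range] at hi
      have h2 := hp (i / D.n) (i % D.n) (b.coord i t.1) (Nat.div_lt_of_lt_mul hi.1) hi.2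
      refine ⟨_, h2, ?_⟩
      change b.w (D.n * (i / D.n) + i % D.n % l) _ = _
      rw [Nat.mod_eq_of_lt hi.2, Nat.div_add_mod]
    obtain ⟨t', ht', h⟩ := h1
    rwa [← Subtype.ext h]

/-- The chains that span the quotient by `low`. -/
noncomputable def highBlocks : Blocks D lam (M ⧸ b.low hl hl' hlam hm) N (D.n - l) l where
  u i j := (b.low hl hl' hlam hm).mkQ.restrictScalars k ∘ₗ b.w (D.n * i + (l + j))
  wt i j v hj := (b.wt _ v).map (b.low hl hl' hlam hm).mkQ
  xi i j v hj := by
    obtain ⟨c, hc, h⟩ := b.xi_ne hl hl' hlam (not_dvd_block (i := i) (j := l + j) (by omega)) v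
    refine ⟨c, hc, ?_⟩
    change _ • (b.low hl hl' hlam hm).mkQ (b.w (D.n * i + (l + j) + 1) v) = _
    rw [← map_smul, h]
    exact LinearMap.map_smul_of_tower _ _ _
  xi_zero i v := by
    change _ • (b.low hl hl' hlam hm).mkQ (b.w (D.n * i + l) v) = 0
    rw [← map_smul]
    refine (Submodule.Quotient.mk_eq_zero _).mpr ?_
    -- From position `l`, `ξ` leads to position `l - 1`, which vanishes in the quotient.
    obtain ⟨c, -, h⟩ := b.xi_ne hl hl' hlam (not_dvd_block (i := i) (j := l - 1) (by omega)) v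
    rw [add_assoc, Nat.sub_add_cancel hl] at h
    rw [h]
    exact ((b.low hl hl' hlam hm).restrictScalars k).smul_mem c
      (b.w_mem_low hl hl' hlam hm (by rw [mod_block (by omega)]; omega) v)
  xt i j v hj := by
    obtain ⟨c, hc, h⟩ := b.xt_ne hl hl' hlam hm (not_dvd_block (i := i) (j := l + j) (by omega))
      (by rw [mod_block (by omega)]; omega) v
    refine ⟨c, hc, ?_⟩
    change _ • (b.low hl hl' hlam hm).mkQ (b.w (D.n * i + (l + j)) v) =
      c • (b.low hl hl' hlam hm).mkQ (b.w (D.n * i + (l + j) + 1) v)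
    rw [← map_smul, h]
    exact LinearMap.map_smul_of_tower _ _ _
  xt_last i v := by
    change _ • (b.low hl hl' hlam hm).mkQ (b.w (D.n * i + (l + (D.n - l - 1))) v) = 0
    -- From the last position `xt` leads to position `0` of the next block, which also vanishes in
    -- the quotient.
    have h1 : D.n * i + (l + (D.n - l - 1)) + 1 = D.n * (i + 1) := by
      rw [mul_add, mul_one]; omega
    rw [← map_smul, b.xt _ _ (by rw [h1]; exact dvd_mul_right _ _), h1]
    exact (Submodule.Quotient.mk_eq_zero _).mpr
      (b.w_mem_low hl hl' hlam hm (by rw [Nat.mul_mod_right]; omega) v)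
  inj i j v hj h :=
    b.w_zero_of_mem_low hl hl' hlam hm (by rw [mod_block (by omega)]; omega)
      ((Submodule.Quotient.mk_eq_zero _).mp h)
  span p hp := by
    rw [eq_top_iff]
    intro t _
    obtain ⟨u, rfl⟩ := Submodule.mkQ_surjective _ t
    rw [← b.sum_coord u, map_sum]
    refine Submodule.sum_mem _ fun i hi => ?_
    rw [mem_range] at hi
    by_cases h : i % D.n < l
    · rw [show (b.low hl hl' hlam hm).mkQ (b.w i (b.coord i u)) = 0 from
        (Submodule.Quotient.mk_eq_zero _).mpr (b.w_mem_low hl hl' hlam hm h _)]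
      exact p.zero_mem
    · have h3 := Nat.mod_lt i (n_pos (D := D))
      have h2 := hp (i / D.n) (i % D.n - l) (b.coord i u) (Nat.div_lt_of_lt_mul hi) (by omega)
      rw [show l + (i % D.n - l) = i % D.n by omega, Nat.div_add_mod] at h2
      exact h2

/-- A nonzero weight component of an element of `K` can be moved down by `ξ`, without becoming zero,
until its position is below `l`. -/
theorem exists_low_of_ne_bot {K : Submodule D.Double M} (hK : K ≠ ⊥) :
    ∃ u ∈ K, u ∈ b.low hl hl' hlam hm ∧ u ≠ 0 := by
  obtain ⟨u, hu, hu0⟩ := Submodule.exists_mem_ne_zero_of_ne_bot hK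
  have key : ∀ r i v, i % D.n ≤ r → b.w i v ∈ K → v ≠ 0 →
      ∃ u ∈ K, u ∈ b.low hl hl' hlam hm ∧ u ≠ 0 := by
    intro r
    induction r with
    | zero =>
      intro i v hi h hv
      exact ⟨_, h, b.w_mem_low hl hl' hlam hm (by omega) v, fun h => hv (b.inj _ _ h)⟩
    | succ r ih =>
      intro i v hi h hv
      by_cases h1 : i % D.n < l
      · exact ⟨_, h, b.w_mem_low hl hl' hlam hm h1 v, fun h => hv (b.inj _ _ h)⟩
      · obtain ⟨i, rfl⟩ : ∃ j, i = j + 1 := Nat.exists_eq_succ_of_ne_zero (by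
          rintro rfl; rw [Nat.zero_mod] at h1; omega)
        have h2 : ¬ D.n ∣ i + 1 := fun h => by rw [Nat.mod_eq_zero_of_dvd h] at h1; omega
        rw [succ_mod_of_not_dvd h2] at hi
        obtain ⟨c, hc, hc'⟩ := b.xi_ne hl hl' hlam h2 v
        exact ih i v (by omega) (smul_mem_cancel hc (hc' ▸ K.smul_mem _ h)) hv
  obtain ⟨i, -, hi⟩ : ∃ i ∈ range (D.n * D.m), b.w i (b.coord i u) ≠ 0 := by
    by_contra hcon
    push Not at hcon
    exact hu0 (by rw [← b.sum_coord u, sum_eq_zero hcon])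
  refine key _ i (b.coord i u) le_rfl ?_ (fun h => hi (by rw [h, map_zero]))
  rw [w_coord]
  exact K.smul_mem _ hu

/-- The quotient by `low` is a sum of simple chains, so its radical is zero; this gives the
inclusion missing from `low_le_jacobson`. -/
theorem jacobson_eq [Module.Finite k N] : Module.jacobson D.Double M = b.low hl hl' hlam hm := by
  refine le_antisymm (Module.jacobson_le_of_eq_bot ?_) (b.low_le_jacobson hl hl' hlam hm)
  have := (b.highBlocks hl hl' hlam hm).isSemisimpleModule (by omega) (by omega)
  exact IsSemisimpleModule.jacobson_eq_bot _ _

/-- `low` meets every nonzero submodule, so it contains each simple one; conversely it is itself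
semisimple. -/
theorem moduleSocle_eq [Module.Finite k N] : moduleSocle D.Double M = b.low hl hl' hlam hm := by
  refine le_antisymm (sSup_le fun K hK => ?_) ?_
  · have hK' : IsSimpleModule D.Double K := hK
    rw [isSimpleModule_iff_isAtom] at hK'
    obtain ⟨u, hu, hu', hu0⟩ := b.exists_low_of_ne_bot hl hl' hlam hm hK'.1
    rcases hK'.le_iff.mp (inf_le_left : K ⊓ b.low hl hl' hlam hm ≤ K) with h | h
    · have : u ∈ K ⊓ b.low hl hl' hlam hm := ⟨hu, hu'⟩
      rw [h, Submodule.mem_bot] at this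
      exact absurd this hu0
    · exact inf_eq_left.mp h
  · have := (b.lowBlocks hl hl' hlam hm).isSemisimpleModule (by omega) (by omega)
    exact le_moduleSocle _

section

variable [IsScalarTower k k[X] N]

include b hl hl' hlam hm in
theorem isIndecomposableModule_iff' :
    IsIndecomposableModule D.Double M ↔ IsIndecomposableModule k[X] N := by
  rw [isIndecomposableModule_iff, isIndecomposableModule_iff]
  refine and_congr ⟨fun h => ?_, fun h => ?_⟩ ⟨fun h g hg => ?_, fun h F hF => ?_⟩
  · by_contra hN
    rw [not_nontrivial_iff_subsingleton] at hN
    obtain ⟨u, hu⟩ := exists_ne (0 : M)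
    apply hu
    rw [← b.sum_coord u]
    exact sum_eq_zero fun i _ => by rw [Subsingleton.elim (b.coord i u) 0, map_zero]
  · exact (b.injective 0).nontrivial
  · obtain ⟨F, hF⟩ := b.exists_map b hl hl' hlam hm g
    have h1 : F ∘ₗ F = F := b.hom_ext fun i v => by
      rw [LinearMap.comp_apply, hF, hF, ← LinearMap.comp_apply, hg]
    rcases h F h1 with rfl | rfl
    · exact Or.inl (LinearMap.ext fun v => b.inj 0 _ (by rw [← hF]; rfl))
    · exact Or.inr (LinearMap.ext fun v => b.injective 0 (by rw [← hF]; rfl))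
  · obtain ⟨g, hg⟩ := b.exists_of_map b hl hl' hlam F
    have h1 : g ∘ₗ g = g := LinearMap.ext fun v => b.injective 0 (by
      rw [LinearMap.comp_apply, ← hg, ← hg]; exact LinearMap.congr_fun hF _)
    rcases h g h1 with rfl | rfl
    · exact Or.inl (b.hom_ext fun i v => by rw [hg]; simp)
    · exact Or.inr (b.hom_ext fun i v => by rw [hg]; simp)

-- In each of the `m` blocks, each of the two layers contributes one simple chain for every basis
-- vector of `N`.
include b hl hl' hlam hm in
theorem isOfType [Module.Finite k N] (hN : IsIndecomposableModule k[X] N) :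
    IsOfType D.Double M (Module.finrank k N * D.m) (Module.finrank k N * D.m) := by
  refine ⟨(b.isIndecomposableModule_iff' hl hl' hlam hm).mpr hN, ?_, ?_, ?_, ?_⟩
  · rw [b.jacobson_eq hl hl' hlam hm]
    intro h
    obtain ⟨v, hv⟩ := @exists_ne N hN.1 0
    have := b.w_mem_low hl hl' hlam hm (i := 0) (by rw [Nat.zero_mod]; omega) v
    rw [h, Submodule.mem_bot] at this
    exact hv (b.inj _ _ this)
  · rw [b.jacobson_eq hl hl' hlam hm]
    have := (b.lowBlocks hl hl' hlam hm).isSemisimpleModule (by omega) (by omega)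
    exact IsSemisimpleModule.jacobson_eq_bot _ _
  · rw [b.jacobson_eq hl hl' hlam hm]
    exact (b.highBlocks hl hl' hlam hm).length_eq (by omega) (by omega)
  · rw [b.moduleSocle_eq hl hl' hlam hm]
    exact (b.lowBlocks hl hl' hlam hm).length_eq (by omega) (by omega)

end

end Band

end Types

end GroupDatum

open Polynomial

/-! ### Indecomposable direct sums -/

section DirectSums

variable {A : Type u} [Ring A] {M : Type v} [AddCommGroup M] [Module A M]

/-- An indecomposable module that is isomorphic to a finite direct sum is isomorphic to one of the
summands. -/
theorem IsIndecomposableModule.exists_equiv (h : IsIndecomposableModule A M) {ι : Type*} [Fintype ι]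
    {Q : ι → Type*} [∀ i, AddCommGroup (Q i)] [∀ i, Module A (Q i)]
    (e : M ≃ₗ[A] DirectSum ι Q) : ∃ i, Nonempty (M ≃ₗ[A] Q i) := by
  classical
  rw [isIndecomposableModule_iff] at h
  -- These are the idempotents of the summands. They cannot all be zero, and a nonzero one must be
  -- the identity.
  let f : ι → M →ₗ[A] M := fun i => e.symm.toLinearMap ∘ₗ DirectSum.lof A ι Q i ∘ₗ
    DirectSum.component A ι Q i ∘ₗ e.toLinearMap
  have hf : ∀ i, f i ∘ₗ f i = f i := by
    intro i
    ext u
    simp [f, DirectSum.component.lof_self]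
  by_cases h0 : ∀ i, f i = 0
  · exfalso
    obtain ⟨u, hu⟩ := @exists_ne M h.1 0
    apply hu
    apply e.injective
    rw [map_zero]
    refine DirectSum.ext_component A fun i => ?_
    have h1 := congrArg (fun u => DirectSum.component A ι Q i (e u)) (LinearMap.congr_fun (h0 i) u)
    simpa [f, DirectSum.component.lof_self] using h1
  · push Not at h0
    obtain ⟨i, hi⟩ := h0
    have h1 := (h.2 _ (hf i)).resolve_left hi
    refine ⟨i, ⟨LinearEquiv.ofBijective (DirectSum.component A ι Q i ∘ₗ e.toLinearMap)
      ⟨fun u v huv => ?_, fun q => ?_⟩⟩⟩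
    · have h2 : f i u = f i v :=
        congrArg (fun q => e.symm (DirectSum.lof A ι Q i q)) huv
      rwa [h1] at h2
    · exact ⟨e.symm (DirectSum.lof A ι Q i q), by simp [DirectSum.component.lof_self]⟩

end DirectSums

/-! ### The cyclic modules `k[X] / (X - η)^t` -/

section Jordan

variable {k : Type u} [Field k]

/-- The cyclic `k[X]`-module `k[X] / (X - η)^t`. -/
abbrev Jordan (η : k) (t : ℕ) : Type u := k[X] ⧸ Submodule.span k[X] {(X - C η) ^ t}

namespace Jordan

variable {η : k} {t : ℕ}

theorem irred (η : k) : Irreducible (X - C η) := irreducible_X_sub_C η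

theorem mk_eq_zero {f : k[X]} : (Submodule.mkQ (Submodule.span k[X] {(X - C η) ^ t})) f = 0 ↔
    (X - C η) ^ t ∣ f := by
  rw [Submodule.mkQ_apply, Submodule.Quotient.mk_eq_zero]
  exact Ideal.mem_span_singleton

theorem finrank_eq : Module.finrank k (Jordan η t) = t := by
  have h := finrank_quotient_span_eq_natDegree (K := k) (f := (X - C η) ^ t)
  rw [natDegree_pow, natDegree_X_sub_C, mul_one] at h
  exact h

theorem finite (η : k) (t : ℕ) : Module.Finite k (Jordan η t) :=
  Polynomial.Monic.finite_quotient ((monic_X_sub_C η).pow t)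

theorem smul_mk (f g : k[X]) :
    f • (Submodule.mkQ (Submodule.span k[X] {(X - C η) ^ t})) g = Submodule.mkQ _ (f * g) := rfl

theorem pow_smul (v : Jordan η t) : (X - C η) ^ t • v = 0 := by
  obtain ⟨g, rfl⟩ := Submodule.mkQ_surjective _ v
  rw [smul_mk, mk_eq_zero]
  exact dvd_mul_right _ _

/-- This makes `X` act bijectively on the Jordan module, as a monodromy must. -/
theorem isCoprime_X (hη : η ≠ 0) : IsCoprime (X : k[X]) ((X - C η) ^ t) := by
  refine IsCoprime.pow_right ?_
  -- The Bézout identity is `η⁻¹ X - η⁻¹ (X - η) = 1`.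
  refine ⟨C η⁻¹, -C η⁻¹, ?_⟩
  have : (C η⁻¹ * C η : k[X]) = 1 := by rw [← C_mul, inv_mul_cancel₀ hη, C_1]
  linear_combination this

theorem X_injective (hη : η ≠ 0) {v : Jordan η t} (h : (X : k[X]) • v = 0) : v = 0 := by
  obtain ⟨g, rfl⟩ := Submodule.mkQ_surjective _ v
  rw [smul_mk, mk_eq_zero] at h
  rw [mk_eq_zero]
  exact (isCoprime_X hη).symm.dvd_of_dvd_mul_left h

theorem X_surjective (hη : η ≠ 0) (v : Jordan η t) : ∃ w, (X : k[X]) • w = v := by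
  obtain ⟨a, b, h⟩ := isCoprime_X (t := t) hη
  refine ⟨a • v, ?_⟩
  conv_rhs => rw [← one_smul k[X] v, ← h, add_smul, mul_smul b, pow_smul, smul_zero, add_zero]
  rw [smul_smul, mul_comm]

/-- An endomorphism is multiplication by some `r`. If it is idempotent, then `(X - η)^t` divides `r
(r - 1)`, and since `X - η` cannot divide both factors, the whole power divides one of them. -/
theorem indecomposable (ht : 1 ≤ t) : IsIndecomposableModule k[X] (Jordan η t) := by
  rw [isIndecomposableModule_iff]
  refine ⟨?_, fun f hf => ?_⟩
  · refine ⟨⟨Submodule.mkQ _ 1, 0, fun h => ?_⟩⟩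
    rw [mk_eq_zero] at h
    exact (irred η).not_isUnit (isUnit_of_dvd_one ((dvd_pow_self _ (by omega)).trans h))
  · obtain ⟨r, hr⟩ := Submodule.mkQ_surjective _ (f (Submodule.mkQ _ 1))
    have h1 : ∀ g, f (Submodule.mkQ _ g) = Submodule.mkQ _ (g * r) := by
      intro g
      have : f (g • Submodule.mkQ _ 1) = g • f (Submodule.mkQ _ 1) := map_smul _ _ _
      rwa [smul_mk, mul_one, ← hr, smul_mk] at this
    have h2 : (X - C η) ^ t ∣ r * (r - 1) := by
      have := LinearMap.congr_fun hf (Submodule.mkQ _ 1)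
      rw [LinearMap.comp_apply, h1, h1, one_mul, ← sub_eq_zero, ← map_sub, mk_eq_zero] at this
      rwa [mul_sub, mul_one]
    by_cases h3 : X - C η ∣ r
    · have h4 : ¬ X - C η ∣ r - 1 := by
        intro h
        have := dvd_sub h3 h
        rw [sub_sub_cancel] at this
        exact (irred η).not_isUnit (isUnit_of_dvd_one this)
      have h5 := (((irred η).coprime_iff_not_dvd.mpr h4).pow_left (m := t)).dvd_of_dvd_mul_right h2
      left
      refine LinearMap.ext fun v => ?_
      obtain ⟨g, rfl⟩ := Submodule.mkQ_surjective _ v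
      rw [h1, LinearMap.zero_apply, mk_eq_zero]
      exact h5.mul_left g
    · have h5 := (((irred η).coprime_iff_not_dvd.mpr h3).pow_left (m := t)).dvd_of_dvd_mul_left h2
      right
      refine LinearMap.ext fun v => ?_
      obtain ⟨g, rfl⟩ := Submodule.mkQ_surjective _ v
      rw [h1, LinearMap.id_apply, ← sub_eq_zero, ← map_sub, mk_eq_zero]
      have := h5.mul_left g
      rwa [mul_sub, mul_one] at this

/-- The exponent is the dimension, and `η` is recovered as the root of the annihilator. -/
theorem eq_of_equiv {η' : k} {t' : ℕ} (ht : 1 ≤ t) (e : Jordan η t ≃ₗ[k[X]] Jordan η' t') :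
    t = t' ∧ η = η' := by
  have h1 : t = t' := by
    have := (e.restrictScalars k).finrank_eq
    rwa [finrank_eq, finrank_eq] at this
  refine ⟨h1, ?_⟩
  have h2 : (X - C η') ^ t' • (Submodule.mkQ _ 1 : Jordan η t) = 0 := by
    apply e.injective
    rw [map_smul, pow_smul, map_zero]
  rw [smul_mk, mk_eq_zero, mul_one] at h2
  have h3 := (irred η).prime.dvd_of_dvd_pow ((dvd_pow_self _ (by omega)).trans h2)
  rw [dvd_iff_isRoot, IsRoot, eval_sub, eval_X, eval_C, sub_eq_zero] at h3
  exact h3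

/-- The maps are multiplication by `X - η` and reduction modulo `X - η`. -/
theorem exists_exact (η : k) (t : ℕ) : ∃ (f : Jordan η t →ₗ[k[X]] Jordan η (t + 1))
    (g : Jordan η (t + 1) →ₗ[k[X]] Jordan η 1), Function.Injective f ∧ Function.Surjective g ∧
      ∀ v, g v = 0 ↔ ∃ w, f w = v := by
  have hle : Submodule.span k[X] {(X - C η) ^ t} ≤
      (Submodule.span k[X] {(X - C η) ^ (t + 1)}).comap (LinearMap.mulLeft k[X] (X - C η)) := by
    rw [Submodule.span_singleton_le_iff_mem, Submodule.mem_comap, LinearMap.mulLeft_apply,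
      ← pow_succ']
    exact Submodule.mem_span_singleton_self _
  have hle' : Submodule.span k[X] {(X - C η) ^ (t + 1)} ≤ Submodule.span k[X] {(X - C η) ^ 1} := by
    rw [Submodule.span_singleton_le_iff_mem]
    exact Ideal.mem_span_singleton.mpr (pow_dvd_pow _ (by omega))
  refine ⟨Submodule.mapQ _ _ (LinearMap.mulLeft k[X] (X - C η)) hle, Submodule.factor hle',
    ?_, ?_, fun v => ?_⟩
  · rw [injective_iff_map_eq_zero]
    intro v hv
    obtain ⟨g, rfl⟩ := Submodule.mkQ_surjective _ v
    have h : Submodule.mkQ (Submodule.span k[X] {(X - C η) ^ (t + 1)}) ((X - C η) * g) = 0 := hv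
    rw [mk_eq_zero, pow_succ', mul_dvd_mul_iff_left (irred η).ne_zero] at h
    exact mk_eq_zero.mpr h
  · exact Submodule.factor_surjective hle'
  · obtain ⟨g, rfl⟩ := Submodule.mkQ_surjective _ v
    constructor
    · intro hv
      have h : Submodule.mkQ (Submodule.span k[X] {(X - C η) ^ 1}) g = 0 := hv
      rw [mk_eq_zero, pow_one] at h
      obtain ⟨q, rfl⟩ := h
      exact ⟨Submodule.mkQ _ q, rfl⟩
    · rintro ⟨w, hw⟩
      rw [← hw]
      obtain ⟨q, rfl⟩ := Submodule.mkQ_surjective _ w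
      exact mk_eq_zero.mpr (by rw [pow_one]; exact dvd_mul_right _ _)

/-- An indecomposable extension of `k[X] / (X - η)` by `k[X] / (X - η)^t` is cyclic. -/
theorem nonempty_equiv_of_exact {N : Type*} [AddCommGroup N] [Module k N] [Module k[X] N]
    [IsScalarTower k k[X] N] (hN : IsIndecomposableModule k[X] N)
    (f : Jordan η t →ₗ[k[X]] N) (g : N →ₗ[k[X]] Jordan η 1) (hf : Function.Injective f)
    (hg : Function.Surjective g) (hfg : ∀ v, g v = 0 ↔ ∃ w, f w = v) :
    Nonempty (N ≃ₗ[k[X]] Jordan η (t + 1)) := by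
  have hex : LinearMap.range (f.restrictScalars k) = LinearMap.ker (g.restrictScalars k) := by
    ext v
    exact (hfg v).symm
  have := finite η t
  have := finite η 1
  have hfin : Module.Finite k N := by
    have h1 : Module.Finite k (LinearMap.ker (g.restrictScalars k)) := by
      rw [← hex]; infer_instance
    have h2 : Module.Finite k (N ⧸ LinearMap.ker (g.restrictScalars k)) :=
      Module.Finite.equiv ((g.restrictScalars k).quotKerEquivOfSurjective hg).symm
    exact Module.Finite.of_submodule_quotient (LinearMap.ker (g.restrictScalars k))
  have hrank : Module.finrank k N = t + 1 := by
    rw [← LinearMap.finrank_range_add_finrank_ker (g.restrictScalars k), ← hex,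
      LinearMap.finrank_range_of_inj (f := f.restrictScalars k) hf, finrank_eq,
      LinearMap.range_eq_top.mpr (show Function.Surjective (g.restrictScalars k) from hg),
      finrank_top, finrank_eq, add_comm]
  -- One factor moves `v` into the image of `f`, and the remaining `t` factors kill that image.
  have hkill : ∀ v : N, (X - C η) ^ (t + 1) • v = 0 := by
    intro v
    have h1 : g ((X - C η) • v) = 0 := by
      rw [map_smul]
      simpa using pow_smul (t := 1) (g v)
    obtain ⟨w, hw⟩ := (hfg _).mp h1
    rw [pow_succ, mul_smul, ← hw, ← map_smul, pow_smul, map_zero]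
  have hfin' : Module.Finite k[X] N := Module.Finite.of_restrictScalars_finite k _ _
  have htor : Module.IsTorsion k[X] N := by
    intro v
    exact ⟨⟨(X - C η) ^ (t + 1), mem_nonZeroDivisors_of_ne_zero
      (pow_ne_zero _ (irred η).ne_zero)⟩, hkill v⟩
  obtain ⟨ι, _, p, hp, e, ⟨F⟩⟩ := Module.equiv_directSum_of_isTorsion htor
  -- By indecomposability only one summand of the structure theorem is left. The annihilator
  -- identifies its prime with `X - η`, and the dimension identifies its exponent.
  obtain ⟨i, ⟨F'⟩⟩ := hN.exists_equiv F
  have h1 : p i ^ e i ∣ (X - C η) ^ (t + 1) := by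
    have h2 : (X - C η) ^ (t + 1) • (Submodule.mkQ (Submodule.span k[X] {p i ^ e i}) 1) = 0 := by
      apply F'.symm.injective
      rw [map_smul, hkill, map_zero]
    rw [← map_smul, smul_eq_mul, mul_one, Submodule.mkQ_apply, Submodule.Quotient.mk_eq_zero] at h2
    exact Ideal.mem_span_singleton.mp h2
  have he : e i ≠ 0 := by
    intro h0
    have h3 : Subsingleton (k[X] ⧸ Submodule.span k[X] {p i ^ e i}) := by
      rw [h0, pow_zero, Submodule.Quotient.subsingleton_iff]
      exact Ideal.span_singleton_one
    have h4 := F'.toEquiv.subsingleton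
    exact (not_nontrivial_iff_subsingleton.mpr h4) hN.1
  have h2 : Associated (p i) (X - C η) :=
    (hp i).associated_of_dvd (irred η) ((hp i).prime.dvd_of_dvd_pow ((dvd_pow_self _ he).trans h1))
  have h3 : Submodule.span k[X] {p i ^ e i} = Submodule.span k[X] {(X - C η) ^ e i} :=
    Ideal.span_singleton_eq_span_singleton.mpr (h2.pow_pow)
  let F2 : N ≃ₗ[k[X]] Jordan η (e i) := F'.trans (Submodule.quotEquivOfEq _ _ h3)
  have h4 : e i = t + 1 := by
    rw [← hrank, (F2.restrictScalars k).finrank_eq, finrank_eq]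
  rw [← h4]
  exact ⟨F2⟩

end Jordan

end Jordan

namespace GroupDatum

open Finset Polynomial

/-! ### Recovering a presentation; extensions of band modules -/

section Reconstruction

variable {k : Type u} [Field k] [IsAlgClosed k] [CharZero k] {G : Type v} [CommGroup G] [Finite G]
  {D : GroupDatum k G} {l : ℕ} {lam : Weight k G}

variable {M : Type*} [AddCommGroup M] [Module D.Double M] [Module k M] [IsScalarTower k D.Double M]

/-- The space of vectors of weight `φ^i λ`. -/
def wtSpace (D : GroupDatum k G) (lam : Weight k G) (M : Type*) [AddCommGroup M]
    [Module D.Double M] [Module k M] [IsScalarTower k D.Double M] (i : ℕ) : Submodule k M where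
  carrier := {u | D.IsWt lam i u}
  add_mem' := IsWt.add
  zero_mem' := isWt_zero
  smul_mem' c _ h := h.smul c

namespace Good

/-- Across a boundary the isomorphism is `xt`; inside a block it is the inverse of `ξ`, rescaled to
produce the coefficients `xiCoeff`. -/
theorem exists_step (hg : Good D lam M) (hl : 1 ≤ l) (hl' : l < D.n) (hlam : lam ∈ D.I l) (i : ℕ) :
    ∃ T : wtSpace D lam M i ≃ₗ[k] wtSpace D lam M (i + 1),
      (D.n ∣ i + 1 → ∀ u, (T u : M) = D.xt • (u : M)) ∧
      (¬ D.n ∣ i + 1 → ∀ u, D.el Gen.xi • (T u : M) =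
        D.xiCoeff l lam ((i + 1) % D.n) • (u : M)) := by
  by_cases h : D.n ∣ i + 1
  · let f : wtSpace D lam M i →ₗ[k] wtSpace D lam M (i + 1) :=
      LinearMap.codRestrict _ ((Algebra.lsmul k k M D.xt).domRestrict _) (fun u => IsWt.xt u.2)
    have hf : Function.Bijective f := by
      constructor
      · rw [injective_iff_map_eq_zero]
        intro u hu
        exact Subtype.ext (hg.x_inj i u h u.2 (congrArg Subtype.val hu))
      · intro u
        obtain ⟨v, hv, hv'⟩ := hg.x_surj i u h u.2
        exact ⟨⟨v, hv⟩, Subtype.ext hv'⟩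
    exact ⟨LinearEquiv.ofBijective f hf, fun _ u => rfl, fun h' => absurd h h'⟩
  · let f : wtSpace D lam M (i + 1) →ₗ[k] wtSpace D lam M i :=
      LinearMap.codRestrict _ ((Algebra.lsmul k k M (D.el Gen.xi)).domRestrict _)
        (fun u => IsWt.xi u.2)
    have hf : Function.Bijective f := by
      constructor
      · rw [injective_iff_map_eq_zero]
        intro u hu
        exact Subtype.ext (hg.xi_inj i u h u.2 (congrArg Subtype.val hu))
      · intro u
        obtain ⟨v, hv, hv'⟩ := hg.xi_surj i u h u.2
        exact ⟨⟨v, hv⟩, Subtype.ext hv'⟩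
    have hc := xiCoeff_ne_zero hl hl' hlam (Band.mod_ne h).1 (Band.mod_ne h).2
    refine ⟨(LinearEquiv.smulOfNeZero k _ _ hc).trans (LinearEquiv.ofBijective f hf).symm,
      fun h' => absurd h' h, fun _ u => ?_⟩
    have h1 : f ((LinearEquiv.ofBijective f hf).symm (D.xiCoeff l lam ((i + 1) % D.n) • u)) =
        D.xiCoeff l lam ((i + 1) % D.n) • u :=
      (LinearEquiv.ofBijective f hf).apply_symm_apply _
    exact congrArg Subtype.val h1

/-- A module of band type is presented by its space of vectors of weight `λ` with the monodromy. -/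
theorem exists_band (hg : Good D lam M) (hl : 1 ≤ l) (hl' : l < D.n) (hlam : lam ∈ D.I l) :
    ∃ Φ : Module.End k (wtSpace D lam M 0), Nonempty (Band D l lam M (Module.AEval' Φ)) := by
  choose T hT hT' using hg.exists_step hl hl' hlam
  let θ : ∀ i, wtSpace D lam M 0 ≃ₗ[k] wtSpace D lam M i :=
    fun i => Nat.rec (LinearEquiv.refl k _) (fun i e => e.trans (T i)) i
  have hθ : ∀ i u, θ (i + 1) u = T i (θ i u) := fun i u => rfl
  -- Transport through `nm` links ends in the weight space where it began, since `φ^(nm) = 1`; this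
  -- is the monodromy.
  let Φ : Module.End k (wtSpace D lam M 0) :=
    LinearMap.codRestrict _ ((wtSpace D lam M (D.n * D.m)).subtype ∘ₗ (θ (D.n * D.m)).toLinearMap)
      (fun u => isWt_add_iff.mp (by rw [zero_add]; exact (θ (D.n * D.m) u).2))
  have hper : ∀ i u, (θ (i + D.n * D.m) u : M) = θ i (Φ u) := by
    intro i u
    induction i with
    | zero => rw [zero_add]; rfl
    | succ i ih =>
      rw [add_right_comm, hθ, hθ]
      have hd : D.n ∣ i + D.n * D.m + 1 ↔ D.n ∣ i + 1 := by
        rw [add_right_comm, ← Nat.dvd_add_iff_left (dvd_mul_right _ _)]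
      by_cases h : D.n ∣ i + 1
      · rw [hT _ (hd.mpr h), hT _ h, ih]
      -- Here the link is known only through `ξ`, so the two vectors are compared after applying
      -- `ξ`, which is injective at this place.
      · refine sub_eq_zero.mp (hg.xi_inj i _ h (IsWt.sub ?_ (T i _).2) ?_)
        · have h1 := (T (i + D.n * D.m) (θ (i + D.n * D.m) u)).2
          exact isWt_add_iff.mp (by rw [add_right_comm]; exact h1)
        · rw [smul_sub, hT' _ (fun h' => h (hd.mp h')), hT' _ h, ih, add_right_comm,
            Nat.add_mul_mod_self_left, sub_self]
  refine ⟨Φ, ⟨?_⟩⟩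
  exact {
    w := fun i => (wtSpace D lam M i).subtype ∘ₗ (θ i).toLinearMap ∘ₗ
      (Module.AEval'.of Φ).symm.toLinearMap
    wt := fun i v => (θ i ((Module.AEval'.of Φ).symm v)).2
    xi := fun i v => by
      change D.el Gen.xi • (θ (i + 1) ((Module.AEval'.of Φ).symm v) : M) =
        _ • (θ i ((Module.AEval'.of Φ).symm v) : M)
      rw [hθ]
      by_cases h : D.n ∣ i + 1
      · rw [Nat.mod_eq_zero_of_dvd h, xiCoeff_zero, zero_smul]
        exact hg.xi_zero (i + 1) _ h (T i _).2
      · exact hT' i h _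
    xt := fun i v h => (hT i h _).symm
    per := fun i v => by
      have := hper i ((Module.AEval'.of Φ).symm v)
      rwa [← Module.AEval'.of_symm_X_smul] at this
    inj := fun i v h => by
      have h1 : θ i ((Module.AEval'.of Φ).symm v) = 0 := Subtype.ext h
      simpa using h1
    surj := fun i u h => by
      refine ⟨Module.AEval'.of Φ ((θ i).symm ⟨u, h⟩), ?_⟩
      change ((θ i ((Module.AEval'.of Φ).symm (Module.AEval'.of Φ ((θ i).symm ⟨u, h⟩))) :
        wtSpace D lam M i) : M) = u
      rw [LinearEquiv.symm_apply_apply, LinearEquiv.apply_symm_apply]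
    span := hg.span }

end Good

section Extension

variable (P : Submodule D.Double M)

theorem exists_isWt_lift {i : ℕ} {q : M ⧸ P} (hq : D.IsWt lam i q) :
    ∃ u, D.IsWt lam i u ∧ P.mkQ u = q := by
  obtain ⟨u, rfl⟩ := P.mkQ_surjective q
  exact ⟨_, isWt_idem i u, by rw [map_smul]; exact hq⟩

theorem isWt_coe_iff {i : ℕ} {p : P} : D.IsWt lam i p ↔ D.IsWt lam i (p : M) := by
  unfold IsWt
  rw [Subtype.ext_iff]
  rfl

/-- This and `exists_of_extension` are the two halves of the five lemma on weight spaces; weight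
vectors of the quotient lift to weight vectors because an idempotent can be applied to any lift. -/
theorem eq_zero_of_extension {i : ℕ} (y : D.Double)
    (hP : ∀ p : P, D.IsWt lam i p → y • p = 0 → p = 0)
    (hQ : ∀ q : M ⧸ P, D.IsWt lam i q → y • q = 0 → q = 0) (u : M) (hu : D.IsWt lam i u)
    (h : y • u = 0) : u = 0 := by
  have h1 := hQ (P.mkQ u) (hu.map _) (by rw [← map_smul, h, map_zero])
  have h2 : u ∈ P := (Submodule.Quotient.mk_eq_zero P).mp h1
  exact congrArg Subtype.val (hP ⟨u, h2⟩ ((isWt_coe_iff P).mpr hu) (Subtype.ext h))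

theorem exists_of_extension {i j : ℕ} (y : D.Double)
    (hy : ∀ u : M, D.IsWt lam i u → D.IsWt lam j (y • u))
    (hP : ∀ p : P, D.IsWt lam j p → ∃ p', D.IsWt lam i p' ∧ y • p' = p)
    (hQ : ∀ q : M ⧸ P, D.IsWt lam j q → ∃ q', D.IsWt lam i q' ∧ y • q' = q) (u : M)
    (hu : D.IsWt lam j u) : ∃ v, D.IsWt lam i v ∧ y • v = u := by
  obtain ⟨q, hq, hq'⟩ := hQ (P.mkQ u) (hu.map _)
  obtain ⟨v, hv, rfl⟩ := exists_isWt_lift P hq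
  have h1 : u - y • v ∈ P := by
    rw [← Submodule.Quotient.mk_eq_zero P, ← Submodule.mkQ_apply, map_sub, map_smul, hq', sub_self]
  obtain ⟨p, hp, hp'⟩ := hP ⟨_, h1⟩ ((isWt_coe_iff P).mpr (hu.sub (hy v hv)))
  refine ⟨v + p, hv.add ((isWt_coe_iff P).mp hp), ?_⟩
  have h2 : y • (p : M) = u - y • v := congrArg Subtype.val hp'
  rw [smul_add, h2, add_sub_cancel]

theorem sum_idem_idem (u : M) {i : ℕ} (hi : i < D.n * D.m) :
    D.idem (D.phi ^ i * lam) • ∑ j ∈ range (D.n * D.m), D.idem (D.phi ^ j * lam) • u =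
      D.idem (D.phi ^ i * lam) • u := by
  rw [smul_sum, sum_eq_single i]
  · exact isWt_idem i u
  · intro j hj hji
    exact (isWt_idem j u).idem_smul (mem_range.mp hj) hi hji.symm
  · intro h; exact absurd (mem_range.mpr hi) h

theorem Band.finite {N : Type*} [AddCommGroup N] [Module k N] [Module k[X] N] [Module.Finite k N]
    (b : Band D l lam M N) : Module.Finite k M := by
  let f : (Fin (D.n * D.m) → N) →ₗ[k] M := ∑ i : Fin (D.n * D.m), b.w i ∘ₗ LinearMap.proj i
  refine Module.Finite.of_surjective f fun u => ⟨fun i => b.coord i u, ?_⟩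
  refine Eq.trans ?_ (b.sum_coord u)
  rw [sum_range]
  simp [f]

variable {P} {N₁ : Type*} [AddCommGroup N₁] [Module k N₁] [Module k[X] N₁] [Module.Finite k N₁]
  {N₂ : Type*} [AddCommGroup N₂] [Module k N₂] [Module k[X] N₂] [Module.Finite k N₂]

/-- For a maximal submodule `K`, the simple module `M / K` is a quotient of `M / P` or of `P`. In
the first case the image of `u` in `M / P` lies in the radical. In the second, write `u = p + κ`
with `p ∈ P`, `κ ∈ K`: the weight component of `p` lies in the radical of `P`, hence in `K`. -/
theorem mem_jacobson_of_extension (b₁ : Band D l lam P N₁) (b₂ : Band D l lam (M ⧸ P) N₂)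
    (hl : 1 ≤ l) (hl' : l < D.n) (hlam : lam ∈ D.I l) (hm : 0 < D.m) {i : ℕ}
    (hi : i % D.n < l) {u : M} (hu : D.IsWt lam i u) : u ∈ Module.jacobson D.Double M := by
  refine (Submodule.mem_sInf).mpr fun K hK => ?_
  have hK : IsCoatom K := hK
  have hs : IsSimpleModule D.Double (M ⧸ K) := isSimpleModule_iff_isCoatom.mpr hK
  by_cases hPK : P ≤ K
  · have h1 := IsSemisimpleModule.jacobson_le_ker D.Double D.Double (M ⧸ P) (M ⧸ K)
      (Submodule.factor hPK)
    rw [b₂.jacobson_eq hl hl' hlam hm] at h1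
    obtain ⟨v, hv⟩ := b₂.surj i (P.mkQ u) (hu.map _)
    have h2 := h1 (hv ▸ b₂.w_mem_low hl hl' hlam hm hi v)
    exact (Submodule.Quotient.mk_eq_zero K).mp h2
  · have h1 := IsSemisimpleModule.jacobson_le_ker D.Double D.Double P (M ⧸ K) (K.mkQ ∘ₗ P.subtype)
    rw [b₁.jacobson_eq hl hl' hlam hm] at h1
    have hsup : P ⊔ K = ⊤ := hK.2 _ (right_lt_sup.mpr hPK)
    obtain ⟨p, hp, κ, hκ, hsum⟩ := Submodule.mem_sup.mp (hsup ▸ Submodule.mem_top : u ∈ _)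
    obtain ⟨v, hv⟩ := b₁.exists_w_idem i ⟨p, hp⟩
    have h2 : D.idem (D.phi ^ i * lam) • p ∈ K :=
      (Submodule.Quotient.mk_eq_zero K).mp (h1 (hv ▸ b₁.w_mem_low hl hl' hlam hm hi v))
    rw [← hu, ← hsum, smul_add]
    exact K.add_mem h2 (K.smul_mem _ hκ)

/-- An extension of modules of band type is of band type if its radical is semisimple. -/
theorem good_of_extension (b₁ : Band D l lam P N₁) (b₂ : Band D l lam (M ⧸ P) N₂)
    (hl : 1 ≤ l) (hl' : l < D.n) (hlam : lam ∈ D.I l) (hm : 0 < D.m)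
    (hjac : Module.jacobson D.Double (Module.jacobson D.Double M) = ⊥) : Good D lam M := by
  have h₁ := b₁.good hl hl' hlam hm
  have h₂ := b₂.good hl hl' hlam hm
  -- For an Artinian module, zero radical implies semisimple; this turns `rad² M = 0` into
  -- semisimplicity of `rad M`.
  have hart : IsArtinian D.Double M := by
    have f₁ := b₁.finite
    have f₂ := b₂.finite
    have a₁ : IsArtinian D.Double P :=
      isArtinian_of_tower k (isArtinian_of_fg_of_artinian' (R := k) (M := P))
    have a₂ : IsArtinian D.Double (M ⧸ P) :=
      isArtinian_of_tower k (isArtinian_of_fg_of_artinian' (R := k) (M := M ⧸ P))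
    exact isArtinian_of_range_eq_ker (R := D.Double) (M := P) (N := M) (P := M ⧸ P) P.subtype P.mkQ
      (by simp)
  have hss : IsSemisimpleModule D.Double (Module.jacobson D.Double M) :=
    (IsArtinian.isSemisimpleModule_iff_jacobson _ _).mpr hjac
  have hxinj : ∀ (i : ℕ) (u : M), D.n ∣ i + 1 → D.IsWt lam i u → D.xt • u = 0 → u = 0 :=
    fun i u hi => eq_zero_of_extension P _ (fun p => h₁.x_inj i p hi) (fun q => h₂.x_inj i q hi) u
  -- The one condition not inherited from `P` and `M / P`: `ξ` could map a lift from `M / P` across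
  -- a boundary into `P`. Semisimplicity of the radical excludes this.
  have hxi : ∀ (i : ℕ) (u : M), D.n ∣ i + 1 → D.IsWt lam (i + 1) u → D.el Gen.xi • u = 0 := by
    intro i u hi hu
    set R := Module.jacobson D.Double M
    have hR : u ∈ R := mem_jacobson_of_extension b₁ b₂ hl hl' hlam hm
      (by rw [Nat.mod_eq_zero_of_dvd hi]; omega) hu
    have hP : D.el Gen.xi • u ∈ P := by
      rw [← Submodule.Quotient.mk_eq_zero P, ← Submodule.mkQ_apply, map_smul]
      exact h₂.xi_zero _ _ hi (hu.map _)
    -- `U` is the part of the radical that comes from `low` in `P`; semisimplicity gives it a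
    -- complement `C` in `R`.
    let U : Submodule D.Double R :=
      Submodule.comap R.subtype (Submodule.map P.subtype (b₁.low hl hl' hlam hm))
    have : ComplementedLattice (Submodule D.Double R) := hss.toComplementedLattice
    obtain ⟨C, hC⟩ := exists_isCompl U
    obtain ⟨s, ⟨p, hp, hps⟩, c, hc, hsc⟩ := Submodule.mem_sup.mp
      (hC.sup_eq_top ▸ Submodule.mem_top : (⟨_, R.smul_mem (D.el Gen.xi) hR⟩ : R) ∈ _)
    have h1 : D.idem (D.phi ^ i * lam) • s = 0 := by
      refine Subtype.ext ?_
      have h3 := hp i (by rw [mod_of_dvd_succ hi]; omega)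
      have h4 : D.idem (D.phi ^ i * lam) • P.subtype p = 0 := by rw [← map_smul, h3, map_zero]
      rw [hps] at h4
      exact h4
    -- The vector `ξ u` sits at position `n - 1 ≥ l`, where `U` has no weight component, so it lies
    -- in `C`.
    have h2 : (⟨_, R.smul_mem (D.el Gen.xi) hR⟩ : R) ∈ C := by
      have h3 : (⟨_, R.smul_mem (D.el Gen.xi) hR⟩ : R) = D.idem (D.phi ^ i * lam) • c := by
        rw [← zero_add (_ • c), ← h1, ← smul_add, hsc]
        exact Subtype.ext hu.xi.symm
      rw [h3]
      exact C.smul_mem _ hc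
    refine hxinj i _ hi hu.xi ?_
    obtain ⟨v, hv⟩ := b₁.surj i ⟨_, hP⟩ ((isWt_coe_iff P).mpr hu.xi)
    -- Since `ξ u` is in `P`, `xt` takes it to position `0` of the next block of `P`, hence into
    -- `U`. It also stays in `C`, so `xt ξ u = 0`, and injectivity of `xt` finishes.
    have h5 : D.xt • (⟨_, R.smul_mem (D.el Gen.xi) hR⟩ : R) ∈ U := by
      refine ⟨b₁.w (i + 1) v, b₁.w_mem_low hl hl' hlam hm
        (by rw [Nat.mod_eq_zero_of_dvd hi]; omega) v, ?_⟩
      rw [← b₁.xt _ _ hi, hv]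
      rfl
    have h6 := hC.disjoint.le_bot ⟨h5, C.smul_mem D.xt h2⟩
    exact congrArg Subtype.val ((Submodule.mem_bot _).mp h6)
  refine ⟨fun i u hi hu => ?_, fun i u hi => ?_, fun i u hi => ?_, hxinj, fun i u hi => ?_,
    fun u => ?_⟩
  · have h3 := isWt_add_iff.mpr hu
    rw [Band.add_nm_sub hm] at h3
    exact hxi _ u (by rw [← Band.add_nm_sub hm]; exact hi.add (dvd_mul_right _ _)) h3
  · exact eq_zero_of_extension P _ (fun p => h₁.xi_inj i p hi) (fun q => h₂.xi_inj i q hi) u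
  · exact exists_of_extension P _ (fun u hu => hu.xi) (fun p => h₁.xi_surj i p hi)
      (fun q => h₂.xi_surj i q hi) u
  · exact exists_of_extension P _ (fun u hu => hu.xt) (fun p => h₁.x_surj i p hi)
      (fun q => h₂.x_surj i q hi) u
  -- The difference lies in `P`, so it is the sum of its weight components, and all of these vanish.
  · have h3 : u - ∑ i ∈ range (D.n * D.m), D.idem (D.phi ^ i * lam) • u ∈ P := by
      rw [← Submodule.Quotient.mk_eq_zero P, ← Submodule.mkQ_apply, map_sub, map_sum]
      simp_rw [map_smul]
      rw [h₂.span, sub_self]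
    have h4 := congrArg Subtype.val (h₁.span ⟨_, h3⟩)
    rw [AddSubmonoidClass.coe_finsetSum] at h4
    rw [sum_eq_zero] at h4
    · exact (sub_eq_zero.mp h4.symm).symm
    · intro i hi
      change D.idem (D.phi ^ i * lam) •
        (u - ∑ i ∈ range (D.n * D.m), D.idem (D.phi ^ i * lam) • u) = 0
      rw [smul_sub, sum_idem_idem u (mem_range.mp hi), sub_self]

/-- An indecomposable extension of two band modules with the parameter `η` is again a band module
with this parameter if its radical is semisimple. -/
theorem band_of_extension {η : k} {t : ℕ} (b₁ : Band D l lam P (Jordan η t))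
    (b₂ : Band D l lam (M ⧸ P) (Jordan η 1))
    (hl : 1 ≤ l) (hl' : l < D.n) (hlam : lam ∈ D.I l) (hm : 0 < D.m)
    (hind : IsIndecomposableModule D.Double M)
    (hjac : Module.jacobson D.Double (Module.jacobson D.Double M) = ⊥) :
    Nonempty (Band D l lam M (Jordan η (t + 1))) := by
  have := Jordan.finite η t
  have := Jordan.finite η 1
  obtain ⟨Φ, ⟨b⟩⟩ := (good_of_extension b₁ b₂ hl hl' hlam hm hjac).exists_band hl hl' hlam
  obtain ⟨f, hf⟩ := b₁.exists_of_map b hl hl' hlam P.subtype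
  obtain ⟨g, hg⟩ := b.exists_of_map b₂ hl hl' hlam P.mkQ
  have hinj : Function.Injective f := by
    rw [injective_iff_map_eq_zero]
    intro v hv
    refine b₁.inj 0 v (Subtype.ext ?_)
    have := hf 0 v
    rw [hv, map_zero] at this
    exact this
  have hsurj : Function.Surjective g := by
    intro v
    obtain ⟨u, hu, hu'⟩ := exists_isWt_lift P (b₂.wt 0 v)
    obtain ⟨v', rfl⟩ := b.surj 0 u hu
    exact ⟨v', b₂.injective 0 (by rw [← hg, hu'])⟩
  have hex : ∀ v, g v = 0 ↔ ∃ w, f w = v := by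
    intro v
    constructor
    · intro hv
      have h1 := hg 0 v
      rw [hv, map_zero] at h1
      obtain ⟨v', hv'⟩ := b₁.surj 0 ⟨_, (Submodule.Quotient.mk_eq_zero P).mp h1⟩
        ((isWt_coe_iff P).mpr (b.wt 0 v))
      exact ⟨v', b.injective 0 (by rw [← hf, hv']; rfl)⟩
    · rintro ⟨w, rfl⟩
      refine b₂.inj 0 _ ?_
      rw [← hg, ← hf]
      exact (Submodule.Quotient.mk_eq_zero P).mpr (b₁.w 0 w).2
  obtain ⟨e⟩ := Jordan.nonempty_equiv_of_exact
    ((b.isIndecomposableModule_iff' hl hl' hlam hm).mp hind) f g hinj hsurj hex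
  exact b.nonempty_of_equiv e

end Extension

end Reconstruction

end GroupDatum

namespace GroupDatum

open Finset Polynomial

/-! ### The family `M₁(l, λ, η)` over `k[X]` -/

section Model

variable {k : Type u} [Field k] [IsAlgClosed k] [CharZero k] {G : Type v} [CommGroup G] [Finite G]

/-- The part of the action of a generator on `M₁(l, λ, η)` that is linear in `η`. -/
noncomputable def slope (D : GroupDatum k G) (l : ℕ) (lam : Weight k G) (y : Gen k G) :
    Module.End k D.Space :=
  -- The action is affine in `η`, so its slope is the difference of the values at `2` and `1`, both
  -- nonzero in characteristic `0`.
  D.genAction l lam (Units.mk0 2 two_ne_zero) y - D.genAction l lam 1 y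

/-- The part of the action of a generator on `M₁(l, λ, η)` that does not depend on `η`. -/
noncomputable def base (D : GroupDatum k G) (l : ℕ) (lam : Weight k G) (y : Gen k G) :
    Module.End k D.Space :=
  D.genAction l lam 1 y - D.slope l lam y

variable {D : GroupDatum k G} {l : ℕ} {lam : Weight k G}

open Classical in
theorem slope_x {i j : ℕ} (hi : i < D.m) (hj : j < D.n) :
    D.slope l lam Gen.x (D.e i j) =
      if i + 1 < D.m then 0
      else if D.Nilpotent then (if j + 1 = D.n - l then D.e 0 (D.n - l) else 0)
      else if l ≤ j ∧ j + 1 = D.n then D.e 0 0 else 0 := by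
  unfold slope
  rw [LinearMap.sub_apply, genAction_x_e _ hi hj, genAction_x_e _ hi hj]
  have h2 : ∀ v : D.Space, (2 : k) • v - v = v := fun v => by rw [two_smul, add_sub_cancel_right]
  unfold xImage next
  split_ifs <;> first | omega | simp [h2]

theorem slope_of_ne {y : Gen k G} (hy : y ≠ Gen.x) : D.slope l lam y = 0 := by
  unfold slope
  cases y <;> first | exact absurd rfl hy | exact LinearMap.ext fun u => sub_self _

theorem genAction_eq (η : kˣ) (y : Gen k G) :
    D.genAction l lam η y = D.base l lam y + (η : k) • D.slope l lam y := by
  by_cases hy : y = Gen.x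
  · subst hy
    refine end_ext fun i j hi hj => ?_
    unfold base
    rw [LinearMap.add_apply, LinearMap.sub_apply, LinearMap.smul_apply, slope_x hi hj,
      genAction_x_e _ hi hj, genAction_x_e _ hi hj]
    unfold xImage next
    split_ifs <;> first | omega | simp
  · unfold base
    rw [slope_of_ne hy]
    refine LinearMap.ext fun u => ?_
    rw [smul_zero, add_zero, LinearMap.sub_apply, LinearMap.zero_apply, sub_zero]
    cases y <;> first | exact absurd rfl hy | rfl

variable (D l lam)

/-- The matrix of a generator over `k[X]`, with the parameter `η` replaced by `X`. -/
noncomputable def genMatrix (y : Gen k G) : Matrix (Fin D.m × Fin D.n) (Fin D.m × Fin D.n) k[X] :=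
  (LinearMap.toMatrixAlgEquiv Finsupp.basisSingleOne (D.base l lam y)).map C +
    (X : k[X]) • (LinearMap.toMatrixAlgEquiv Finsupp.basisSingleOne (D.slope l lam y)).map C

variable {D l lam}

theorem eval_lift_genMatrix (η : kˣ) (f : FreeAlgebra k (Gen k G)) :
    (FreeAlgebra.lift k (D.genMatrix l lam) f).map (aeval (η : k)) =
      LinearMap.toMatrixAlgEquiv Finsupp.basisSingleOne
        (FreeAlgebra.lift k (D.genAction l lam η) f) := by
  have h : ((aeval (η : k)).mapMatrix (m := Fin D.m × Fin D.n)).comp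
      (FreeAlgebra.lift k (D.genMatrix l lam)) =
      (LinearMap.toMatrixAlgEquiv Finsupp.basisSingleOne).toAlgHom.comp
        (FreeAlgebra.lift k (D.genAction l lam η)) := by
    refine FreeAlgebra.hom_ext (funext fun y => ?_)
    ext p q
    simp [genMatrix, genAction_eq, LinearMap.toMatrixAlgEquiv_apply]
    exact mul_comm _ _
  exact DFunLike.congr_fun h f

/-- The entries are polynomials that agree at every nonzero `η`, by the relations in `M₁(l, λ, η)`;
as `k` is infinite, they are equal. -/
theorem lift_genMatrix_rel (hl : 1 ≤ l) (hl' : l < D.n) (hlam : lam ∈ D.I l)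
    ⦃y z : FreeAlgebra k (Gen k G)⦄ (h : D.Rel y z) :
    FreeAlgebra.lift k (D.genMatrix l lam) y = FreeAlgebra.lift k (D.genMatrix l lam) z := by
  ext1 p q
  refine eq_of_infinite_eval_eq _ _ (Set.Infinite.mono (s := {0}ᶜ) (fun η hη => ?_)
    (Set.finite_singleton 0).infinite_compl)
  have h1 := eval_lift_genMatrix (D := D) (l := l) (lam := lam) (Units.mk0 η hη) y
  rw [lift_rel _ hl hl' hlam h, ← eval_lift_genMatrix] at h1
  have := congrFun (congrFun h1 p) q
  simp only [Matrix.map_apply, coe_aeval_eq_eval] at this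
  exact this

/-- The action of the double on `M₁(l, λ, η)` with `η` replaced by `X`. -/
noncomputable def toMatrix (D : GroupDatum k G) (l : ℕ) (lam : Weight k G) (hl : 1 ≤ l)
    (hl' : l < D.n) (hlam : lam ∈ D.I l) :
    D.Double →ₐ[k] Matrix (Fin D.m × Fin D.n) (Fin D.m × Fin D.n) k[X] :=
  RingQuot.liftAlgHom k
    ⟨FreeAlgebra.lift k (D.genMatrix l lam), lift_genMatrix_rel hl hl' hlam⟩

/-- The module of band type with monodromy `X` on the `k[X]`-module `N`. -/
def Model (D : GroupDatum k G) (l : ℕ) (lam : Weight k G) (_ : 1 ≤ l)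
    (_ : l < D.n) (_ : lam ∈ D.I l) (N : Type*) := Fin D.m × Fin D.n → N

section Instances

variable {hl : 1 ≤ l} {hl' : l < D.n} {hlam : lam ∈ D.I l} {N : Type*} [AddCommGroup N]

instance : AddCommGroup (D.Model l lam hl hl' hlam N) :=
  inferInstanceAs (AddCommGroup (Fin D.m × Fin D.n → N))

instance [Module k N] : Module k (D.Model l lam hl hl' hlam N) :=
  inferInstanceAs (Module k (Fin D.m × Fin D.n → N))

open scoped Matrix.Module in
noncomputable instance [Module k[X] N] : Module D.Double (D.Model l lam hl hl' hlam N) :=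
  Module.compHom (Fin D.m × Fin D.n → N) (D.toMatrix l lam hl hl' hlam).toRingHom

variable [Module k N] [Module k[X] N] [IsScalarTower k k[X] N]

theorem model_smul_apply (d : D.Double) (u : D.Model l lam hl hl' hlam N)
    (p : Fin D.m × Fin D.n) : (d • u) p = ∑ q, D.toMatrix l lam hl hl' hlam d p q • u q := rfl

instance : IsScalarTower k D.Double (D.Model l lam hl hl' hlam N) where
  smul_assoc c d u := by
    funext p
    rw [model_smul_apply]
    change _ = c • (d • u) p
    rw [model_smul_apply, map_smul, smul_sum]
    simp only [Matrix.smul_apply, smul_assoc]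

/-- The tensor product of a vector of the underlying space of `M₁(l, λ, η)` and a vector of `N`. -/
noncomputable def tens (D : GroupDatum k G) (l : ℕ) (lam : Weight k G) (hl : 1 ≤ l)
    (hl' : l < D.n) (hlam : lam ∈ D.I l) (N : Type*) [AddCommGroup N] [Module k N] :
    D.Space →ₗ[k] N →ₗ[k] D.Model l lam hl hl' hlam N :=
  LinearMap.mk₂ k (fun u v p => u p • v)
    (fun _ _ _ => funext fun _ => add_smul _ _ _) (fun _ _ _ => funext fun _ => mul_smul _ _ _)
    (fun _ _ _ => funext fun _ => smul_add _ _ _) (fun _ _ _ => funext fun _ => smul_comm _ _ _)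

theorem el_smul_tens (y : Gen k G) (u : D.Space) (v : N) :
    D.el y • D.tens l lam hl hl' hlam N u v =
      D.tens l lam hl hl' hlam N (D.base l lam y u) v +
        D.tens l lam hl hl' hlam N (D.slope l lam y u) ((X : k[X]) • v) := by
  have hm : D.toMatrix l lam hl hl' hlam (D.el y) = D.genMatrix l lam y := by
    simp [toMatrix, el, gen]
  have hT : ∀ (T : Module.End k D.Space) p, (T u) p =
      ∑ q, LinearMap.toMatrixAlgEquiv Finsupp.basisSingleOne T p q * u q := by
    intro T p
    have h := LinearMap.toMatrix_mulVec_repr Finsupp.basisSingleOne Finsupp.basisSingleOne T u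
    have h1 := congrFun h p
    simp only [Matrix.mulVec, dotProduct, Finsupp.basisSingleOne_repr, LinearEquiv.refl_apply] at h1
    exact h1.symm
  funext p
  rw [model_smul_apply, hm]
  change ∑ q, D.genMatrix l lam y p q • (u q • v) =
    (D.base l lam y u) p • v + (D.slope l lam y u) p • ((X : k[X]) • v)
  rw [hT, hT, sum_smul, sum_smul, ← sum_add_distrib]
  refine sum_congr rfl fun q _ => ?_
  rw [genMatrix, Matrix.add_apply, Matrix.smul_apply, Matrix.map_apply, Matrix.map_apply, add_smul,
    smul_eq_mul, mul_smul, ← algebraMap_eq, algebraMap_smul, algebraMap_smul, smul_smul,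
    smul_smul, smul_comm (X : k[X])]

end Instances

end Model

end GroupDatum

namespace GroupDatum

open Finset Polynomial

/-! ### The model is of band type -/

section ModelBand

variable {k : Type u} [Field k] [IsAlgClosed k] [CharZero k] {G : Type v} [CommGroup G] [Finite G]
  {D : GroupDatum k G} {l : ℕ} {lam : Weight k G}

/-- Both sequences start at `0`, as `α_l(λ) = 0`, and have equal differences, as `σ(λ) = φ^l λ`.
This merges the two families of coefficients into one along the block. -/
theorem alphaCoeff_sigma (hl : 1 ≤ l) (hl' : l < D.n) (hlam : lam ∈ D.I l) (s : ℕ) :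
    D.alphaCoeff s (D.sigma lam) = D.alphaCoeff (s + l) lam := by
  induction s with
  | zero => rw [alpha_zero, zero_add, alpha_l hl hlam]
  | succ s ih =>
    have h1 := alpha_sub (D := D) (D.sigma lam) s
    have h2 := alpha_sub (D := D) lam (s + l)
    rw [sigma_eq hl hl' hlam, ← mul_assoc, ← pow_add, ← sigma_eq hl hl' hlam, ← h2, ih] at h1
    rw [sub_right_inj.mp h1, add_right_comm]

open Classical in
/-- The position of the vectors of weight `φ^j τ^i(λ)` in the basis of `M₁(l, λ, η)`. -/
noncomputable def pos (D : GroupDatum k G) (l j : ℕ) : ℕ :=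
  -- In the nilpotent case the first `n - l` basis vectors carry the weights of the head, the
  -- positions `j ≥ l`; the two segments are exchanged.
  if D.Nilpotent then (if j < l then j + (D.n - l) else j - l) else j

theorem pos_lt (hl' : l < D.n) {j : ℕ} (hj : j < D.n) : D.pos l j < D.n := by
  unfold pos
  split_ifs <;> omega

theorem exists_pos (hl' : l < D.n) {j : ℕ} (hj : j < D.n) : ∃ j' < D.n, D.pos l j' = j := by
  unfold pos
  split_ifs with h
  · by_cases h1 : j < D.n - l
    · exact ⟨j + l, by omega, by rw [if_neg (by omega)]; omega⟩
    · exact ⟨j - (D.n - l), by omega, by rw [if_pos (by omega)]; omega⟩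
  · exact ⟨j, hj, rfl⟩

theorem pos_of_lt (hD : D.Nilpotent) {j : ℕ} (h : j < l) : D.pos l j = j + (D.n - l) := by
  unfold pos; rw [if_pos hD, if_pos h]

theorem pos_of_le (hD : D.Nilpotent) {j : ℕ} (h : l ≤ j) : D.pos l j = j - l := by
  unfold pos; rw [if_pos hD, if_neg (by omega)]

theorem wt_pos (hl : 1 ≤ l) (hl' : l < D.n) (hlam : lam ∈ D.I l) (q : ℕ) {j : ℕ} (hj : j < D.n) :
    D.wt l lam (q % D.m) (D.pos l j) = D.phi ^ (D.n * q + j) * lam := by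
  have h : D.wt l lam (q % D.m) (D.pos l j) = D.phi ^ j * (D.tau ^ (q % D.m)) lam := by
    unfold wt pos
    split_ifs <;> first | omega | rfl | (congr 2; omega)
  have h2 : D.phi ^ (D.n * q) = D.phi ^ (D.n * (q % D.m)) := by
    conv_lhs => rw [← Nat.mod_add_div q D.m, mul_add, ← mul_assoc, pow_add, pow_mul _ (_ * _),
      phi_pow_eq_one, one_pow, mul_one]
  rw [h, (tau_pow_eq hl hl' hlam _).1, add_comm, pow_add, h2, mul_assoc]

variable {hl : 1 ≤ l} {hl' : l < D.n} {hlam : lam ∈ D.I l} {N : Type*} [AddCommGroup N]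
  [Module k N] [Module k[X] N] [IsScalarTower k k[X] N]

local notation "T" => D.tens l lam hl hl' hlam N

theorem el_smul_tens_of_ne {y : Gen k G} (hy : y ≠ Gen.x) (u : D.Space) (v : N) :
    D.el y • T u v = T (D.genAction l lam 1 y u) v := by
  rw [el_smul_tens, genAction_eq, slope_of_ne hy, smul_zero, add_zero, LinearMap.zero_apply,
    map_zero, LinearMap.zero_apply, add_zero]

theorem grp_smul_tens (p : G × Chr k G) (i j : ℕ) (v : N) :
    D.grp p • T (D.e i j) v = (D.wt l lam i j p : k) • T (D.e i j) v := by
  unfold grp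
  rw [mul_smul, el_smul_tens_of_ne (by simp), el_smul_tens_of_ne (by simp), genAction_g, genAction_c,
    ← Module.End.mul_apply, ← diag_mul, diag_e, map_smul, LinearMap.smul_apply]
  simp

/-- Each of the averaged terms fixes `u`, and the order of `G × Γ` is invertible in `k`. -/
theorem idem_smul_eq {M : Type*} [AddCommGroup M] [Module D.Double M] [Module k M]
    [IsScalarTower k D.Double M] {mu : Weight k G} {u : M}
    (h : ∀ p, D.grp p • u = (mu p : k) • u) : D.idem mu • u = u := by
  unfold idem
  rw [smul_assoc, sum_smul]
  have h1 : ∀ p, ((((mu p)⁻¹ : kˣ) : k) • D.grp p) • u = u := by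
    intro p
    rw [smul_assoc, h, smul_smul]
    simp
  simp_rw [h1]
  rw [sum_const, card_univ, ← Nat.cast_smul_eq_nsmul k, smul_smul, inv_mul_cancel₀, one_smul]
  exact Nat.cast_ne_zero.mpr Fintype.card_ne_zero

theorem xi_smul_tens_zero {i : ℕ} (hi : i < D.m) (v : N) :
    D.el Gen.xi • T (D.e i (D.pos l 0)) v = 0 := by
  rw [el_smul_tens_of_ne (by simp), genAction_xi_e _ hi (pos_lt hl' n_pos)]
  have : D.xiImage l lam i (D.pos l 0) = 0 := by
    unfold xiImage pos
    split_ifs <;> first | omega | rfl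
  rw [this, map_zero, LinearMap.zero_apply]

theorem xi_smul_tens_succ {i j : ℕ} (hi : i < D.m) (hj : j + 1 < D.n) (v : N) :
    D.el Gen.xi • T (D.e i (D.pos l (j + 1))) v =
      D.xiCoeff l lam (j + 1) • T (D.e i (D.pos l j)) v := by
  rw [el_smul_tens_of_ne (by simp), genAction_xi_e _ hi (pos_lt hl' hj)]
  have : D.xiImage l lam i (D.pos l (j + 1)) = D.xiCoeff l lam (j + 1) • D.e i (D.pos l j) := by
    unfold xiImage xiCoeff
    by_cases hD : D.Nilpotent
    · rw [if_pos hD, if_neg (Nat.succ_ne_zero j)]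
      rcases lt_trichotomy (j + 1) l with h | h | h
      · rw [pos_of_lt hD h, pos_of_lt hD (by omega), if_neg (by omega), if_neg (by omega),
          if_neg (by omega), if_pos ⟨hD, by omega⟩, Nat.add_sub_cancel, Nat.add_right_comm,
          Nat.add_sub_cancel]
      -- At the cut `j + 1 = l` the basis indices are `0` and `n - 1`: this is the rule `ξ x_0^k =
      -- x_(n-1)^k`.
      · rw [pos_of_le hD (by omega), pos_of_lt hD (by omega), if_pos (by omega),
          if_neg (by omega), one_smul]
        congr 1
        omega
      · rw [pos_of_le hD (by omega), pos_of_le hD (by omega), if_neg (by omega), if_pos (by omega),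
          if_pos ⟨hD, by omega⟩, alphaCoeff_sigma hl hl' hlam, Nat.sub_add_cancel (by omega)]
        congr 2
        omega
    · simp [hD, pos]
  rw [this, map_smul, LinearMap.smul_apply]

theorem x_smul_tens_nil (hD : D.Nilpotent) {i : ℕ} (hi : i < D.m) (v : N) :
    D.el Gen.x • T (D.e i (D.pos l (D.n - 1))) v =
      if i + 1 < D.m then T (D.e (i + 1) (D.pos l 0)) v
      else T (D.e 0 (D.pos l 0)) ((X : k[X]) • v) := by
  have hp : D.pos l (D.n - 1) + 1 = D.n - l := by rw [pos_of_le hD (by omega)]; omega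
  have h0 : D.pos l 0 = D.n - l := by rw [pos_of_lt hD (by omega), zero_add]
  rw [el_smul_tens, base, LinearMap.sub_apply, slope_x hi (by omega), genAction_x_e _ hi (by omega)]
  unfold xImage next
  rw [h0, if_pos hD, if_pos hD, if_neg (by omega), if_pos hp, if_pos hp]
  split_ifs <;> simp

theorem x_smul_tens_non (hD : ¬ D.Nilpotent) {i : ℕ} (hi : i < D.m) (v : N) :
    D.el Gen.x • T (D.e i (D.n - 1)) v = D.zCoeff lam • T (D.e i 0) v +
      if i + 1 < D.m then T (D.e (i + 1) 0) v else T (D.e 0 0) ((X : k[X]) • v) := by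
  rw [el_smul_tens, base, LinearMap.sub_apply, slope_x hi (by omega), genAction_x_e _ hi (by omega)]
  unfold xImage next
  have h1 : D.n - 1 + 1 = D.n := by omega
  have h2 : l ≤ D.n - 1 ∧ D.n = D.n := ⟨by omega, rfl⟩
  rw [h1, if_neg hD, if_neg hD, if_neg (by omega), if_neg (by omega), if_neg (by omega), if_pos h2]
  split_ifs <;> simp

/-- `ξ^(n-1)` returns from the last position to the first, and the group factor contributes exactly
`z_λ`. So the term `z_λ x_0^k` in the action of `x` is the part due to `corr`, and `xt` keeps only
the link to the next block. -/
theorem corr_smul_tens (hD : ¬ D.Nilpotent) {i : ℕ} (hi : i < D.m) (v : N) :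
    D.corr • T (D.e i (D.n - 1)) v = D.zCoeff lam • T (D.e i 0) v := by
  have h1 : ∀ r (u : D.Space), D.el Gen.xi ^ r • T u v = T ((D.genAction l lam 1 Gen.xi ^ r) u) v := by
    intro r
    induction r with
    | zero => intro u; simp
    | succ r ih =>
      intro u
      rw [pow_succ, pow_succ, mul_smul, el_smul_tens_of_ne (by simp), ih, Module.End.mul_apply]
  have h2 : ∀ p, (D.phi ^ D.n) p = 1 → D.wt l lam i 0 p = lam p := by
    intro p hp
    rw [wt_non hD, diag_comm p hp hl hl' hlam, pow_zero, one_mul]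
  unfold corr
  rw [smul_assoc, mul_smul, h1, xi_pow_e _ hD _ hi (by omega), if_pos le_rfl, Nat.sub_self, sub_smul,
    smul_assoc, grp_smul_tens, grp_smul_tens, h2 _ phi_n_a, h2 _ phi_n_chi, smul_smul, ← sub_smul,
    smul_smul]
  unfold zCoeff
  rw [div_eq_inv_mul]

theorem xt_smul_tens {i : ℕ} (hi : i < D.m) (v : N) :
    D.xt • T (D.e i (D.pos l (D.n - 1))) v =
      if i + 1 < D.m then T (D.e (i + 1) (D.pos l 0)) v
      else T (D.e 0 (D.pos l 0)) ((X : k[X]) • v) := by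
  unfold xt
  split_ifs with hD h h
  · rw [x_smul_tens_nil hD hi, if_pos h]
  · rw [x_smul_tens_nil hD hi, if_neg h]
  all_goals
    have hp : ∀ j, D.pos l j = j := fun j => if_neg hD
    rw [hp, hp, sub_smul, x_smul_tens_non hD hi, corr_smul_tens hD hi, add_sub_cancel_left]
  · rw [if_pos h]
  · rw [if_neg h]

variable (D l lam hl hl' hlam N)

/-- The vectors of weight `φ^(n q + j) λ` in the model. -/
noncomputable def modelVec (q j : ℕ) : N →ₗ[k] D.Model l lam hl hl' hlam N :=
  D.tens l lam hl hl' hlam N (D.e (q % D.m) (D.pos l j)) ∘ₗ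
    Algebra.lsmul k k N ((X : k[X]) ^ (q / D.m))

variable {D l lam hl hl' hlam N}

theorem modelVec_apply (q j : ℕ) (v : N) : D.modelVec l lam hl hl' hlam N q j v =
    T (D.e (q % D.m) (D.pos l j)) ((X : k[X]) ^ (q / D.m) • v) := rfl

theorem modelVec_wt (q : ℕ) {j : ℕ} (hj : j < D.n) (v : N) :
    D.IsWt lam (D.n * q + j) (D.modelVec l lam hl hl' hlam N q j v) := by
  refine idem_smul_eq fun p => ?_
  rw [modelVec_apply, grp_smul_tens, wt_pos hl hl' hlam q hj]

theorem tens_e_eq_zero {i j : ℕ} (hi : i < D.m) (hj : j < D.n) {v : N} (h : T (D.e i j) v = 0) :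
    v = 0 := by
  have h1 : (D.e i j) (⟨i, hi⟩, ⟨j, hj⟩) • v = 0 := congrFun h (⟨i, hi⟩, ⟨j, hj⟩)
  rw [e, dif_pos ⟨hi, hj⟩, Finsupp.single_eq_same, one_smul] at h1
  exact h1

theorem eq_sum_tens (u : D.Model l lam hl hl' hlam N) :
    u = ∑ p : Fin D.m × Fin D.n, T (D.e p.1 p.2) (u p) := by
  funext q
  have h1 : ∀ s : Finset (Fin D.m × Fin D.n), (∑ p ∈ s, T (D.e p.1 p.2) (u p)) q =
      ∑ p ∈ s, (D.e p.1 p.2) q • u p := by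
    classical
    intro s
    induction s using Finset.induction_on with
    | empty => rfl
    | insert p s hp ih => rw [sum_insert hp, sum_insert hp, ← ih]; rfl
  rw [h1, sum_eq_single q]
  · rw [e, dif_pos ⟨q.1.2, q.2.2⟩]; simp
  · intro p _ hp
    rw [e, dif_pos ⟨p.1.2, p.2.2⟩, Finsupp.single_eq_of_ne hp.symm, zero_smul]
  · simp

theorem exists_sum_modelVec (u : D.Model l lam hl hl' hlam N) : ∃ c : ℕ → N,
    u = ∑ i ∈ range (D.n * D.m), D.modelVec l lam hl hl' hlam N (i / D.n) (i % D.n) (c i) := by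
  have key : ∀ s : Finset (Fin D.m × Fin D.n), ∃ c : ℕ → N,
      ∑ p ∈ s, T (D.e p.1 p.2) (u p) =
        ∑ i ∈ range (D.n * D.m), D.modelVec l lam hl hl' hlam N (i / D.n) (i % D.n) (c i) := by
    classical
    intro s
    induction s using Finset.induction_on with
    | empty => exact ⟨fun _ => 0, by simp⟩
    | insert p s hp ih =>
      obtain ⟨c, hc⟩ := ih
      obtain ⟨j, hj, hj'⟩ := exists_pos (D := D) hl' p.2.2
      have hm := p.1.2
      have hr : D.n * p.1 + j ∈ range (D.n * D.m) := by
        rw [mem_range]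
        calc D.n * p.1 + j < D.n * p.1 + D.n := by omega
          _ = D.n * (p.1 + 1) := by ring
          _ ≤ D.n * D.m := Nat.mul_le_mul_left _ hm
      refine ⟨fun i => (if i = D.n * p.1 + j then u p else 0) + c i, ?_⟩
      rw [sum_insert hp, hc]
      simp_rw [map_add]
      rw [sum_add_distrib, add_left_inj, sum_eq_single (D.n * p.1 + j)]
      · rw [if_pos rfl, modelVec_apply, Nat.mul_add_mod, Nat.mod_eq_of_lt hj,
          Nat.mul_add_div n_pos, Nat.div_eq_of_lt hj, add_zero, Nat.mod_eq_of_lt hm,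
          Nat.div_eq_of_lt hm, hj', pow_zero, one_smul]
      · intro i _ hi
        rw [if_neg hi, map_zero]
      · intro h; exact absurd hr h
  obtain ⟨c, hc⟩ := key univ
  exact ⟨c, (eq_sum_tens u).trans hc⟩

theorem modelVec_idx_wt (i : ℕ) (v : N) :
    D.IsWt lam i (D.modelVec l lam hl hl' hlam N (i / D.n) (i % D.n) v) := by
  have := modelVec_wt (hl := hl) (hl' := hl') (hlam := hlam) (i / D.n) (Nat.mod_lt i n_pos) v
  rwa [Nat.div_add_mod] at this

theorem idem_smul_sum_modelVec {i : ℕ} (hi : i < D.n * D.m) (c : ℕ → N) :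
    D.idem (D.phi ^ i * lam) • ∑ j ∈ range (D.n * D.m),
      D.modelVec l lam hl hl' hlam N (j / D.n) (j % D.n) (c j) =
      D.modelVec l lam hl hl' hlam N (i / D.n) (i % D.n) (c i) := by
  rw [smul_sum, sum_eq_single i]
  · exact modelVec_idx_wt i _
  · intro j hj hji
    exact (modelVec_idx_wt j _).idem_smul (mem_range.mp hj) hi hji.symm
  · intro h; exact absurd (mem_range.mpr hi) h

theorem modelVec_add_m (hm : 0 < D.m) (q j : ℕ) (v : N) :
    D.modelVec l lam hl hl' hlam N (q + D.m) j v =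
      D.modelVec l lam hl hl' hlam N q j ((X : k[X]) • v) := by
  rw [modelVec_apply, modelVec_apply, Nat.add_mod_right, Nat.add_div_right _ hm, pow_succ, mul_smul]

/-- The model is a module of band type. -/
noncomputable def Model.band (hm : 0 < D.m) (hinj : ∀ v : N, (X : k[X]) • v = 0 → v = 0)
    (hsurj : ∀ v : N, ∃ v', (X : k[X]) • v' = v) :
    Band D l lam (D.Model l lam hl hl' hlam N) N where
  w i := D.modelVec l lam hl hl' hlam N (i / D.n) (i % D.n)
  wt := modelVec_idx_wt
  xi i v := by
    by_cases h : D.n ∣ i + 1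
    · rw [Nat.mod_eq_zero_of_dvd h, modelVec_apply, xi_smul_tens_zero (Nat.mod_lt _ hm),
        xiCoeff_zero, zero_smul]
    · rw [Nat.succ_div_of_not_dvd h, succ_mod_of_not_dvd h, modelVec_apply,
        xi_smul_tens_succ (Nat.mod_lt _ hm)]
      · rfl
      · have := Nat.mod_lt (i + 1) (n_pos (D := D))
        rwa [succ_mod_of_not_dvd h] at this
  xt i v h := by
    rw [Nat.mod_eq_zero_of_dvd h, Nat.succ_div_of_dvd h, mod_of_dvd_succ h, modelVec_apply,
      xt_smul_tens (Nat.mod_lt _ hm), modelVec_apply]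
    by_cases h1 : D.m ∣ i / D.n + 1
    -- When the block number reaches a multiple of `m`, the turn is complete: the factor `X` from
    -- the model is the additional power of `X` in `modelVec`.
    · have h2 : ¬ i / D.n % D.m + 1 < D.m := by
        intro h2
        rw [Nat.dvd_iff_mod_eq_zero, ← Nat.mod_add_mod, Nat.mod_eq_of_lt h2] at h1
        omega
      rw [if_neg h2, Nat.succ_div_of_dvd h1, Nat.mod_eq_zero_of_dvd h1, pow_succ', mul_smul]
    · have h2 : i / D.n % D.m + 1 < D.m := by
        refine lt_of_le_of_ne (Nat.mod_lt _ hm) fun h2 => h1 ?_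
        rw [Nat.dvd_iff_mod_eq_zero, ← Nat.mod_add_mod, h2, Nat.mod_self]
      rw [if_pos h2, Nat.succ_div_of_not_dvd h1, ← Nat.mod_add_mod (i / D.n), Nat.mod_eq_of_lt h2]
  per i v := by
    rw [Nat.add_mul_mod_self_left, Nat.add_mul_div_left _ _ n_pos, modelVec_add_m hm]
  inj i v h := by
    rw [modelVec_apply] at h
    have h1 := tens_e_eq_zero (Nat.mod_lt _ hm) (pos_lt hl' (Nat.mod_lt _ n_pos)) h
    revert h1
    induction i / D.n / D.m with
    | zero => intro h1; simpa using h1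
    | succ r ih => intro h1; exact ih (hinj _ (by rwa [pow_succ', mul_smul] at h1))
  surj i u h := by
    have hnm := Nat.mul_pos (n_pos (D := D)) hm
    have key : ∀ i, i < D.n * D.m → ∀ u : D.Model l lam hl hl' hlam N, D.IsWt lam i u →
        ∃ v, D.modelVec l lam hl hl' hlam N (i / D.n) (i % D.n) v = u := by
      intro i hi u h
      obtain ⟨c, hc⟩ := exists_sum_modelVec u
      exact ⟨c i, by rw [← h, hc, idem_smul_sum_modelVec hi]⟩
    induction i using Nat.strong_induction_on with
    | _ i ih =>
      by_cases hi : i < D.n * D.m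
      · exact key i hi u h
      · obtain ⟨j, rfl⟩ := Nat.exists_eq_add_of_le' (not_lt.mp hi)
        obtain ⟨v, rfl⟩ := ih j (by omega) (isWt_add_iff.mp h)
        -- One turn later the same vector has its coordinate divided by `X`.
        obtain ⟨v', rfl⟩ := hsurj v
        refine ⟨v', ?_⟩
        rw [Nat.add_mul_mod_self_left, Nat.add_mul_div_left _ _ n_pos, modelVec_add_m hm]
  span u := by
    obtain ⟨c, hc⟩ := exists_sum_modelVec u
    conv_rhs => rw [hc]
    refine sum_congr rfl fun i hi => ?_
    rw [hc, idem_smul_sum_modelVec (mem_range.mp hi)]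

/-- `k[X] / (X - η)` is a line on which `X` is the scalar `η`. Tensoring with a spanning vector `v₀`
specialises the action over `k[X]` to that on `M₁(l, λ, η)`. -/
theorem Model.nonempty_equiv_M1 (η : kˣ) (hl : 1 ≤ l) (hl' : l < D.n) (hlam : lam ∈ D.I l) :
    Nonempty (D.M1 l lam η hl hl' hlam ≃ₗ[D.Double]
      D.Model l lam hl hl' hlam (Jordan (η : k) 1)) := by
  have hrank := Jordan.finrank_eq (η := (η : k)) (t := 1)
  have := Jordan.finite (η : k) 1
  obtain ⟨v₀, hv₀, hgen⟩ := finrank_eq_one_iff'.mp hrank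
  have hX : (X : k[X]) • v₀ = (η : k) • v₀ := by
    have h : (X - C (η : k)) • v₀ = 0 := (congrArg (· • v₀) (pow_one _)).symm.trans
      (Jordan.pow_smul v₀)
    rw [sub_smul, sub_eq_zero] at h
    exact h.trans (algebraMap_smul k[X] (η : k) v₀)
  have hel : ∀ (y : Gen k G) (u : D.Space), D.el y • D.tens l lam hl hl' hlam _ u v₀ =
      D.tens l lam hl hl' hlam _ (D.genAction l lam η y u) v₀ := by
    intro y u
    rw [el_smul_tens, hX, genAction_eq, LinearMap.add_apply, map_add, LinearMap.smul_apply,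
      map_smul, map_smul, LinearMap.add_apply, LinearMap.smul_apply]
  have hd : ∀ (d : D.Double) (u : D.Space), D.tens l lam hl hl' hlam _
      ((RingQuot.liftAlgHom k ⟨FreeAlgebra.lift k (D.genAction l lam η),
        lift_rel η hl hl' hlam⟩ : D.Double →ₐ[k] Module.End k D.Space) d u) v₀ =
      d • D.tens l lam hl hl' hlam _ u v₀ := by
    intro d
    obtain ⟨f, rfl⟩ := RingQuot.mkAlgHom_surjective k D.Rel d
    rw [RingQuot.liftAlgHom_mkAlgHom_apply]
    induction f using FreeAlgebra.induction with
    | grade0 r => intro u; simp [Algebra.algebraMap_eq_smul_one]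
    | grade1 y => intro u; rw [FreeAlgebra.lift_ι_apply]; exact (hel y u).symm
    | mul a b ha hb => intro u; rw [map_mul, map_mul, mul_smul, Module.End.mul_apply, ha, hb]
    | add a b ha hb =>
      intro u
      rw [map_add, map_add, add_smul, LinearMap.add_apply, map_add, LinearMap.add_apply, ha, hb]
  let F : D.M1 l lam η hl hl' hlam →ₗ[D.Double] D.Model l lam hl hl' hlam (Jordan (η : k) 1) :=
    { toFun := fun u => D.tens l lam hl hl' hlam _ (u : D.Space) v₀
      map_add' := fun u u' => LinearMap.map_add₂ (D.tens l lam hl hl' hlam _) (u : D.Space) u' v₀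
      map_smul' := fun d u => hd d u }
  refine ⟨LinearEquiv.ofBijective F ⟨fun u u' h => ?_, fun f => ?_⟩⟩
  · refine Finsupp.ext (f := (u : D.Space)) (g := (u' : D.Space)) fun p => ?_
    exact smul_left_injective k hv₀ (congrFun h p)
  · choose c hc using fun p => hgen (f p)
    exact ⟨Finsupp.equivFunOnFinite.symm c, funext hc⟩

end ModelBand

end GroupDatum

namespace GroupDatum

open Finset Polynomial

/-! ### Identification of the modules `M_t(l, λ, η)` -/

section Classification

variable {k : Type u} [Field k] [IsAlgClosed k] [CharZero k] {G : Type v} [CommGroup G] [Finite G]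
  {D : GroupDatum k G} {l : ℕ} {lam : Weight k G}

/-- The module of band type with monodromy a Jordan block. -/
noncomputable def jordanBand (hl : 1 ≤ l) (hl' : l < D.n) (hlam : lam ∈ D.I l) (hm : 0 < D.m)
    (η : kˣ) (t : ℕ) :
    Band D l lam (D.Model l lam hl hl' hlam (Jordan (η : k) t)) (Jordan (η : k) t) :=
  Model.band hm (fun _ h => Jordan.X_injective η.ne_zero h)
    (fun v => Jordan.X_surjective η.ne_zero v)

/-- Induction on `t` through `band_of_extension`. The presentation depends only on the parameters,
so all choices of `M_t(l, λ, η)` are isomorphic. -/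
theorem nonempty_band_of_isM (hl : 1 ≤ l) (hl' : l < D.n) (hlam : lam ∈ D.I l) (hm : 0 < D.m)
    (η : kˣ) (t : ℕ) (M : Type w) [AddCommGroup M] [Module D.Double M] [Module k M]
    [IsScalarTower k D.Double M] (h : D.IsM l lam η hl hl' hlam t M) :
    Nonempty (Band D l lam M (Jordan (η : k) t)) := by
  obtain ⟨e₁⟩ := Model.nonempty_equiv_M1 η hl hl' hlam
  have b₁ := jordanBand hl hl' hlam hm η 1
  induction t generalizing M with
  | zero => exact h.elim
  | succ t ih =>
    cases t with
    | zero =>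
      obtain ⟨e⟩ := h
      exact ⟨b₁.congr (e.trans e₁).symm⟩
    | succ t =>
      obtain ⟨h1, P, hP, ⟨e⟩⟩ := h
      obtain ⟨b⟩ := ih P hP
      exact band_of_extension b (b₁.congr (e.trans e₁).symm) hl hl' hlam hm h1.1 h1.2.2.1

section Maps

variable {M : Type*} [AddCommGroup M] [Module D.Double M] [Module k M] [IsScalarTower k D.Double M]
  {M' : Type*} [AddCommGroup M'] [Module D.Double M'] [Module k M'] [IsScalarTower k D.Double M']
  {N : Type*} [AddCommGroup N] [Module k N] [Module k[X] N]
  {N' : Type*} [AddCommGroup N'] [Module k N'] [Module k[X] N']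

namespace Band

theorem coord_map (b : Band D l lam M N) (b' : Band D l lam M' N') {F : M →ₗ[D.Double] M'}
    {g : N → N'} (h : ∀ i v, F (b.w i v) = b'.w i (g v)) (i : ℕ) (u : M) :
    b'.coord i (F u) = g (b.coord i u) := by
  apply b'.injective i
  rw [w_coord, ← h, w_coord, map_smul]

theorem eq_zero_of_coord (b : Band D l lam M N) {u : M} (h : ∀ i, b.coord i u = 0) : u = 0 := by
  rw [← b.sum_coord u]
  exact sum_eq_zero fun i _ => by rw [h, map_zero]

/-- The socle layer of an isomorphism determines `l` and the orbit of `λ`. -/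
theorem eq_tau_pow {l' : ℕ} {lam' : Weight k G} (b : Band D l lam M N)
    (b' : Band D l' lam' M' N') [Nontrivial N] (hl : 1 ≤ l) (hln : l < D.n) (hlam : lam ∈ D.I l)
    (hl' : 1 ≤ l') (hln' : l' < D.n) (hlam' : lam' ∈ D.I l') (hm : 0 < D.m)
    (F : M ≃ₗ[D.Double] M') : l = l' ∧ ∃ q : ℕ, lam = (D.tau ^ q) lam' := by
  obtain ⟨v, hv⟩ := exists_ne (0 : N)
  have hg := b.good hl hln hlam hm
  have hg' := b'.good hl' hln' hlam' hm
  have hu : F (b.w 0 v) ≠ 0 := fun h => hv (b.inj 0 v (F.map_eq_zero_iff.mp h))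
  have hwt : D.IsWt lam 0 (F (b.w 0 v)) := (b.wt 0 v).map F.toLinearMap
  have hxi : D.el Gen.xi • F (b.w 0 v) = 0 := by
    rw [← map_smul, hg.xi_zero 0 _ (dvd_zero _) (b.wt 0 v), map_zero]
  -- A nonzero vector of weight `λ` in `M'` forces `λ` to occur among the weights `φ^i λ'`.
  obtain ⟨i, hi⟩ : ∃ i, D.phi ^ i * lam' = lam := by
    by_contra! hne
    apply hu
    rw [← b'.span (F (b.w 0 v))]
    refine sum_eq_zero fun i _ => hwt.idem_smul_of_ne ?_
    rw [pow_zero, one_mul]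
    exact hne i
  have hwt' : D.IsWt lam' i (F (b.w 0 v)) := by
    have h0 : D.phi ^ i * lam' = D.phi ^ 0 * lam := by rw [hi, pow_zero, one_mul]
    unfold IsWt at hwt ⊢
    rwa [h0]
  -- The vector is killed by `ξ`, which is injective at every place that is not the start of a
  -- block.
  have hdvd : D.n ∣ i := by
    cases i with
    | zero => exact dvd_zero _
    | succ i =>
      by_contra h
      exact hu (hg'.xi_inj i _ h hwt' hxi)
  obtain ⟨q, rfl⟩ := hdvd
  have hq := tau_pow_eq hl' hln' hlam' q
  rw [hi] at hq
  refine ⟨?_, q, hq.1.symm⟩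
  -- The permutation `τ` preserves `I_l`, so `λ(a χ⁻¹)` can be computed from either side.
  have h1 : D.rho ^ (l - 1) = D.rho ^ (l' - 1) := by
    rw [← hlam.2, ← hq.2.2, hq.1]
  have := pow_injOn_Iio_orderOf (x := D.rho) (show l - 1 < D.n by omega)
    (show l' - 1 < D.n by omega) h1
  omega

end Band

end Maps

/-- The exact sequence of Jordan modules, applied to coordinates, becomes an exact sequence of band
modules; the image of the first map is the submodule that the recursive definition requires. -/
theorem isM_of_band (hl : 1 ≤ l) (hl' : l < D.n) (hlam : lam ∈ D.I l) (hm : 0 < D.m)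
    (η : kˣ) (t : ℕ) (M : Type w) [AddCommGroup M] [Module D.Double M] [Module k M]
    [IsScalarTower k D.Double M] (b : Band D l lam M (Jordan (η : k) (t + 1))) :
    D.IsM l lam η hl hl' hlam (t + 1) M := by
  obtain ⟨e₁⟩ := Model.nonempty_equiv_M1 η hl hl' hlam
  have b₁ := jordanBand hl hl' hlam hm η 1
  induction t generalizing M with
  | zero =>
    obtain ⟨e⟩ := b.equiv_of_equiv b₁ hl hl' hlam hm (LinearEquiv.refl _ _)
    exact ⟨e.trans e₁.symm⟩
  | succ t ih =>
    have hfin := Jordan.finite (η : k) (t + 1 + 1)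
    have htype := b.isOfType hl hl' hlam hm (Jordan.indecomposable (by omega))
    rw [Jordan.finrank_eq] at htype
    obtain ⟨f, g, hf, hg, hfg⟩ := Jordan.exists_exact (η : k) (t + 1)
    have b' := jordanBand hl hl' hlam hm η (t + 1)
    obtain ⟨F, hF⟩ := b'.exists_map b hl hl' hlam hm f
    obtain ⟨H, hH⟩ := b.exists_map b₁ hl hl' hlam hm g
    have hFinj : Function.Injective F := by
      rw [injective_iff_map_eq_zero]
      intro u hu
      refine b'.eq_zero_of_coord fun i => ?_
      apply hf
      rw [← b'.coord_map b hF, hu, map_zero, map_zero]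
    have hHsurj : Function.Surjective H := by
      intro u
      choose c hc using fun i => hg (b₁.coord i u)
      refine ⟨∑ i ∈ range (D.n * D.m), b.w i (c i), ?_⟩
      rw [map_sum, ← b₁.sum_coord u]
      refine sum_congr rfl fun i _ => ?_
      rw [hH, hc]
    have hker : LinearMap.ker H = LinearMap.range F := by
      ext u
      rw [LinearMap.mem_ker, LinearMap.mem_range]
      constructor
      · intro hu
        have h1 : ∀ i, ∃ c, f c = b.coord i u := fun i => (hfg _).mp
          (by rw [← b.coord_map b₁ hH, hu, map_zero])
        choose c hc using h1
        refine ⟨∑ i ∈ range (D.n * D.m), b'.w i (c i), ?_⟩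
        rw [map_sum, ← b.sum_coord u]
        refine sum_congr rfl fun i _ => ?_
        rw [hF, hc]
      · rintro ⟨v, rfl⟩
        refine b₁.eq_zero_of_coord fun i => ?_
        rw [b.coord_map b₁ hH, b'.coord_map b hF]
        exact (hfg _).mpr ⟨_, rfl⟩
    refine ⟨htype, LinearMap.range F, ih _ (b'.congr (LinearEquiv.ofInjective F hFinj)), ?_⟩
    rw [← hker]
    exact ⟨(H.quotKerEquivOfSurjective hHsurj).trans e₁.symm⟩

end Classification

end GroupDatum

/-- The modules `M_t(l, λ, η)` exist, and any two models of them satisfy the isomorphism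
criterion. -/
theorem corollary4p21 {k : Type u} [Field k] [IsAlgClosed k] [CharZero k]
    {G : Type v} [CommGroup G] [Finite G] (D : GroupDatum k G) (hm : 1 < D.m) :
    (∀ (t l : ℕ) (lam : GroupDatum.Weight k G) (η : kˣ) (_ : 1 ≤ t) (hl : 1 ≤ l) (hl' : l < D.n)
        (hlam : lam ∈ D.I l),
      ∃ M : ModuleCat.{u} D.Double, D.IsM l lam η hl hl' hlam t M) ∧
    (∀ (t l : ℕ) (lam : GroupDatum.Weight k G) (η : kˣ) (_ : 1 ≤ t) (hl : 1 ≤ l) (hl' : l < D.n)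
        (hlam : lam ∈ D.I l)
        (t' l₁ : ℕ) (lam' : GroupDatum.Weight k G) (η' : kˣ) (_ : 1 ≤ t') (hl₁ : 1 ≤ l₁)
        (hl₁' : l₁ < D.n) (hlam' : lam' ∈ D.I l₁)
        (M : Type w) [AddCommGroup M] [Module D.Double M]
        (M' : Type*) [AddCommGroup M'] [Module D.Double M'],
      D.IsM l lam η hl hl' hlam t M → D.IsM l₁ lam' η' hl₁ hl₁' hlam' t' M' →
        (Nonempty (M ≃ₗ[D.Double] M') ↔
          t = t' ∧ l = l₁ ∧ η = η' ∧ ∃ z : ℤ, lam' = (D.tau ^ z) lam)) := by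
  have hm0 : 0 < D.m := by omega
  refine ⟨fun t l lam η ht hl hl' hlam => ?_, fun t l lam η ht hl hl' hlam t' l₁ lam' η' ht' hl₁ hl₁'
    hlam' M _ _ M' _ _ h h' => ?_⟩
  · obtain ⟨t, rfl⟩ := Nat.exists_eq_add_of_le' ht
    exact ⟨ModuleCat.of D.Double (D.Model l lam hl hl' hlam (Jordan (η : k) (t + 1))),
      GroupDatum.isM_of_band hl hl' hlam hm0 η t
        (D.Model l lam hl hl' hlam (Jordan (η : k) (t + 1)))
        (GroupDatum.jordanBand hl hl' hlam hm0 η (t + 1))⟩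
  -- The vector space structure is induced by the double, so linear maps over the double are
  -- automatically compatible with it.
  · let _ : Module k M := Module.compHom M (algebraMap k D.Double)
    let _ : Module k M' := Module.compHom M' (algebraMap k D.Double)
    have : IsScalarTower k D.Double M := ⟨fun c d u => by
      rw [Algebra.smul_def, mul_smul]; rfl⟩
    have : IsScalarTower k D.Double M' := ⟨fun c d u => by
      rw [Algebra.smul_def, mul_smul]; rfl⟩
    obtain ⟨b⟩ := GroupDatum.nonempty_band_of_isM hl hl' hlam hm0 η t M h
    obtain ⟨b'⟩ := GroupDatum.nonempty_band_of_isM hl₁ hl₁' hlam' hm0 η' t' M' h'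
    constructor
    · rintro ⟨e⟩
      have := (Jordan.indecomposable (η := (η : k)) ht).1
      -- Once `l` and the orbit agree, shifting the second presentation by `q` blocks gives both the
      -- base weight `λ`, and the Jordan modules can be compared.
      obtain ⟨rfl, q, hq⟩ := b.eq_tau_pow b' hl hl' hlam hl₁ hl₁' hlam' hm0 e
      obtain ⟨b''⟩ := b'.shift_pow hl hl' hlam' q
      rw [← hq] at b''
      obtain ⟨e'⟩ := b.equiv_of_equiv' b'' hl hl' hlam e
      obtain ⟨rfl, hη⟩ := Jordan.eq_of_equiv ht e'
      refine ⟨rfl, rfl, Units.ext hη, -q, ?_⟩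
      rw [hq, ← zpow_natCast, ← Equiv.Perm.mul_apply, ← zpow_add]
      simp
    · rintro ⟨rfl, rfl, rfl, z, hz⟩
      -- Presentations shift only by natural numbers, so for negative `z` the presentation of `M'`
      -- is shifted instead.
      obtain ⟨q, rfl | rfl⟩ := z.eq_nat_or_neg
      · obtain ⟨b''⟩ := b.shift_pow hl hl' hlam q
        rw [← zpow_natCast, ← hz] at b''
        exact b''.equiv_of_equiv b' hl hl' hlam' hm0 (LinearEquiv.refl _ _)
      · have hz' : lam = (D.tau ^ q) lam' := by
          rw [hz, ← zpow_natCast, ← Equiv.Perm.mul_apply, ← zpow_add]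
          simp
        obtain ⟨b''⟩ := b'.shift_pow hl hl' hlam' q
        rw [← hz'] at b''
        exact b.equiv_of_equiv b'' hl hl' hlam hm0 (LinearEquiv.refl _ _)
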